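/- **Conventions.** An *ordered blueprint* $B=(B^\bullet,B^+,\le)$ is a commutative semiring $B^+$ with a partial order that is compatible with addition and multiplication, together with a multiplicative submonoid $B^\bullet\ni 0,1$ that generates $B^+$ as a semiring. Morphisms are order-preserving semiring homomorphisms $B^+\to C^+$ with $B^\bullet\to C^\bullet$. For a set $S$ of relations, $B/\!\!/\langle S\rangle$ is the quotient by the smallest preorder that contains $\leq$ and $S$ and is closed under $+$ and $\cdot$ (where $x\equiv y$ means $x\le y$ and $y\le x$). Put $\mathbb F_1^\pm=\{0,1,\epsilon\}/\!\!/\langle 0\le 1+\epsilon\rangle$ and $\mathbb F_1^{\pm,sq}=\{0,1,-1\}/\!\!/\langle 0\equiv 1+(-1)\rangle$, with $\epsilon^2=1$ and $(-1)^2=1$; the second is an $\mathbb F_1^\pm$-algebra by $\epsilon\mapsto-1$. An element $b\in B^\bullet$ is a *weak inverse* of $a\in B^\bullet$ if $0\le a+b$. The *pasteurization* of $B$ is $B^\pm=(B\otimes_{\mathbb F_1}\mathbb F_1^\pm)/\!\!/\langle a\equiv a'\mid a,a'\text{ have a common weak inverse}\rangle$. A *partial field* $P=(P^\times,\pi_P)$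 is a commutative group $P^\times$ with a surjective ring homomorphism $\pi_P:\mathbb Z[P^\times]\to R_P$ such that (1) $P:=P^\times\cup\{0\}\to R_P$ is injective; (2) for every $a\in P^\times$ there is a unique $b\in P^\times$ with $\pi_P(a+b)=0$; (3) $\ker\pi_P$ is generated by the elements $a+b+c$ with $a,b,c\in P$ and $\pi_P(a+b+c)=0$. A morphism $P\to Q$ is a group homomorphism $P^\times\to Q^\times$ that extends to a ring homomorphism $R_P\to R_Q$; the same notion of morphism is used for pairs $(P^\times,\pi_P)$ that do not necessarily satisfy (1)–(3). Put $$P^{oblpr}=P/\!\!/\langle 0\le a+b+c\mid a,b,c\in P,\ \pi_P(a+b+c)=0\rangle,\qquad P^{blpr}=P/\!\!/\langle \textstyle\sum a_i\equiv\sum b_j\mid \sum\pi_P(a_i)=\sum\pi_P(b_j)\rangle .$$ The *regular partial field* is $\mathbb F_1^\pm=(\{\pm1\},\mathbb Z[\{\pm1\}]\to\mathbb Z)$, and $\mathbb F_2$ denotes the field with two elements as a partial field. Let $M$ be a matroid of rank $r$ on a finite totally ordered set $E$, with set of bases $\mathcal B$. For an $(r-2)$-subset $I$ of $E$ and $i_1,\dots,i_4\in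 E$ write $I_{k,l}=I\cup\{i_k,i_l\}$ and $x_{I,k,l}=x_{I_{k,l}}$ if $I_{k,l}\in\mathcal B$ and $x_{I,k,l}=0$ otherwise. Below, the $3$-term Plücker relations range over all $(r-2)$-subsets $I$ and all $i_1<i_2<i_3<i_4$ in $E\setminus I$. * The *weak universal pasture* is $k_M^w=\big((\mathbb F_1^\pm[x_J^{\pm1}\mid J\in\mathcal B]/\!\!/\langle 0\le x_{I,1,2}x_{I,3,4}+\epsilon x_{I,1,3}x_{I,2,4}+x_{I,1,4}x_{I,2,3}\rangle)_0\big)^\pm$, where $(-)_0$ is the degree-$0$ part for $\deg x_J=1$. The *foundation* $k_M^f\subseteq k_M^w$ is the subblueprint generated by the fundamental elements, i.e. the $a\in (k_M^w)^\bullet$ such that $0\le a+b+\epsilon^i$ for some $b\in (k_M^w)^\bullet$ and $i\in\{0,1\}$. * The *bracket ring* $B_M$ is the quotient of $\mathbb Z[x_J^{\pm1}\mid J\in\mathcal B]$ by the ideal generated by the elements $x_{I,1,2}x_{I,3,4}-x_{I,1,3}x_{I,2,4}+x_{I,1,4}x_{I,2,3}$. The *partial degree-$0$ bracket field* $P_{M,0}$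 has the group $P_{M,0}^\times=\{\pm\prod x_J^{e_J}\mid \sum e_J=0\}\subseteq B_M^\times$, and its ambient ring is the subring of $B_M$ generated by this group. The *universal partial field* $\mathbb P_M$ has the subgroup $\mathbb P_M^\times$ of $P_{M,0}^\times$ generated by $-1$ and all cross ratios $\frac{x_{I,1,2}\,x_{I,3,4}}{x_{I,2,3}\,x_{I,4,1}}$, for all $(r-2)$-subsets $I$ of $E$ and $i_1,\dots,i_4\in E$ such that $I_{1,2},I_{2,3},I_{3,4},I_{4,1}$ are bases; its ambient ring is the subring of $B_M$ generated by $\mathbb P_M^\times$. * A *weak Grassmann–Plücker function* representing $M$ over $P^{oblpr}$ is a function $\Delta$ from the $r$-subsets of $E$ to $P$ with $\Delta(J)\neq0$ if and only if $J\in\mathcal B$, and with $0\le\Delta(I_{1,2})\Delta(I_{3,4})+\epsilon\Delta(I_{1,3})\Delta(I_{2,4})+\Delta(I_{1,4})\Delta(I_{2,3})$ for all $I$, $i_1<i_2<i_3<i_4$ as above, where $\epsilon$ is the weak inverse of $1$. The set $\mathcal X_M^f(P^{oblpr})$ of *rescaling classes* is the set of these functions modulo $\Delta\sim\Delta'$ if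 $\Delta'(J)=a\cdot\prod_{j\in J}t(j)\cdot\Delta(J)$ for some $a\in P^\times$ and $t:E\to P^\times$. The matroid $M$ is *regular* if it is represented over $\mathbb Z$ by a totally unimodular $r\times E$-matrix (a set $J$ of $r$ columns is a basis if and only if its maximal minor is nonzero), and *binary* if it is represented by an $r\times E$-matrix over $\mathbb F_2$. **Theorem.** Let $M$ be a matroid on a finite totally ordered set $E$. 1. There is an isomorphism $\theta:k_M^w\otimes_{\mathbb F_1^\pm}\mathbb F_1^{\pm,sq}\to P_{M,0}^{blpr}$ with $\theta\big(\tfrac{x_I}{x_J}\otimes1\big)=\tfrac{x_I}{x_J}$ for all bases $I,J$ of $M$. It restricts to an isomorphism $\theta^f:k_M^f\otimes_{\mathbb F_1^\pm}\mathbb F_1^{\pm,sq}\to\mathbb P_M^{blpr}$, i.e. $\theta^f(a\otimes1)=\theta(a\otimes1)$ in $P_{M,0}^{blpr}$ for every $a\in (k_M^f)^+$. If $B_M\neq0$, then $\mathbb P_M$ is a partial field. 2. For every partial field $P$ there are bijections $$\mathcal X_M^f(P^{oblpr})\ \xrightarrow{\ e_1\ }\ \mathrm{Hom}(k_M^f,P^{oblpr})\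 \xrightarrow{\ e_2\ }\ \mathrm{Hom}(k_M^f\otimes_{\mathbb F_1^\pm}\mathbb F_1^{\pm,sq},P^{blpr})\ \xrightarrow{\ e_3\ }\ \mathrm{Hom}(\mathbb P_M,P)$$ that are natural with respect to morphisms $P\to Q$ of partial fields. Here $e_1([\Delta])$ is the restriction to $k_M^f$ of a morphism $\chi:k_M^w\to P^{oblpr}$ with $\chi(x_I/x_J)\,\Delta(J)=\Delta(I)$ for all bases $I,J$; the morphism $e_2(f)$ maps $a\otimes1$ to the image of $f(a)$ under the canonical map $P^{oblpr}\to P^{blpr}$; and $e_3(g)$ is characterized by $e_3(g)^{blpr}\circ\theta^f=g$. 3. $M$ is regular if and only if $\mathbb P_M\simeq\mathbb F_1^\pm$, and $M$ is binary if and only if $\mathbb P_M\simeq\mathbb F_1^\pm$ or $\mathbb P_M\simeq\mathbb F_2$. -/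

import Mathlib

universe u v w u₁ u₂ u₃

noncomputable section

/-! ### Ordered blueprints -/

/-- An ordered blueprint `B = (B•, B⁺, ≤)`: an ordered (commutative) semiring `B⁺ = carrier`
together with a multiplicative subset `B• = mon` that contains `0` and `1` and generates `B⁺` as a
semiring. -/
structure OrderedBlueprint : Type (u + 1) where
  carrier : Type u
  [semiring : CommSemiring carrier]
  [order : PartialOrder carrier]
  add_mono : ∀ x y z t : carrier, x ≤ y → z ≤ t → x + z ≤ y + t
  mul_mono : ∀ x y z t : carrier, x ≤ y → z ≤ t → x * z ≤ y * t
  mon : Submonoid carrier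
  zero_mem : (0 : carrier) ∈ mon
  closure_mon : Subsemiring.closure (mon : Set carrier) = ⊤

attribute [instance] OrderedBlueprint.semiring OrderedBlueprint.order

namespace OrderedBlueprint

/-- Morphisms of ordered blueprints: order preserving semiring morphisms `B⁺ → C⁺` that map `B•`
into `C•`. -/
@[ext]
structure Hom (B : OrderedBlueprint.{u}) (C : OrderedBlueprint.{v}) where
  toRingHom : B.carrier →+* C.carrier
  mono : ∀ x y, x ≤ y → toRingHom x ≤ toRingHom y
  map_mon : ∀ a ∈ B.mon, toRingHom a ∈ C.mon

namespace Hom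

def id (B : OrderedBlueprint.{u}) : Hom B B :=
  ⟨RingHom.id _, fun _ _ h => h, fun _ h => h⟩

/-- `f.comp g` is the composition `f ∘ g`. -/
def comp {B : OrderedBlueprint.{u}} {C : OrderedBlueprint.{v}} {D : OrderedBlueprint.{w}}
    (f : Hom C D) (g : Hom B C) : Hom B D :=
  ⟨f.toRingHom.comp g.toRingHom, fun x y h => f.mono _ _ (g.mono x y h),
    fun a h => f.map_mon _ (g.map_mon a h)⟩

/-- The restriction of a morphism to the underlying monoids. -/
def onMon {B : OrderedBlueprint.{u}} {C : OrderedBlueprint.{v}} (f : Hom B C) :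
    B.mon →* C.mon :=
  (f.toRingHom.toMonoidHom.comp B.mon.subtype).codRestrict C.mon
    (fun a => f.map_mon _ a.2)

end Hom

/-- Isomorphisms of ordered blueprints. -/
structure Iso (B : OrderedBlueprint.{u}) (C : OrderedBlueprint.{v}) where
  hom : Hom B C
  inv : Hom C B
  hom_inv : inv.comp hom = Hom.id B
  inv_hom : hom.comp inv = Hom.id C

/-! #### Ordered blueprints given by generators and relations -/

/-- The smallest preorder on a semiring that contains the relation `r` and that is closed under
addition and multiplication. -/
inductive GenLE {S : Type u} [CommSemiring S] (r : S → S → Prop) : S → S → Prop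
  | of (x y : S) : r x y → GenLE r x y
  | refl (x : S) : GenLE r x x
  | trans (x y z : S) : GenLE r x y → GenLE r y z → GenLE r x z
  | add (x y z t : S) : GenLE r x y → GenLE r z t → GenLE r (x + z) (y + t)
  | mul (x y z t : S) : GenLE r x y → GenLE r z t → GenLE r (x * z) (y * t)

/-- The congruence `x ≡ y` iff `x ≤ y` and `y ≤ x`, for the preorder generated by `r`. -/
def genCon {S : Type u} [CommSemiring S] (r : S → S → Prop) : RingCon S where
  r x y := GenLE r x y ∧ GenLE r y x
  iseqv :=
    { refl := fun x => ⟨GenLE.refl x, GenLE.refl x⟩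
      symm := fun h => ⟨h.2, h.1⟩
      trans := fun h k => ⟨GenLE.trans _ _ _ h.1 k.1, GenLE.trans _ _ _ k.2 h.2⟩ }
  mul' := fun h k => ⟨GenLE.mul _ _ _ _ h.1 k.1, GenLE.mul _ _ _ _ h.2 k.2⟩
  add' := fun h k => ⟨GenLE.add _ _ _ _ h.1 k.1, GenLE.add _ _ _ _ h.2 k.2⟩

/-- The order on the quotient semiring `S / ≡` that is induced by the generated preorder. -/
@[reducible]
def genOrder {S : Type u} [CommSemiring S] (r : S → S → Prop) :
    PartialOrder (genCon r).Quotient where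
  le p q := ∃ x y : S, (genCon r).mk' x = p ∧ (genCon r).mk' y = q ∧ GenLE r x y
  le_refl p := by
    obtain ⟨x, rfl⟩ := (genCon r).mk'_surjective p
    exact ⟨x, x, rfl, rfl, GenLE.refl x⟩
  le_trans p q s := by
    rintro ⟨x, y, rfl, rfl, h⟩ ⟨y', z, hy, rfl, k⟩
    have e : GenLE r y' y ∧ GenLE r y y' := (RingCon.eq (genCon r)).1 hy
    exact ⟨x, z, rfl, rfl, GenLE.trans _ _ _ h (GenLE.trans _ _ _ e.2 k)⟩
  le_antisymm p q := by
    rintro ⟨x, y, rfl, rfl, h⟩ ⟨y', x', hy, hx, k⟩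
    have ey : GenLE r y' y ∧ GenLE r y y' := (RingCon.eq (genCon r)).1 hy
    have ex : GenLE r x' x ∧ GenLE r x x' := (RingCon.eq (genCon r)).1 hx
    exact (RingCon.eq (genCon r)).2
      ⟨h, GenLE.trans _ _ _ ey.2 (GenLE.trans _ _ _ k ex.1)⟩

/-- The ordered blueprint `m ⫽ r`: its semiring is the quotient of `S` by the congruence `≡` of the
smallest preorder on `S` that contains `r` and is closed under addition and multiplication, its
order is induced by this preorder and its underlying monoid is the image of `m`. -/
def ofRel {S : Type u} [CommSemiring S] (m : Submonoid S) (h0 : (0 : S) ∈ m)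
    (hm : Subsemiring.closure (m : Set S) = ⊤) (r : S → S → Prop) : OrderedBlueprint.{u} where
  carrier := (genCon r).Quotient
  semiring := inferInstance
  order := genOrder r
  add_mono := by
    rintro _ _ _ _ ⟨x, y, rfl, rfl, h⟩ ⟨z, t, rfl, rfl, k⟩
    exact ⟨x + z, y + t, map_add _ _ _, map_add _ _ _, GenLE.add _ _ _ _ h k⟩
  mul_mono := by
    rintro _ _ _ _ ⟨x, y, rfl, rfl, h⟩ ⟨z, t, rfl, rfl, k⟩
    exact ⟨x * z, y * t, map_mul _ _ _, map_mul _ _ _, GenLE.mul _ _ _ _ h k⟩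
  mon := m.map ((genCon r).mk' : S →+* (genCon r).Quotient).toMonoidHom
  zero_mem := ⟨0, h0, map_zero ((genCon r).mk')⟩
  closure_mon := by
    have h := RingHom.map_closureS ((genCon r).mk') (m : Set S)
    rw [hm] at h
    have h2 : (Subsemiring.map (genCon r).mk' ⊤) = ⊤ := by
      rw [eq_top_iff]
      rintro p -
      obtain ⟨x, rfl⟩ := (genCon r).mk'_surjective p
      exact ⟨x, trivial, rfl⟩
    rw [h2] at h
    exact h.symm

/-- The quotient map `S → (m ⫽ r)⁺`. -/
def ofRelMk {S : Type u} [CommSemiring S] (m : Submonoid S) (h0 : (0 : S) ∈ m)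
    (hm : Subsemiring.closure (m : Set S) = ⊤) (r : S → S → Prop) :
    S →+* (ofRel m h0 hm r).carrier :=
  (genCon r).mk'

lemma ofRelMk_mem {S : Type u} [CommSemiring S] (m : Submonoid S) (h0 : (0 : S) ∈ m)
    (hm : Subsemiring.closure (m : Set S) = ⊤) (r : S → S → Prop) (a : S) (ha : a ∈ m) :
    ofRelMk m h0 hm r a ∈ (ofRel m h0 hm r).mon :=
  ⟨a, ha, rfl⟩

lemma ofRelMk_le {S : Type u} [CommSemiring S] (m : Submonoid S) (h0 : (0 : S) ∈ m)
    (hm : Subsemiring.closure (m : Set S) = ⊤) (r : S → S → Prop) (x y : S)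
    (h : GenLE r x y) : ofRelMk m h0 hm r x ≤ ofRelMk m h0 hm r y :=
  ⟨x, y, rfl, rfl, h⟩

lemma GenLE.map_le {S : Type u} [CommSemiring S] {r : S → S → Prop} {B : OrderedBlueprint.{v}}
    (f : S →+* B.carrier) (hr : ∀ x y, r x y → f x ≤ f y) {x y : S} (h : GenLE r x y) :
    f x ≤ f y := by
  induction h with
  | of x y h => exact hr x y h
  | refl x => exact le_rfl
  | trans x y z _ _ h k => exact h.trans k
  | add x y z t _ _ h k => rw [map_add, map_add]; exact B.add_mono _ _ _ _ h k
  | mul x y z t _ _ h k => rw [map_mul, map_mul]; exact B.mul_mono _ _ _ _ h k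

/-- The universal property of `m ⫽ r`. -/
def liftRel {S : Type u} [CommSemiring S] {m : Submonoid S} {h0 : (0 : S) ∈ m}
    {hm : Subsemiring.closure (m : Set S) = ⊤} {r : S → S → Prop} {B : OrderedBlueprint.{v}}
    (f : S →+* B.carrier) (hf : ∀ a ∈ m, f a ∈ B.mon) (hr : ∀ x y, r x y → f x ≤ f y) :
    Hom (ofRel m h0 hm r) B where
  toRingHom := (genCon r).lift f fun x y (h : GenLE r x y ∧ GenLE r y x) =>
    le_antisymm (h.1.map_le f hr) (h.2.map_le f hr)
  mono := by
    rintro _ _ ⟨x, y, rfl, rfl, h⟩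
    exact h.map_le f hr
  map_mon := by
    rintro _ ⟨a, ha, rfl⟩
    exact hf a ha

/-- The quotient `B ⫽ r` of an ordered blueprint by a set of relations. -/
def quot (B : OrderedBlueprint.{u}) (r : B.carrier → B.carrier → Prop) : OrderedBlueprint.{u} :=
  ofRel B.mon B.zero_mem B.closure_mon (fun x y => x ≤ y ∨ r x y)

/-- The quotient map `B → B ⫽ r`. -/
def quotMk (B : OrderedBlueprint.{u}) (r : B.carrier → B.carrier → Prop) : Hom B (B.quot r) where
  toRingHom := ofRelMk B.mon B.zero_mem B.closure_mon _
  mono x y h := ofRelMk_le _ _ _ _ x y (GenLE.of _ _ (Or.inl h))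
  map_mon a ha := ofRelMk_mem _ _ _ _ a ha

/-! #### Subblueprints -/

/-- The subblueprint of `B` given by a submonoid `m` of `B•` that contains `0`: its semiring is the
subsemiring of `B⁺` generated by `m`, with the restricted order. -/
def sub (B : OrderedBlueprint.{u}) (m : Submonoid B.carrier) (h0 : (0 : B.carrier) ∈ m) :
    OrderedBlueprint.{u} where
  carrier := Subsemiring.closure (m : Set B.carrier)
  semiring := inferInstance
  order := inferInstance
  add_mono x y z t h k := B.add_mono x.1 y.1 z.1 t.1 h k
  mul_mono x y z t h k := B.mul_mono x.1 y.1 z.1 t.1 h k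
  mon := m.comap (Subsemiring.closure (m : Set B.carrier)).subtype.toMonoidHom
  zero_mem := h0
  closure_mon := by
    rw [eq_top_iff]
    rintro ⟨x, hx⟩ -
    induction hx using Subsemiring.closure_induction with
    | mem a ha => exact Subsemiring.subset_closure ha
    | zero => exact Subsemiring.zero_mem _
    | one => exact Subsemiring.one_mem _
    | add a b ha hb h k => exact Subsemiring.add_mem _ h k
    | mul a b ha hb h k => exact Subsemiring.mul_mem _ h k

/-- The inclusion of a subblueprint. -/
def subIncl (B : OrderedBlueprint.{u}) (m : Submonoid B.carrier) (h0 : (0 : B.carrier) ∈ m)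
    (hm : m ≤ B.mon) : Hom (B.sub m h0) B where
  toRingHom := (Subsemiring.closure (m : Set B.carrier)).subtype
  mono _ _ h := h
  map_mon _ ha := hm ha

/-- A morphism whose image on underlying monoids lies in `m` factors through the subblueprint
of `m`. -/
def Hom.corestrict {A : OrderedBlueprint.{v}} {B : OrderedBlueprint.{u}} (f : Hom A B)
    (m : Submonoid B.carrier) (h0 : (0 : B.carrier) ∈ m)
    (h : ∀ a ∈ A.mon, f.toRingHom a ∈ m) : Hom A (B.sub m h0) where
  toRingHom := f.toRingHom.codRestrict (Subsemiring.closure (m : Set B.carrier)) (by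
    intro x
    have hx : x ∈ Subsemiring.closure (A.mon : Set A.carrier) := by
      rw [A.closure_mon]; trivial
    have h1 : Subsemiring.closure (A.mon : Set A.carrier) ≤
        (Subsemiring.closure (m : Set B.carrier)).comap f.toRingHom :=
      Subsemiring.closure_le.2 fun a ha => Subsemiring.subset_closure (h a ha)
    exact h1 hx)
  mono x y hxy := f.mono x y hxy
  map_mon a ha := h a ha

/-! #### Tensor products -/

section Tensor

open scoped TensorProduct

/-- The tensor product `C ⊗_A D`: its semiring is `C⁺ ⊗_{A⁺} D⁺` modulo the relations
`x ⊗ 1 ≤ y ⊗ 1` for `x ≤ y` in `C` and `1 ⊗ x ≤ 1 ⊗ y` for `x ≤ y` in `D`; its underlying monoid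
consists of the pure tensors `c ⊗ d` with `c ∈ C•` and `d ∈ D•`. -/
def tensor {A : OrderedBlueprint.{u₁}} {C : OrderedBlueprint.{u₂}} {D : OrderedBlueprint.{u₃}}
    (f : Hom A C) (g : Hom A D) : OrderedBlueprint.{max u₂ u₃} :=
  letI := f.toRingHom.toAlgebra
  letI := g.toRingHom.toAlgebra
  ofRel (S := C.carrier ⊗[A.carrier] D.carrier)
    { carrier := {x | ∃ c ∈ C.mon, ∃ d ∈ D.mon, x = c ⊗ₜ[A.carrier] d}
      one_mem' := ⟨1, C.mon.one_mem, 1, D.mon.one_mem, rfl⟩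
      mul_mem' := by
        rintro _ _ ⟨c, hc, d, hd, rfl⟩ ⟨c', hc', d', hd', rfl⟩
        exact ⟨c * c', C.mon.mul_mem hc hc', d * d', D.mon.mul_mem hd hd',
          Algebra.TensorProduct.tmul_mul_tmul c c' d d'⟩ }
    ⟨0, C.zero_mem, 0, D.zero_mem, (TensorProduct.zero_tmul _ _).symm⟩
    (by
      rw [eq_top_iff]
      rintro x -
      set K := Subsemiring.closure {x : C.carrier ⊗[A.carrier] D.carrier |
        ∃ c ∈ C.mon, ∃ d ∈ D.mon, x = c ⊗ₜ[A.carrier] d} with hK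
      have h1 : ∀ c : C.carrier, c ⊗ₜ[A.carrier] (1 : D.carrier) ∈ K := by
        intro c
        have hc : c ∈ Subsemiring.closure (C.mon : Set C.carrier) := by
          rw [C.closure_mon]; trivial
        have := Subsemiring.closure_le (s := (C.mon : Set C.carrier))
          (t := K.comap (Algebra.TensorProduct.includeLeftRingHom :
            C.carrier →+* C.carrier ⊗[A.carrier] D.carrier))
        exact this.2 (fun a ha =>
          Subsemiring.subset_closure ⟨a, ha, 1, D.mon.one_mem, rfl⟩) hc
      have h2 : ∀ d : D.carrier, (1 : C.carrier) ⊗ₜ[A.carrier] d ∈ K := by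
        intro d
        have hd : d ∈ Subsemiring.closure (D.mon : Set D.carrier) := by
          rw [D.closure_mon]; trivial
        have := Subsemiring.closure_le (s := (D.mon : Set D.carrier))
          (t := K.comap ((Algebra.TensorProduct.includeRight :
            D.carrier →ₐ[A.carrier] C.carrier ⊗[A.carrier] D.carrier) : _ →+* _))
        exact this.2 (fun a ha =>
          Subsemiring.subset_closure ⟨1, C.mon.one_mem, a, ha, rfl⟩) hd
      change x ∈ K
      induction x using TensorProduct.induction_on with
      | zero => exact K.zero_mem
      | add x y hx hy => exact K.add_mem hx hy
      | tmul c d =>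
        have := K.mul_mem (h1 c) (h2 d)
        rwa [Algebra.TensorProduct.tmul_mul_tmul, mul_one, one_mul] at this)
    (fun x y =>
      (∃ a b : C.carrier, a ≤ b ∧ x = a ⊗ₜ[A.carrier] 1 ∧ y = b ⊗ₜ[A.carrier] 1) ∨
      (∃ a b : D.carrier, a ≤ b ∧ x = 1 ⊗ₜ[A.carrier] a ∧ y = 1 ⊗ₜ[A.carrier] b))

/-- The canonical morphism `C → C ⊗_A D`, `c ↦ c ⊗ 1`. -/
def tensorInl {A : OrderedBlueprint.{u₁}} {C : OrderedBlueprint.{u₂}} {D : OrderedBlueprint.{u₃}}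
    (f : Hom A C) (g : Hom A D) : Hom C (tensor f g) :=
  letI := f.toRingHom.toAlgebra
  letI := g.toRingHom.toAlgebra
  { toRingHom := (ofRelMk _ _ _ _).comp (Algebra.TensorProduct.includeLeftRingHom :
      C.carrier →+* C.carrier ⊗[A.carrier] D.carrier)
    mono := fun x y h => ofRelMk_le _ _ _ _ _ _ (GenLE.of _ _ (Or.inl ⟨x, y, h, rfl, rfl⟩))
    map_mon := fun a ha => ofRelMk_mem _ _ _ _ _ ⟨a, ha, 1, D.mon.one_mem, rfl⟩ }

/-- The canonical morphism `D → C ⊗_A D`, `d ↦ 1 ⊗ d`. -/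
def tensorInr {A : OrderedBlueprint.{u₁}} {C : OrderedBlueprint.{u₂}} {D : OrderedBlueprint.{u₃}}
    (f : Hom A C) (g : Hom A D) : Hom D (tensor f g) :=
  letI := f.toRingHom.toAlgebra
  letI := g.toRingHom.toAlgebra
  { toRingHom := (ofRelMk _ _ _ _).comp ((Algebra.TensorProduct.includeRight :
      D.carrier →ₐ[A.carrier] C.carrier ⊗[A.carrier] D.carrier) : _ →+* _)
    mono := fun x y h => ofRelMk_le _ _ _ _ _ _ (GenLE.of _ _ (Or.inr ⟨x, y, h, rfl, rfl⟩))
    map_mon := fun a ha => ofRelMk_mem _ _ _ _ _ ⟨1, C.mon.one_mem, a, ha, rfl⟩ }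

end Tensor

/-! #### Monoid semirings `ℕ[G]`, the blueprints `𝔽₁`, `𝔽₁^±` and `𝔽₁^{±,sq}` -/

/-- The subset `G ∪ {0}` of the group semiring `ℕ[G]`. -/
def monomials (G : Type u) [CommGroup G] : Submonoid (MonoidAlgebra ℕ G) where
  carrier := {x | x = 0 ∨ ∃ a : G, x = MonoidAlgebra.of ℕ G a}
  one_mem' := Or.inr ⟨1, (map_one _).symm⟩
  mul_mem' := by
    rintro _ _ (rfl | ⟨a, rfl⟩) (rfl | ⟨b, rfl⟩)
    · exact Or.inl (mul_zero _)
    · exact Or.inl (zero_mul _)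
    · exact Or.inl (mul_zero _)
    · exact Or.inr ⟨a * b, (map_mul _ _ _).symm⟩

lemma closure_monomials (G : Type u) [CommGroup G] :
    Subsemiring.closure (monomials G : Set (MonoidAlgebra ℕ G)) = ⊤ := by
  rw [eq_top_iff]
  rintro x -
  induction x using MonoidAlgebra.induction_on with
  | of a => exact Subsemiring.subset_closure (Or.inr ⟨a, rfl⟩)
  | add x y hx hy => exact add_mem hx hy
  | smul n x hx => exact nsmul_mem hx n

/-- The ordered blueprint `(G ∪ {0}) ⫽ r` with semiring `ℕ[G] / ≡`. -/
def ofGroup (G : Type u) [CommGroup G] (r : MonoidAlgebra ℕ G → MonoidAlgebra ℕ G → Prop) :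
    OrderedBlueprint.{u} :=
  ofRel (monomials G) (Or.inl rfl) (closure_monomials G) r

/-- The quotient map `ℕ[G] → ((G ∪ {0}) ⫽ r)⁺`. -/
def ofGroupProj (G : Type u) [CommGroup G] (r : MonoidAlgebra ℕ G → MonoidAlgebra ℕ G → Prop) :
    MonoidAlgebra ℕ G →+* (ofGroup G r).carrier :=
  ofRelMk (monomials G) (Or.inl rfl) (closure_monomials G) r

lemma ofGroupProj_mem (G : Type u) [CommGroup G]
    (r : MonoidAlgebra ℕ G → MonoidAlgebra ℕ G → Prop) (a : MonoidAlgebra ℕ G)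
    (ha : a ∈ monomials G) : ofGroupProj G r a ∈ (ofGroup G r).mon :=
  ofRelMk_mem _ _ _ _ a ha

lemma ofGroupProj_le (G : Type u) [CommGroup G]
    (r : MonoidAlgebra ℕ G → MonoidAlgebra ℕ G → Prop) (x y : MonoidAlgebra ℕ G) (h : r x y) :
    ofGroupProj G r x ≤ ofGroupProj G r y :=
  ofRelMk_le _ _ _ _ x y (GenLE.of _ _ h)

/-- The universal property of `(G ∪ {0}) ⫽ r`. -/
def ofGroupLift {G : Type u} [CommGroup G] {r : MonoidAlgebra ℕ G → MonoidAlgebra ℕ G → Prop}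
    {B : OrderedBlueprint.{v}} (f : MonoidAlgebra ℕ G →+* B.carrier)
    (hf : ∀ a ∈ monomials G, f a ∈ B.mon) (hr : ∀ x y, r x y → f x ≤ f y) :
    Hom (ofGroup G r) B :=
  liftRel f hf hr

/-- The class of `a ∈ G` in `(G ∪ {0}) ⫽ r`. -/
def ofGroupMk (G : Type u) [CommGroup G] (r : MonoidAlgebra ℕ G → MonoidAlgebra ℕ G → Prop) :
    G →* (ofGroup G r).mon :=
  ((ofGroupProj G r).toMonoidHom.comp (MonoidAlgebra.of ℕ G)).codRestrict (ofGroup G r).mon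
    (fun a => ofGroupProj_mem G r _ (Or.inr ⟨a, rfl⟩))

/-- `𝔽₁ = ({0, 1}, ℕ, =)`. -/
def F1 : OrderedBlueprint.{0} where
  carrier := ℕ
  semiring := inferInstance
  order :=
    { le := Eq
      lt := fun _ _ => False
      lt_iff_le_not_ge := fun _ _ => ⟨False.elim, fun h => h.2 h.1.symm⟩
      le_refl := fun _ => rfl
      le_trans := fun _ _ _ => Eq.trans
      le_antisymm := fun _ _ h _ => h }
  add_mono x y z t h k := congrArg₂ (· + ·) h k
  mul_mono x y z t h k := congrArg₂ (· * ·) h k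
  mon :=
    { carrier := {x | x = 0 ∨ x = 1}
      one_mem' := Or.inr rfl
      mul_mem' := by
        rintro _ _ (rfl | rfl) (rfl | rfl)
        · exact Or.inl rfl
        · exact Or.inl rfl
        · exact Or.inl rfl
        · exact Or.inr rfl }
  zero_mem := Or.inl rfl
  closure_mon := by
    rw [eq_top_iff]
    rintro x -
    exact natCast_mem (Subsemiring.closure _) x

/-- The unique morphism `𝔽₁ → B`. -/
def F1.toHom (B : OrderedBlueprint.{u}) : Hom F1 B where
  toRingHom := Nat.castRingHom B.carrier
  mono x y h := by
    have h' : x = y := h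
    rw [h']
  map_mon := by
    rintro _ (rfl | rfl)
    · change ((0 : ℕ) : B.carrier) ∈ B.mon
      rw [Nat.cast_zero]; exact B.zero_mem
    · change ((1 : ℕ) : B.carrier) ∈ B.mon
      rw [Nat.cast_one]; exact B.mon.one_mem

/-- `𝔽₁^± = {0, 1, ε} ⫽ ⟨0 ≤ 1 + ε⟩`, where `{1, ε}` is the group `ℤˣ` and `ε = -1 ∈ ℤˣ`. -/
def F1pm : OrderedBlueprint.{0} :=
  ofGroup ℤˣ fun x y => x = 0 ∧ y = 1 + MonoidAlgebra.of ℕ ℤˣ (-1)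

/-- `𝔽₁^{±,sq} = {0, 1, -1} ⫽ ⟨0 ≡ 1 + (-1)⟩`. -/
def F1sq : OrderedBlueprint.{0} :=
  ofGroup ℤˣ fun x y =>
    (x = 0 ∧ y = 1 + MonoidAlgebra.of ℕ ℤˣ (-1)) ∨ (y = 0 ∧ x = 1 + MonoidAlgebra.of ℕ ℤˣ (-1))

/-- The canonical morphism `𝔽₁^± → 𝔽₁^{±,sq}`. -/
def F1pm.toSq : Hom F1pm F1sq :=
  ofGroupLift (ofGroupProj ℤˣ _) (ofGroupProj_mem ℤˣ _)
    (fun x y h => ofGroupProj_le ℤˣ _ x y (Or.inl h))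

/-- `B ⊗_{𝔽₁^±} 𝔽₁^{±,sq}` for an `𝔽₁^±`-algebra `f : 𝔽₁^± → B`. -/
def tensorSq {B : OrderedBlueprint.{u}} (f : Hom F1pm B) : OrderedBlueprint.{u} :=
  tensor f F1pm.toSq

/-- The canonical morphism `B → B ⊗_{𝔽₁^±} 𝔽₁^{±,sq}`, `a ↦ a ⊗ 1`. -/
def toTensorSq {B : OrderedBlueprint.{u}} (f : Hom F1pm B) : Hom B (tensorSq f) :=
  tensorInl f F1pm.toSq

/-! #### Weak inverses, pasteurization, foundations -/

/-- `b` is a weak inverse of `a` if `0 ≤ a + b`. -/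
def IsWeakInverse (B : OrderedBlueprint.{u}) (a b : B.carrier) : Prop :=
  a ∈ B.mon ∧ b ∈ B.mon ∧ 0 ≤ a + b

/-- `B` is pasteurized if every `a ∈ B•` has a unique weak inverse `b ∈ B•`. -/
def IsPasteurized (B : OrderedBlueprint.{u}) : Prop :=
  ∀ a ∈ B.mon, ∃! b, B.IsWeakInverse a b

/-- The pasteurization
`B^± = (B ⊗_{𝔽₁} 𝔽₁^±) ⫽ ⟨a ≡ a' | 0 ≤ a + b and 0 ≤ a' + b for some b⟩`. -/
def pasteurization (B : OrderedBlueprint.{u}) : OrderedBlueprint.{u} :=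
  (tensor (F1.toHom B) (F1.toHom F1pm)).quot fun a a' =>
    ∃ b, (tensor (F1.toHom B) (F1.toHom F1pm)).IsWeakInverse a b ∧
      (tensor (F1.toHom B) (F1.toHom F1pm)).IsWeakInverse a' b

/-- The canonical morphism `B → B^±`. -/
def toPasteurization (B : OrderedBlueprint.{u}) : Hom B B.pasteurization :=
  (quotMk _ _).comp (tensorInl (F1.toHom B) (F1.toHom F1pm))

/-- The canonical morphism `𝔽₁^± → B^±`. -/
def F1pmToPasteurization (B : OrderedBlueprint.{u}) : Hom F1pm B.pasteurization :=
  (quotMk _ _).comp (tensorInr (F1.toHom B) (F1.toHom F1pm))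

/-- A fundamental element of a pasteurized ordered blueprint is an element `a ∈ B•` with
`0 ≤ a + b + ε^i` for some `b ∈ B•` and `i ∈ {0, 1}`, where `ε` is the weak inverse of `1`. -/
def IsFundamental (B : OrderedBlueprint.{u}) (a : B.carrier) : Prop :=
  a ∈ B.mon ∧ ∃ b ∈ B.mon, ∃ e, B.IsWeakInverse 1 e ∧ (0 ≤ a + b + 1 ∨ 0 ≤ a + b + e)

/-- The submonoid of `B•` generated by `0` and the fundamental elements (`0` itself is fundamental
if `B` is pasteurized). -/
def foundationMon (B : OrderedBlueprint.{u}) : Submonoid B.carrier :=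
  Submonoid.closure ({0} ∪ {a | B.IsFundamental a})

lemma zero_mem_foundationMon (B : OrderedBlueprint.{u}) : (0 : B.carrier) ∈ B.foundationMon :=
  Submonoid.subset_closure (Or.inl rfl)

lemma foundationMon_le (B : OrderedBlueprint.{u}) : B.foundationMon ≤ B.mon := by
  refine Submonoid.closure_le.2 ?_
  rintro a (rfl | ha)
  · exact B.zero_mem
  · exact ha.1

/-- The foundation of `B`: the subblueprint generated by the fundamental elements. -/
def foundation (B : OrderedBlueprint.{u}) : OrderedBlueprint.{u} :=
  B.sub B.foundationMon B.zero_mem_foundationMon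

/-- The inclusion of the foundation. -/
def foundationIncl (B : OrderedBlueprint.{u}) : Hom B.foundation B :=
  B.subIncl _ _ B.foundationMon_le

/-- A morphism `𝔽₁^± → B` takes values in the foundation of `B`. -/
def F1pmToFoundation {B : OrderedBlueprint.{u}} (f : Hom F1pm B) : Hom F1pm B.foundation :=
  f.corestrict B.foundationMon B.zero_mem_foundationMon (by
    have key : B.IsWeakInverse 1
        (f.toRingHom (ofGroupProj ℤˣ _ (MonoidAlgebra.of ℕ ℤˣ (-1)))) := by
      refine ⟨B.mon.one_mem, f.map_mon _ (ofGroupProj_mem ℤˣ _ _ (Or.inr ⟨-1, rfl⟩)), ?_⟩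
      have h := f.mono _ _ (ofGroupProj_le ℤˣ
        (fun x y => x = 0 ∧ y = 1 + MonoidAlgebra.of ℕ ℤˣ (-1)) _ _ ⟨rfl, rfl⟩)
      have e0 := map_zero (f.toRingHom.comp (ofGroupProj ℤˣ
        (fun x y => x = 0 ∧ y = 1 + MonoidAlgebra.of ℕ ℤˣ (-1))))
      have e1 := map_add (f.toRingHom.comp (ofGroupProj ℤˣ
        (fun x y => x = 0 ∧ y = 1 + MonoidAlgebra.of ℕ ℤˣ (-1)))) 1 (MonoidAlgebra.of ℕ ℤˣ (-1))
      rw [map_one] at e1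
      exact (e0.symm.le.trans h).trans e1.le
    rintro _ ⟨a, (rfl | ⟨s, rfl⟩), rfl⟩
    · have : f.toRingHom 0 ∈ B.foundationMon := by
        rw [map_zero]; exact B.zero_mem_foundationMon
      exact this
    · rcases Int.units_eq_one_or s with rfl | rfl
      · have : f.toRingHom 1 ∈ B.foundationMon := by
          rw [map_one]; exact B.foundationMon.one_mem
        exact this
      · refine Submonoid.subset_closure (Or.inr ⟨key.2.1, 0, B.zero_mem, _, key, Or.inl ?_⟩)
        have h := key.2.2
        rw [add_comm] at h
        rw [add_zero]
        exact h)

end OrderedBlueprint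

/-! ### Partial fields -/

/-- A pair `(P^×, π_P)` of a commutative group `P^× = G` and a surjective ring homomorphism
`π_P : ℤ[P^×] → R_P`, subject to no further axioms. -/
structure PartialFieldDatum : Type (u + 1) where
  G : Type u
  R : Type u
  [group : CommGroup G]
  [ring : CommRing R]
  π : MonoidAlgebra ℤ G →+* R
  surj : Function.Surjective π

attribute [instance] PartialFieldDatum.group PartialFieldDatum.ring

namespace PartialFieldDatum

/-- The subset `P = P^× ∪ {0}` of `ℤ[P^×]`. -/
def elements (P : PartialFieldDatum.{u}) : Set (MonoidAlgebra ℤ P.G) :=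
  {0} ∪ Set.range (MonoidAlgebra.of ℤ P.G)

/-- The axioms (PF1), (PF2) and (PF3) of a partial field. -/
structure IsPartialField (P : PartialFieldDatum.{u}) : Prop where
  injOn : Set.InjOn P.π P.elements
  neg : ∀ a : P.G, ∃! b : P.G, P.π (MonoidAlgebra.of ℤ P.G a + MonoidAlgebra.of ℤ P.G b) = 0
  ker : RingHom.ker P.π = Ideal.span {x | P.π x = 0 ∧
    ∃ a ∈ P.elements, ∃ b ∈ P.elements, ∃ c ∈ P.elements, x = a + b + c}

/-- Morphisms of partial fields: group homomorphisms `P^× → Q^×` that extend to a ring homomorphism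
`R_P → R_Q`. -/
@[ext]
structure Hom (P : PartialFieldDatum.{u}) (Q : PartialFieldDatum.{v}) where
  toMonoidHom : P.G →* Q.G
  exists_ringHom : ∃ g : P.R →+* Q.R, ∀ a : P.G,
    g (P.π (MonoidAlgebra.of ℤ P.G a)) = Q.π (MonoidAlgebra.of ℤ Q.G (toMonoidHom a))

/-- The identity morphism. -/
def Hom.id (P : PartialFieldDatum.{u}) : Hom P P :=
  ⟨MonoidHom.id _, RingHom.id _, fun _ => rfl⟩

/-- `f.comp g` is the composition `f ∘ g`. -/
def Hom.comp {P : PartialFieldDatum.{u}} {Q : PartialFieldDatum.{v}} {T : PartialFieldDatum.{w}}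
    (f : Hom Q T) (g : Hom P Q) : Hom P T :=
  ⟨f.toMonoidHom.comp g.toMonoidHom, by
    obtain ⟨φ, hφ⟩ := f.exists_ringHom
    obtain ⟨ψ, hψ⟩ := g.exists_ringHom
    exact ⟨φ.comp ψ, fun a => by
      rw [RingHom.comp_apply, hψ, hφ]; rfl⟩⟩

/-- `P` and `Q` are isomorphic. -/
def Isomorphic (P : PartialFieldDatum.{u}) (Q : PartialFieldDatum.{v}) : Prop :=
  ∃ (f : Hom P Q) (g : Hom Q P), g.comp f = Hom.id P ∧ f.comp g = Hom.id Q

/-- The restriction `ℕ[P^×] → R_P`, `∑ a_i ↦ ∑ π_P(a_i)`, of `π_P`. -/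
def natπ (P : PartialFieldDatum.{u}) : MonoidAlgebra ℕ P.G →+* P.R :=
  (MonoidAlgebra.lift ℕ P.R P.G (P.π.toMonoidHom.comp (MonoidAlgebra.of ℤ P.G))).toRingHom

lemma natπ_of (P : PartialFieldDatum.{u}) (a : P.G) :
    P.natπ (MonoidAlgebra.of ℕ P.G a) = P.π (MonoidAlgebra.of ℤ P.G a) :=
  MonoidAlgebra.lift_of _ _

/-- `P^oblpr = P ⫽ ⟨0 ≤ a + b + c | a, b, c ∈ P, π_P(a + b + c) = 0⟩`. -/
def oblpr (P : PartialFieldDatum.{u}) : OrderedBlueprint.{u} :=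
  OrderedBlueprint.ofGroup P.G fun x y => x = 0 ∧ P.natπ y = 0 ∧
    ∃ a ∈ OrderedBlueprint.monomials P.G, ∃ b ∈ OrderedBlueprint.monomials P.G,
      ∃ c ∈ OrderedBlueprint.monomials P.G, y = a + b + c

/-- `P^blpr = P ⫽ ⟨∑ a_i ≡ ∑ b_j | ∑ π_P(a_i) = ∑ π_P(b_j)⟩`. -/
def blpr (P : PartialFieldDatum.{u}) : OrderedBlueprint.{u} :=
  OrderedBlueprint.ofGroup P.G fun x y => P.natπ x = P.natπ y

/-- The class of `a ∈ P^×` in `P^blpr`. -/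
def toBlpr (P : PartialFieldDatum.{u}) : P.G →* P.blpr.mon :=
  OrderedBlueprint.ofGroupMk P.G _

/-- The morphism `P^oblpr → P^blpr` induced by the identity of `P`. -/
def oblprToBlpr (P : PartialFieldDatum.{u}) : OrderedBlueprint.Hom P.oblpr P.blpr :=
  OrderedBlueprint.ofGroupLift (OrderedBlueprint.ofGroupProj P.G _)
    (OrderedBlueprint.ofGroupProj_mem P.G _)
    (fun x y h => OrderedBlueprint.ofGroupProj_le P.G _ x y (by
      rw [h.1, h.2.1, map_zero]))

/-- The linear extension `ℕ[P^×] → ℕ[Q^×]` of a morphism. -/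
def Hom.natMap {P : PartialFieldDatum.{u}} {Q : PartialFieldDatum.{v}} (f : Hom P Q) :
    MonoidAlgebra ℕ P.G →+* MonoidAlgebra ℕ Q.G :=
  (MonoidAlgebra.lift ℕ (MonoidAlgebra ℕ Q.G) P.G
    ((MonoidAlgebra.of ℕ Q.G).comp f.toMonoidHom)).toRingHom

lemma Hom.natMap_of {P : PartialFieldDatum.{u}} {Q : PartialFieldDatum.{v}} (f : Hom P Q)
    (a : P.G) : f.natMap (MonoidAlgebra.of ℕ P.G a) = MonoidAlgebra.of ℕ Q.G (f.toMonoidHom a) :=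
  MonoidAlgebra.lift_of _ _

lemma Hom.natMap_mem {P : PartialFieldDatum.{u}} {Q : PartialFieldDatum.{v}} (f : Hom P Q)
    (x : MonoidAlgebra ℕ P.G) (hx : x ∈ OrderedBlueprint.monomials P.G) :
    f.natMap x ∈ OrderedBlueprint.monomials Q.G := by
  rcases hx with rfl | ⟨a, rfl⟩
  · exact Or.inl (map_zero _)
  · exact Or.inr ⟨_, f.natMap_of a⟩

lemma Hom.natπ_natMap {P : PartialFieldDatum.{u}} {Q : PartialFieldDatum.{v}} (f : Hom P Q)
    (g : P.R →+* Q.R) (hg : ∀ a : P.G,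
      g (P.π (MonoidAlgebra.of ℤ P.G a)) = Q.π (MonoidAlgebra.of ℤ Q.G (f.toMonoidHom a)))
    (x : MonoidAlgebra ℕ P.G) : Q.natπ (f.natMap x) = g (P.natπ x) := by
  induction x using MonoidAlgebra.induction_on with
  | of a => rw [f.natMap_of, natπ_of, natπ_of, hg]
  | add x y hx hy => rw [map_add, map_add, map_add, map_add, hx, hy]
  | smul n x hx => rw [map_nsmul, map_nsmul, map_nsmul, map_nsmul, hx]

/-- The morphism `P^oblpr → Q^oblpr` induced by `f : P → Q`. -/
def Hom.oblpr {P : PartialFieldDatum.{u}} {Q : PartialFieldDatum.{v}} (f : Hom P Q) :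
    OrderedBlueprint.Hom P.oblpr Q.oblpr :=
  OrderedBlueprint.ofGroupLift ((OrderedBlueprint.ofGroupProj Q.G _).comp f.natMap)
    (fun a ha => OrderedBlueprint.ofGroupProj_mem Q.G _ _ (f.natMap_mem a ha))
    (by
      rintro x y ⟨rfl, h, a, ha, b, hb, c, hc, rfl⟩
      refine OrderedBlueprint.ofGroupProj_le Q.G _ _ _ ?_
      obtain ⟨g, hg⟩ := f.exists_ringHom
      refine ⟨map_zero _, ?_, f.natMap a, f.natMap_mem a ha, f.natMap b, f.natMap_mem b hb,
        f.natMap c, f.natMap_mem c hc, ?_⟩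
      · rw [f.natπ_natMap g hg, h, map_zero]
      · rw [map_add, map_add])

/-- The morphism `P^blpr → Q^blpr` induced by `f : P → Q`. -/
def Hom.blpr {P : PartialFieldDatum.{u}} {Q : PartialFieldDatum.{v}} (f : Hom P Q) :
    OrderedBlueprint.Hom P.blpr Q.blpr :=
  OrderedBlueprint.ofGroupLift ((OrderedBlueprint.ofGroupProj Q.G _).comp f.natMap)
    (fun a ha => OrderedBlueprint.ofGroupProj_mem Q.G _ _ (f.natMap_mem a ha))
    (by
      intro x y h
      refine OrderedBlueprint.ofGroupProj_le Q.G _ _ _ ?_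
      obtain ⟨g, hg⟩ := f.exists_ringHom
      rw [f.natπ_natMap g hg, f.natπ_natMap g hg, show P.natπ x = P.natπ y from h])

/-- The ring homomorphism `ℤ[G] → A` given by a subgroup `G` of the unit group of `A`. -/
def unitsLift (A : Type u) [CommRing A] (G : Subgroup Aˣ) : MonoidAlgebra ℤ G →+* A :=
  (MonoidAlgebra.lift ℤ A G ((Units.coeHom A).comp G.subtype)).toRingHom

/-- The pair given by a subgroup `G` of the unit group of a ring `A`: the ambient ring is the
subring of `A` that is generated by `G`. -/
def ofUnits (A : Type u) [CommRing A] (G : Subgroup Aˣ) : PartialFieldDatum.{u} where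
  G := G
  R := (unitsLift A G).range
  π := (unitsLift A G).rangeRestrict
  surj := (unitsLift A G).rangeRestrict_surjective

lemma unitsLift_of (A : Type u) [CommRing A] (G : Subgroup Aˣ) (a : G) :
    unitsLift A G (MonoidAlgebra.of ℤ G a) = ((a : Aˣ) : A) :=
  MonoidAlgebra.lift_of _ _

/-- For subgroups `G ≤ H` of `Aˣ`, the inclusion of the associated pairs. -/
def ofUnitsIncl (A : Type u) [CommRing A] {G H : Subgroup Aˣ} (h : G ≤ H) :
    Hom (ofUnits A G) (ofUnits A H) where
  toMonoidHom := Subgroup.inclusion h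
  exists_ringHom := by
    refine ⟨Subring.inclusion ?_, ?_⟩
    · rintro _ ⟨x, rfl⟩
      induction x using MonoidAlgebra.induction_on with
      | of a =>
        exact ⟨MonoidAlgebra.of ℤ H (Subgroup.inclusion h a), by
          rw [unitsLift_of, unitsLift_of]; rfl⟩
      | add x y hx hy => rw [map_add]; exact add_mem hx hy
      | smul n x hx => rw [map_zsmul]; exact zsmul_mem hx n
    · intro a
      apply Subtype.ext
      exact (unitsLift_of A G a).trans (unitsLift_of A H (Subgroup.inclusion h a)).symm

end PartialFieldDatum

/-- A partial field. -/
structure PartialField : Type (u + 1) extends PartialFieldDatum.{u} where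
  isPartialField : toPartialFieldDatum.IsPartialField

/-- The regular partial field `𝔽₁^± = ({±1}, ℤ[{±1}] → ℤ)`. -/
def regularPartialField : PartialFieldDatum.{0} := PartialFieldDatum.ofUnits ℤ ⊤

/-- The field `𝔽₂` as a partial field. -/
def partialFieldF2 : PartialFieldDatum.{0} := PartialFieldDatum.ofUnits (ZMod 2) ⊤

/-! ### Matroids -/

namespace Matroid

variable {E : Type u} [LinearOrder E]

/-- The `r × E`-matrix `A` represents `M`: for every `r`-subset `J` of `E`, the maximal minor of `A`
in the columns `J` is nonzero if and only if `J` is a basis (and all bases have `r` elements). -/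
def IsRepresentedBy (M : Matroid E) {R : Type v} [CommRing R] {r : ℕ}
    (A : Matrix (Fin r) E R) : Prop :=
  ∀ J : Finset E, M.IsBase (J : Set E) ↔
    ∃ h : J.card = r, (A.submatrix id (J.orderEmbOfFin h)).det ≠ 0

/-- `M` is regular: it is represented over `ℤ` by a totally unimodular matrix. -/
def IsRegularMatroid (M : Matroid E) : Prop :=
  ∃ (r : ℕ) (A : Matrix (Fin r) E ℤ), A.IsTotallyUnimodular ∧ M.IsRepresentedBy A

/-- `M` is binary: it is represented over `𝔽₂`. -/
def IsBinaryMatroid (M : Matroid E) : Prop :=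
  ∃ (r : ℕ) (A : Matrix (Fin r) E (ZMod 2)), M.IsRepresentedBy A

/-- The set of bases of `M`, as finite subsets of `E`. -/
abbrev Basis (M : Matroid E) : Type u := {J : Finset E // M.IsBase (J : Set E)}

/-- The index set of the `3`-term Plücker relations: an `(r-2)`-subset `I` of `E`, where `r` is the
rank of `M`, and elements `i₁ < i₂ < i₃ < i₄` (written `i 0 < i 1 < i 2 < i 3`) outside of `I`. -/
structure PluckerIndex (M : Matroid E) where
  I : Finset E
  card_I : M.eRank = (I.card : ℕ∞) + 2
  i : Fin 4 → E
  strictMono : StrictMono i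
  notMem : ∀ k, i k ∉ I

/-- The set `I_{k,l} = I ∪ {i_k, i_l}`. -/
def PluckerIndex.sub {M : Matroid E} (p : M.PluckerIndex) (k l : Fin 4) : Finset E :=
  p.I ∪ {p.i k, p.i l}

/-- The set `Ω_M` of tuples `(I, i₁, i₂, i₃, i₄)`, where `I` is an `(r-2)`-subset of `E`, such that
`I_{1,2}`, `I_{2,3}`, `I_{3,4}`, `I_{4,1}` are bases of `M`, where `I_{k,l} = I ∪ {i_k, i_l}`. -/
structure Omega (M : Matroid E) where
  I : Finset E
  card_I : M.eRank = (I.card : ℕ∞) + 2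
  (i₁ i₂ i₃ i₄ : E)
  base₁₂ : M.IsBase ((I ∪ {i₁, i₂} : Finset E) : Set E)
  base₂₃ : M.IsBase ((I ∪ {i₂, i₃} : Finset E) : Set E)
  base₃₄ : M.IsBase ((I ∪ {i₃, i₄} : Finset E) : Set E)
  base₄₁ : M.IsBase ((I ∪ {i₄, i₁} : Finset E) : Set E)

/-! #### The weak universal pasture and the foundation -/

/-- The group of Laurent monomials `∏ x_J^{e_J}` in variables `x_J` indexed by the bases of `M`. -/
abbrev LaurentMonomial (M : Matroid E) : Type u := Multiplicative (M.Basis →₀ ℤ)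

/-- The monomial `x_J`. -/
def xMon (M : Matroid E) (J : M.Basis) : M.LaurentMonomial :=
  Multiplicative.ofAdd (Finsupp.single J 1)

/-- The degree of Laurent monomials, for which every `x_J` has degree `1`. -/
def degree (M : Matroid E) : M.LaurentMonomial →* Multiplicative ℤ :=
  AddMonoidHom.toMultiplicative (Finsupp.degree : (M.Basis →₀ ℤ) →+ ℤ)

lemma degree_xMon {E : Type u} (M : Matroid E) (J : M.Basis) :
    M.degree (M.xMon J) = Multiplicative.ofAdd 1 := by
  change Multiplicative.ofAdd (Finsupp.degree (Finsupp.single J (1 : ℤ))) = _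
  rw [Finsupp.degree_single]

/-- The group `{1, ε} × {∏ x_J^{e_J}}` of units of `𝔽₁^±[x_J^{±1}]`, with `ε = -1 ∈ ℤˣ`. -/
abbrev SignedMonomial (M : Matroid E) : Type u := ℤˣ × M.LaurentMonomial

open Classical in
/-- The element `x_J` of `ℕ[{1, ε} × {∏ x_J^{e_J}}]` if `J` is a basis, and `0` otherwise. -/
def xNat (M : Matroid E) (J : Finset E) : MonoidAlgebra ℕ M.SignedMonomial :=
  if h : M.IsBase (J : Set E) then MonoidAlgebra.of ℕ M.SignedMonomial (1, M.xMon ⟨J, h⟩) else 0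

/-- The element `ε`. -/
def epsNat (M : Matroid E) : MonoidAlgebra ℕ M.SignedMonomial :=
  MonoidAlgebra.of ℕ M.SignedMonomial (-1, 1)

/-- The relation `0 ≤ 1 + ε` together with the `3`-term Plücker relations
`0 ≤ x_{I,1,2} x_{I,3,4} + ε x_{I,1,3} x_{I,2,4} + x_{I,1,4} x_{I,2,3}`. -/
def weakPluckerRel (M : Matroid E) (x y : MonoidAlgebra ℕ M.SignedMonomial) : Prop :=
  x = 0 ∧
    (y = 1 + M.epsNat ∨ ∃ p : M.PluckerIndex,
      y = M.xNat (p.sub 0 1) * M.xNat (p.sub 2 3)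
        + M.epsNat * (M.xNat (p.sub 0 2) * M.xNat (p.sub 1 3))
        + M.xNat (p.sub 0 3) * M.xNat (p.sub 1 2))

/-- The graded ordered blueprint `𝔽₁^±[x_J^{±1} | J a basis] ⫽ Pl^w`, where `Pl^w` consists of the
`3`-term Plücker relations. -/
def gradedWeakPasture (M : Matroid E) : OrderedBlueprint.{u} :=
  OrderedBlueprint.ofGroup M.SignedMonomial M.weakPluckerRel

/-- The class of `ε^i ∏ x_J^{e_J}` in `𝔽₁^±[x_J^{±1}] ⫽ Pl^w`. -/
def gradedMk (M : Matroid E) : M.SignedMonomial →* M.gradedWeakPasture.carrier :=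
  M.gradedWeakPasture.mon.subtype.comp
    (OrderedBlueprint.ofGroupMk M.SignedMonomial M.weakPluckerRel)

/-- The submonoid of the elements of degree `0` (including the zero element). -/
def degreeZeroMon (M : Matroid E) : Submonoid M.gradedWeakPasture.carrier where
  carrier := {x | x = 0 ∨ ∃ h : M.SignedMonomial, M.degree h.2 = 1 ∧
    x = M.gradedMk h}
  one_mem' := Or.inr ⟨1, map_one _, by rw [map_one]⟩
  mul_mem' := by
    rintro _ _ (rfl | ⟨a, ha, rfl⟩) (rfl | ⟨b, hb, rfl⟩)
    · exact Or.inl (mul_zero _)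
    · exact Or.inl (zero_mul _)
    · exact Or.inl (mul_zero _)
    · refine Or.inr ⟨a * b, ?_, ?_⟩
      · rw [Prod.snd_mul, map_mul, ha, hb, one_mul]
      · rw [map_mul]

/-- The degree-`0` part `(𝔽₁^±[x_J^{±1} | J a basis] ⫽ Pl^w)₀`. -/
def degreeZeroPasture (M : Matroid E) : OrderedBlueprint.{u} :=
  M.gradedWeakPasture.sub M.degreeZeroMon (Or.inl rfl)

/-- The weak universal pasture `k_M^w = (𝔽₁^±[x_J^{±1} | J a basis] ⫽ Pl^w)₀^±`. -/
def weakUniversalPasture (M : Matroid E) : OrderedBlueprint.{u} :=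
  M.degreeZeroPasture.pasteurization

/-- The structure of an `𝔽₁^±`-algebra of `k_M^w`. -/
def weakUniversalPastureStr (M : Matroid E) :
    OrderedBlueprint.Hom OrderedBlueprint.F1pm M.weakUniversalPasture :=
  M.degreeZeroPasture.F1pmToPasteurization

/-- The element `x_I / x_J` of `k_M^w`. -/
def xRatio (M : Matroid E) (I J : M.Basis) : M.weakUniversalPasture.carrier :=
  M.degreeZeroPasture.toPasteurization.toRingHom
    ⟨M.gradedMk (1, M.xMon I / M.xMon J),
      Subsemiring.subset_closure (Or.inr ⟨(1, M.xMon I / M.xMon J), by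
        rw [map_div, degree_xMon, degree_xMon, div_self'], rfl⟩)⟩

/-- The foundation `k_M^f` of `M`: the foundation of `k_M^w`. -/
def foundation (M : Matroid E) : OrderedBlueprint.{u} :=
  M.weakUniversalPasture.foundation

/-- The inclusion `k_M^f → k_M^w`. -/
def foundationIncl (M : Matroid E) :
    OrderedBlueprint.Hom M.foundation M.weakUniversalPasture :=
  M.weakUniversalPasture.foundationIncl

/-- The structure of an `𝔽₁^±`-algebra of `k_M^f`. -/
def foundationStr (M : Matroid E) :
    OrderedBlueprint.Hom OrderedBlueprint.F1pm M.foundation :=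
  OrderedBlueprint.F1pmToFoundation M.weakUniversalPastureStr

/-- `k_M^w ⊗_{𝔽₁^±} 𝔽₁^{±,sq}`. -/
def weakUniversalPastureSq (M : Matroid E) : OrderedBlueprint.{u} :=
  OrderedBlueprint.tensorSq M.weakUniversalPastureStr

/-- The morphism `k_M^w → k_M^w ⊗ 𝔽₁^{±,sq}`, `a ↦ a ⊗ 1`. -/
def toWeakUniversalPastureSq (M : Matroid E) :
    OrderedBlueprint.Hom M.weakUniversalPasture M.weakUniversalPastureSq :=
  OrderedBlueprint.toTensorSq M.weakUniversalPastureStr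

/-- `k_M^f ⊗_{𝔽₁^±} 𝔽₁^{±,sq}`. -/
def foundationSq (M : Matroid E) : OrderedBlueprint.{u} :=
  OrderedBlueprint.tensorSq M.foundationStr

/-- The morphism `k_M^f → k_M^f ⊗ 𝔽₁^{±,sq}`, `a ↦ a ⊗ 1`. -/
def toFoundationSq (M : Matroid E) :
    OrderedBlueprint.Hom M.foundation M.foundationSq :=
  OrderedBlueprint.toTensorSq M.foundationStr

/-! #### The bracket ring and the universal partial field -/

open Classical in
/-- The element `x_J` of `ℤ[x_J^{±1} | J a basis]` if `J` is a basis, and `0` otherwise. -/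
def xInt (M : Matroid E) (J : Finset E) : MonoidAlgebra ℤ M.LaurentMonomial :=
  if h : M.IsBase (J : Set E) then MonoidAlgebra.of ℤ M.LaurentMonomial (M.xMon ⟨J, h⟩) else 0

/-- The ideal of `ℤ[x_J^{±1} | J a basis]` generated by the `3`-term Plücker relations. -/
def pluckerIdeal (M : Matroid E) : Ideal (MonoidAlgebra ℤ M.LaurentMonomial) :=
  Ideal.span {y | ∃ p : M.PluckerIndex,
    y = M.xInt (p.sub 0 1) * M.xInt (p.sub 2 3)
      - M.xInt (p.sub 0 2) * M.xInt (p.sub 1 3)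
      + M.xInt (p.sub 0 3) * M.xInt (p.sub 1 2)}

/-- The bracket ring `B_M`. -/
abbrev BracketRing (M : Matroid E) : Type u :=
  MonoidAlgebra ℤ M.LaurentMonomial ⧸ M.pluckerIdeal

/-- The unit of `B_M` given by a Laurent monomial. -/
def monomialUnit (M : Matroid E) : M.LaurentMonomial →* M.BracketRingˣ :=
  (Units.map ((Ideal.Quotient.mk M.pluckerIdeal).toMonoidHom.comp
    (MonoidAlgebra.of ℤ M.LaurentMonomial))).comp toUnits.toMonoidHom

/-- The unit `x_J` of `B_M`. -/
def xUnit (M : Matroid E) (J : M.Basis) : M.BracketRingˣ :=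
  M.monomialUnit (M.xMon J)

/-- The group `{± ∏ x_J^{e_J} | ∑ e_J = 0}` of units of `B_M`. -/
def degreeZeroUnits (M : Matroid E) : Subgroup M.BracketRingˣ :=
  Subgroup.closure {-1} ⊔ M.degree.ker.map M.monomialUnit

/-- The partial degree-`0` bracket field `P_{M,0}`; its unit group consists of the elements
`± ∏ x_J^{e_J}` with `∑ e_J = 0`, and its ambient ring is the degree-`0` bracket ring `B_{M,0}`,
which is generated by these elements. -/
def partialBracketField (M : Matroid E) : PartialFieldDatum.{u} :=
  PartialFieldDatum.ofUnits M.BracketRing M.degreeZeroUnits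

/-- The cross ratio `x_{I,1,2} x_{I,3,4} / (x_{I,2,3} x_{I,4,1})` in `B_M`. -/
def crossRatio (M : Matroid E) (t : M.Omega) : M.BracketRingˣ :=
  M.xUnit ⟨_, t.base₁₂⟩ * M.xUnit ⟨_, t.base₃₄⟩ / (M.xUnit ⟨_, t.base₂₃⟩ * M.xUnit ⟨_, t.base₄₁⟩)

/-- The group of units generated by `-1` and the cross ratios. -/
def crossRatioUnits (M : Matroid E) : Subgroup M.BracketRingˣ :=
  Subgroup.closure ({-1} ∪ Set.range M.crossRatio)

lemma crossRatioUnits_le (M : Matroid E) : M.crossRatioUnits ≤ M.degreeZeroUnits := by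
  refine (Subgroup.closure_le _).2 ?_
  rintro _ (rfl | ⟨t, rfl⟩)
  · exact Subgroup.mem_sup_left (Subgroup.subset_closure rfl)
  · refine Subgroup.mem_sup_right ⟨M.xMon ⟨_, t.base₁₂⟩ * M.xMon ⟨_, t.base₃₄⟩ /
      (M.xMon ⟨_, t.base₂₃⟩ * M.xMon ⟨_, t.base₄₁⟩), ?_, ?_⟩
    · change M.degree _ = 1
      rw [map_div, map_mul, map_mul, degree_xMon, degree_xMon, degree_xMon, degree_xMon, div_self']
    · simp only [crossRatio, xUnit, map_div, map_mul]

/-- The universal partial field `ℙ_M`: the partial subfield of the partial bracket field that is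
generated by the cross ratios. It satisfies the axioms of a partial field only if `B_M ≠ 0`. -/
def universalPartialField (M : Matroid E) : PartialFieldDatum.{u} :=
  PartialFieldDatum.ofUnits M.BracketRing M.crossRatioUnits

/-- The inclusion `ℙ_M → P_{M,0}`. -/
def universalPartialFieldIncl (M : Matroid E) :
    M.universalPartialField.Hom M.partialBracketField :=
  PartialFieldDatum.ofUnitsIncl M.BracketRing M.crossRatioUnits_le

/-- The element `x_I / x_J` of `P_{M,0}^×`. -/
def bracketRatio (M : Matroid E) (I J : M.Basis) : M.partialBracketField.G :=
  (⟨M.xUnit I / M.xUnit J, Subgroup.mem_sup_right ⟨M.xMon I / M.xMon J, by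
    change M.degree _ = 1
    rw [map_div, degree_xMon, degree_xMon, div_self'], by simp only [xUnit, map_div]⟩⟩ : M.degreeZeroUnits)

/-! #### Weak Grassmann-Plücker functions and rescaling classes -/

/-- The weak Grassmann-Plücker functions with coefficients in `B` whose underlying matroid is `M`.
A function `Δ` on the `r`-subsets of `E` is extended by `0` to all finite subsets of `E`. That `Δ`
represents `M` means that the bases of `M` are precisely the sets `J` with `Δ(J) ≠ 0`; since `B` is
an ordered blue field in our applications, `Δ(J) ≠ 0` means that `Δ(J)` is a unit of `B`. -/
structure WeakGPFunction (M : Matroid E) (B : OrderedBlueprint.{v}) where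
  Δ : Finset E → B.mon
  isUnit : ∀ J : Finset E, M.IsBase (J : Set E) → IsUnit (Δ J)
  eq_zero : ∀ J : Finset E, ¬ M.IsBase (J : Set E) → (Δ J : B.carrier) = 0
  plucker : ∀ p : M.PluckerIndex, ∃ e : B.carrier, B.IsWeakInverse 1 e ∧
    (0 : B.carrier) ≤ (Δ (p.sub 0 1) : B.carrier) * Δ (p.sub 2 3)
      + e * ((Δ (p.sub 0 2) : B.carrier) * Δ (p.sub 1 3))
      + (Δ (p.sub 0 3) : B.carrier) * Δ (p.sub 1 2)

/-- The push-forward `f ∘ Δ`. -/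
def WeakGPFunction.map {M : Matroid E} {B : OrderedBlueprint.{v}} {C : OrderedBlueprint.{w}}
    (f : OrderedBlueprint.Hom B C) (D : M.WeakGPFunction B) : M.WeakGPFunction C where
  Δ J := f.onMon (D.Δ J)
  isUnit J h := (D.isUnit J h).map f.onMon
  eq_zero J h := by
    change f.toRingHom (D.Δ J : B.carrier) = 0
    rw [D.eq_zero J h, map_zero]
  plucker p := by
    obtain ⟨e, ⟨_, he, h1⟩, h2⟩ := D.plucker p
    refine ⟨f.toRingHom e, ⟨C.mon.one_mem, f.map_mon e he, ?_⟩, ?_⟩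
    · have := f.mono _ _ h1
      rwa [map_zero, map_add, map_one] at this
    · have := f.mono _ _ h2
      rw [map_zero] at this
      simp only [map_add, map_mul] at this
      exact this

/-- Rescaling equivalence: `Δ' = a · (t.Δ)` for some `a ∈ B^×` and `t : E → B^×`, where
`t.Δ(J) = (∏_{j ∈ J} t(j)) · Δ(J)`. Equivalently, the weak `B`-matroids `[Δ]` and `[Δ']` lie in the
same orbit under the torus `T(B)`. -/
def RescalingEquiv {M : Matroid E} {B : OrderedBlueprint.{v}} (D D' : M.WeakGPFunction B) : Prop :=
  ∃ (a : (B.mon)ˣ) (t : E → (B.mon)ˣ), ∀ J : Finset E,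
    D'.Δ J = (a : B.mon) * ((∏ j ∈ J, t j : (B.mon)ˣ) : B.mon) * D.Δ J

/-- The rescaling class space `𝒳_M^f(B)`. -/
def RescalingClass (M : Matroid E) (B : OrderedBlueprint.{v}) : Type (max u v) :=
  Quot (RescalingEquiv (M := M) (B := B))

/-- The rescaling class of a weak Grassmann-Plücker function. -/
def RescalingClass.mk {M : Matroid E} {B : OrderedBlueprint.{v}} (D : M.WeakGPFunction B) :
    M.RescalingClass B :=
  Quot.mk _ D

/-- The map `𝒳_M^f(B) → 𝒳_M^f(C)`, `[Δ] ↦ [f ∘ Δ]`. -/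
def RescalingClass.map {M : Matroid E} {B : OrderedBlueprint.{v}} {C : OrderedBlueprint.{w}}
    (f : OrderedBlueprint.Hom B C) : M.RescalingClass B → M.RescalingClass C :=
  Quot.map (WeakGPFunction.map f) (by
    rintro D D' ⟨a, t, h⟩
    refine ⟨Units.map f.onMon a, fun j => Units.map f.onMon (t j), fun J => ?_⟩
    change f.onMon (D'.Δ J) = _
    rw [h J, map_mul, map_mul, ← map_prod]
    rfl)

end Matroid

end

/-! Let L be the group of Laurent monomials in the x_J and K ≤ L the subgroup generated by the cross
ratios. The combinatorial core is `CrossRatioFree.exists_eq_prod`: a function on the bases with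
values in an abelian group and with trivial cross ratios has the form J ↦ a ∏_{j ∈ J} t(j). The
proof is an induction on the ground set, and its deletion step rests on `CrossRatioFree.eq_of_path`,
a shortening argument for paths in the fundamental graph of a basis. Applied to the classes of the
x_J in L/K, this yields a `retraction` of L onto K that is multiplication by a rescaling. A
rescaling multiplies the three terms of a Plücker relation by a common factor, so a solution f of
the relations may be replaced by f ∘ `retraction`, which depends only on the values of f on K.

The monoid of the foundation consists of 0 and the classes of ±K. Cross ratios are fundamental up to
sign: divide a Plücker relation by one of its terms. Conversely, k_M^w maps to a test blueprint on
ℕ[L/K] in which 0 ≤ n means that no coefficient of n is 1. The Plücker relations hold there by basis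
exchange, and a nonzero fundamental element must go to 1. Hence k_M^f is a retract of k_M^w, and
morphisms from it extend to k_M^w.

In a blueprint with an additive inverse of 1 the order is equality (`HasNeg.eq_of_le`). There the
inequalities defining k_M^w become the equations of the bracket ring, so `PluckerData` with values
in such a blueprint also give ring homomorphisms from B_M. Comparing universal properties gives θ;
inserting the retraction gives θ^f and the presentation of ℤ[ℙ_M^×] by three term relations. The
bijections follow similarly. Rescaling classes are solutions restricted to K, three term relations
lift from P^blpr to P^oblpr because they already are positive there, and morphisms from ℙ_M^blpr to
P^blpr are morphisms ℙ_M → P.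

Regularity and binarity become solvability of the Plücker relations in ℤ and in 𝔽₂ with unit values
on the bases: maximal minors satisfy the relations, and a solution is recovered from its values at
exchanges with a fixed basis. If B_M maps to 𝔽₂, every cross ratio is ±1, because three units of 𝔽₂
do not sum to 0. Then ℙ_M is 𝔽₂ if 2 = 0 in B_M. Otherwise the signs form an integral solution: each
relation takes an even value of absolute value at most 3 that vanishes in B_M, and ±2 is excluded.
-/

set_option linter.unusedSectionVars false

noncomputable section

/-! ### Functions on the bases of a matroid without cross ratios -/

namespace BasisFamily

variable {E : Type u} [DecidableEq E] {A : Type v} [CommGroup A]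

/-- The basis exchange property for a family of finite sets. -/
def Exchange (F : Finset E → Prop) : Prop :=
  ∀ B C, F B → F C → ∀ a ∈ B \ C, ∃ b ∈ C \ B, F (insert b (B.erase a))

/-- Join x, y to z, w by an edge whenever adding the two ends to I gives a member of F. Exchanging
each of the four elements away shows that no vertex is isolated, and a subgraph of a 4-cycle without
isolated vertices contains a perfect matching. -/
lemma Exchange.pairs {F : Finset E → Prop} (hF : Exchange F) {I : Finset E} {x y z w : E}
    (hx : x ∉ I) (hy : y ∉ I) (hz : z ∉ I) (hw : w ∉ I) (hxy : x ≠ y) (hxz : x ≠ z) (hxw : x ≠ w)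
    (hyz : y ≠ z) (hyw : y ≠ w) (hzw : z ≠ w) (h₁ : F (I ∪ {x, y})) (h₂ : F (I ∪ {z, w})) :
    (F (I ∪ {x, z}) ∧ F (I ∪ {y, w})) ∨ (F (I ∪ {x, w}) ∧ F (I ∪ {y, z})) := by
  have key : ∀ x y z w : E, x ∉ I → y ∉ I → z ∉ I → w ∉ I → x ≠ y → x ≠ z → x ≠ w → y ≠ z →
      y ≠ w → z ≠ w → F (I ∪ {x, y}) → F (I ∪ {z, w}) → F (I ∪ {y, z}) ∨ F (I ∪ {y, w}) := by
    intro x y z w hx hy hz hw hxy hxz hxw hyz hyw hzw h₁ h₂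
    obtain ⟨b, hb, h⟩ := hF _ _ h₁ h₂ x (by grind)
    have : b = z ∨ b = w := by grind
    rcases this with rfl | rfl
    · left; convert h using 1; grind
    · right; convert h using 1; grind
  have k₁ := key x y z w hx hy hz hw hxy hxz hxw hyz hyw hzw h₁ h₂
  have k₂ := key y x z w hy hx hz hw hxy.symm hyz hyw hxz hxw hzw (by rwa [Finset.pair_comm]) h₂
  have k₃ := key z w x y hz hw hx hy hzw hxz.symm hyz.symm hxw.symm hyw.symm hxy h₂ h₁
  have k₄ := key w z x y hw hz hx hy hzw.symm hxw.symm hyw.symm hxz.symm hyz.symm hxy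
    (by rwa [Finset.pair_comm]) h₁
  rw [Finset.pair_comm w x, Finset.pair_comm w y] at k₃
  rw [Finset.pair_comm z x, Finset.pair_comm z y] at k₄
  tauto

/-- A member of the family that differs from `B` in at least two elements can be moved two steps
towards `B`. -/
lemma exists_two_steps {F : Finset E → Prop} {B J : Finset E}
    (hF : ∀ J, F J → ∀ a ∈ J \ B, ∃ b ∈ B \ J, F (insert b (J.erase a)))
    (hJ : F J) (h2 : 2 ≤ (J \ B).card) :
    ∃ (I : Finset E) (x y z w : E), J = I ∪ {x, y} ∧ x ∉ I ∧ y ∉ I ∧ z ∉ I ∧ w ∉ I ∧ x ≠ y ∧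
      x ≠ z ∧ x ≠ w ∧ y ≠ z ∧ y ≠ w ∧ z ≠ w ∧ x ∉ B ∧ y ∉ B ∧ z ∈ B ∧ w ∈ B ∧
      F (I ∪ {z, w}) := by
  obtain ⟨x, hx, y, hy, hxy⟩ := Finset.one_lt_card.1 h2
  obtain ⟨z, hz, h₁⟩ := hF J hJ x hx
  obtain ⟨w, hw, h₂⟩ := hF _ h₁ y (by grind)
  refine ⟨(J.erase x).erase y, x, y, z, w, ?_⟩
  have e : insert w ((insert z (J.erase x)).erase y) = (J.erase x).erase y ∪ {z, w} := by
    grind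
  rw [e] at h₂
  refine ⟨?_, ?_, ?_, ?_, ?_, ?_, ?_, ?_, ?_, ?_, ?_, ?_, ?_, ?_, ?_, h₂⟩ <;> grind

/-- The relation `D(I₁₂) D(I₃₄) = D(I₂₃) D(I₄₁)` for sets `I₁₂`, `I₂₃`, `I₃₄`, `I₄₁` in `F`. -/
def CrossRatioFree (F : Finset E → Prop) (D : Finset E → A) : Prop :=
  ∀ (I : Finset E) (x y z w : E), x ∉ I → y ∉ I → z ∉ I → w ∉ I → x ≠ y → x ≠ z → x ≠ w →
    y ≠ z → y ≠ w → z ≠ w → F (I ∪ {x, y}) → F (I ∪ {y, z}) → F (I ∪ {z, w}) → F (I ∪ {w, x}) →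
    D (I ∪ {x, y}) * D (I ∪ {z, w}) = D (I ∪ {y, z}) * D (I ∪ {w, x})

lemma union_pair_sdiff {B I : Finset E} {a b : E} (ha : a ∉ B) (hb : b ∈ B) :
    (I ∪ {a, b}) \ B = insert a (I \ B) := by
  grind

lemma card_sdiff_aux {B I : Finset E} {x y z w : E} (hx : x ∉ I) (hy : y ∉ I)
    (hxy : x ≠ y) (hxB : x ∉ B) (hyB : y ∉ B) (hzB : z ∈ B) (hwB : w ∈ B) :
    ((I ∪ {x, y}) \ B).card = (I \ B).card + 2 ∧ ((I ∪ {x, z}) \ B).card = (I \ B).card + 1 ∧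
    ((I ∪ {z, w}) \ B).card = (I \ B).card := by
  have e1 : (I ∪ {x, y}) \ B = insert x (insert y (I \ B)) := by grind
  have e2 : (I ∪ {x, z}) \ B = insert x (I \ B) := by grind
  have e3 : (I ∪ {z, w}) \ B = I \ B := by grind
  rw [e1, e2, e3, Finset.card_insert_of_notMem (by grind), Finset.card_insert_of_notMem (by grind),
    Finset.card_insert_of_notMem (by grind)]
  simp

lemma eq_exchange_of_card {B J : Finset E} (hc : J.card = B.card) (h : (J \ B).card ≤ 1) :
    J = B ∨ ∃ i ∈ B, ∃ j ∉ B, J = insert j (B.erase i) := by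
  rcases Nat.le_one_iff_eq_zero_or_eq_one.1 h with h0 | h1
  · left
    rw [Finset.card_eq_zero, Finset.sdiff_eq_empty_iff_subset] at h0
    exact Finset.eq_of_subset_of_card_le h0 hc.ge
  · right
    have h1' := h1
    rw [Finset.card_sdiff_comm hc] at h1'
    obtain ⟨j, hj⟩ := Finset.card_eq_one.1 h1
    obtain ⟨i, hi⟩ := Finset.card_eq_one.1 h1'
    have hj' : ∀ x, x ∈ J \ B ↔ x = j := by simp [hj]
    have hi' : ∀ x, x ∈ B \ J ↔ x = i := by simp [hi]
    simp only [Finset.mem_sdiff] at hi' hj'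
    refine ⟨i, ((hi' i).2 rfl).1, j, ((hj' j).2 rfl).2, ?_⟩
    ext x
    have h3 := hi' x
    have h4 := hj' x
    simp only [Finset.mem_insert, Finset.mem_erase]
    tauto

/-- Induction on the distance of J from B. Two exchanges lead from J = I ∪ {x, y} to I ∪ {z, w} with
z, w ∈ B, and `Exchange.pairs` provides two intermediate members. The trivial cross ratio then
expresses D(J) through three members that are closer to B. -/
lemma CrossRatioFree.eq_one {F : Finset E → Prop} (hF : Exchange F) {r : ℕ}
    (hr : ∀ J, F J → J.card = r) {D : Finset E → A} (hD : CrossRatioFree F D) {B : Finset E}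
    (hB : F B) (hDB : D B = 1)
    (h1 : ∀ i ∈ B, ∀ j ∉ B, F (insert j (B.erase i)) → D (insert j (B.erase i)) = 1) :
    ∀ J, F J → D J = 1 := by
  have key : ∀ (n : ℕ) (J : Finset E), (J \ B).card = n → F J → D J = 1 := by
    intro n
    induction n using Nat.strong_induction_on with
    | _ n ih =>
      intro J hn hJ
      by_cases h2 : 2 ≤ n
      · obtain ⟨I, x, y, z, w, rfl, hx, hy, hz, hw, hxy, hxz, hxw, hyz, hyw, hzw, hxB, hyB, hzB,
          hwB, h⟩ := exists_two_steps (fun J hJ a ha => hF J B hJ hB a ha) hJ (hn ▸ h2)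
        have cards : ∀ a b, a ∉ I → a ∉ B → b ∈ B → ((I ∪ {a, b}) \ B).card < n := by
          intro a b ha haB hb
          have e1 := (card_sdiff_aux hx hy hxy hxB hyB hzB hwB).1
          have e2 : ((I ∪ {a, b}) \ B).card = (I \ B).card + 1 := by
            rw [union_pair_sdiff haB hb, Finset.card_insert_of_notMem (by simp [ha])]
          omega
        have c3 : ((I ∪ {z, w}) \ B).card < n := by
          have e1 := card_sdiff_aux hx hy hxy hxB hyB hzB hwB
          omega
        have d3 := ih _ c3 _ rfl h
        have d : ∀ a b, a ∉ I → a ∉ B → b ∈ B → F (I ∪ {a, b}) → D (I ∪ {a, b}) = 1 :=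
          fun a b ha haB hb hf => ih _ (cards a b ha haB hb) _ rfl hf
        rcases hF.pairs hx hy hz hw hxy hxz hxw hyz hyw hzw hJ h with ⟨p, q⟩ | ⟨p, q⟩
        · have := hD I x y w z hx hy hw hz hxy hxw hxz hyw hyz hzw.symm hJ q
            (by rwa [Finset.pair_comm]) (by rwa [Finset.pair_comm])
          rw [Finset.pair_comm w z, Finset.pair_comm z x, d3, d y w hy hyB hwB q,
            d x z hx hxB hzB p] at this
          simpa using this
        · have := hD I x y z w hx hy hz hw hxy hxz hxw hyz hyw hzw hJ q h
            (by rwa [Finset.pair_comm])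
          rw [Finset.pair_comm w x, d3, d y z hy hyB hzB q, d x w hx hxB hwB p] at this
          simpa using this
      · rcases eq_exchange_of_card ((hr J hJ).trans (hr B hB).symm) (by omega) with
          rfl | ⟨i, hi, j, hj, rfl⟩
        · exact hDB
        · exact h1 i hi j hj hJ
  exact fun J hJ => key _ J rfl hJ

/-! ### Fundamental graphs: i ∈ B and j ∉ B are adjacent if B - i + j is in F -/

section Paths

variable {F : Finset E → Prop} {D : Finset E → A} {B : Finset E}

/-- Analogue of a 2 × 2 determinant with nonzero diagonal and vanishing off-diagonal product: it
cannot vanish. The proof is `Exchange.pairs` over B - i - i', where the hypothesis excludes one of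
the two matchings. -/
lemma Exchange.pivot (hF : Exchange F) {i i' j j' : E} (hi : i ∈ B) (hi' : i' ∈ B) (hii : i ≠ i')
    (hj : j ∉ B) (hj' : j' ∉ B) (hjj : j ≠ j') (h₁ : F (insert j (B.erase i)))
    (h₂ : F (insert j' (B.erase i')))
    (h : ¬ (F (insert j' (B.erase i)) ∧ F (insert j (B.erase i')))) :
    F (insert j' ((insert j (B.erase i)).erase i')) := by
  have := hF.pairs (I := (B.erase i).erase i') (x := i') (y := j) (z := i) (w := j')
    (by grind) (by grind) (by grind) (by grind) (by grind) (by grind) (by grind) (by grind)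
    (by grind) (by grind) (by convert h₁ using 1; grind) (by convert h₂ using 1; grind)
  rcases this with ⟨-, h3⟩ | ⟨h3, h4⟩
  · convert h3 using 1; grind
  · refine absurd ⟨?_, ?_⟩ h
    · convert h3 using 1; grind
    · convert h4 using 1; grind

lemma CrossRatioFree.square (hD : CrossRatioFree F D) {i i' j j' : E} (hi : i ∈ B) (hi' : i' ∈ B)
    (hii : i ≠ i') (hj : j ∉ B) (hj' : j' ∉ B) (hjj : j ≠ j') (h₁ : F (insert j (B.erase i)))
    (h₂ : F (insert j' (B.erase i))) (h₃ : F (insert j (B.erase i')))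
    (h₄ : F (insert j' (B.erase i'))) :
    D (insert j (B.erase i)) * D (insert j' (B.erase i')) =
      D (insert j' (B.erase i)) * D (insert j (B.erase i')) := by
  have e1 : (B.erase i).erase i' ∪ {i', j} = insert j (B.erase i) := by grind
  have e2 : (B.erase i).erase i' ∪ {j, i} = insert j (B.erase i') := by grind
  have e3 : (B.erase i).erase i' ∪ {i, j'} = insert j' (B.erase i') := by grind
  have e4 : (B.erase i).erase i' ∪ {j', i'} = insert j' (B.erase i) := by grind
  have := hD ((B.erase i).erase i') i' j i j'
    (by grind) (by grind) (by grind) (by grind) (by grind) (by grind) (by grind) (by grind)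
    (by grind) (by grind)
  rw [e1, e2, e3, e4] at this
  rw [this h₁ h₃ h₄ h₂, mul_comm]

/-- The cross ratio of the four sets over B - i - i' that contain exactly one element of {i, j} and
exactly one of {i', j'}. It transports D from exchanges of B to exchanges of the pivoted set B - i +
j. -/
lemma CrossRatioFree.pivot (hD : CrossRatioFree F D) {i i' j j' : E} (hi : i ∈ B) (hi' : i' ∈ B)
    (hii : i ≠ i') (hj : j ∉ B) (hj' : j' ∉ B) (hjj : j ≠ j') (hB : F B)
    (h₁ : F (insert j (B.erase i))) (h₂ : F (insert j' (B.erase i')))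
    (h₃ : F (insert j' ((insert j (B.erase i)).erase i'))) :
    D B * D (insert j' ((insert j (B.erase i)).erase i')) =
      D (insert j (B.erase i)) * D (insert j' (B.erase i')) := by
  have e1 : (B.erase i).erase i' ∪ {i', i} = B := by grind
  have e2 : (B.erase i).erase i' ∪ {i, j'} = insert j' (B.erase i') := by grind
  have e3 : (B.erase i).erase i' ∪ {j', j} = insert j' ((insert j (B.erase i)).erase i') := by
    grind
  have e4 : (B.erase i).erase i' ∪ {j, i'} = insert j (B.erase i) := by grind
  have := hD ((B.erase i).erase i') i' i j' j
    (by grind) (by grind) (by grind) (by grind) (by grind) (by grind) (by grind) (by grind)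
    (by grind) (by grind)
  rw [e1, e2, e3, e4] at this
  rw [this hB h₂ h₃ h₁, mul_comm]

/-- If `i 0` and `i n` are connected by a path in the fundamental graph of `B` that avoids `e`, then
exchanging either of them for `e` has the same effect on `D`. -/
lemma CrossRatioFree.eq_of_path (hF : Exchange F) (hD : CrossRatioFree F D) {e : E}
    (hone : ∀ J, F J → e ∉ J → D J = 1) (n : ℕ) :
    ∀ (B : Finset E) (i j : ℕ → E), F B → e ∉ B → (∀ k ≤ n, i k ∈ B) →
      (∀ k < n, j k ∉ B ∧ j k ≠ e ∧ F (insert (j k) (B.erase (i k))) ∧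
        F (insert (j k) (B.erase (i (k + 1))))) →
      F (insert e (B.erase (i 0))) → F (insert e (B.erase (i n))) →
      D (insert e (B.erase (i 0))) = D (insert e (B.erase (i n))) := by
  induction n using Nat.strong_induction_on with
  | _ n ih =>
    intro B i j hB he hi hj h0 hn
    -- A path with distinct ends and n = 1 closes up with e to a 4-cycle; the two of its exchanges
    -- that avoid e have D = 1, so `CrossRatioFree.square` compares the other two.
    rcases Nat.lt_or_ge n 2 with hn2 | hn2
    · by_cases h : i 0 = i n
      · rw [h]
      · have hn1 : n = 1 := by
          rcases Nat.lt_succ_iff.1 hn2 |>.eq_or_lt with h' | h'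
          · exact h'
          · exact absurd (by rw [Nat.lt_one_iff.1 h']) h
        subst hn1
        obtain ⟨a, b, c, d⟩ := hj 0 one_pos
        have := hD.square (hi 0 (by omega)) (hi 1 le_rfl) h he a b.symm h0 c hn d
        rw [hone _ d (by grind), hone _ c (by grind)] at this
        simpa using this
    -- If e is adjacent to i 1, the path splits there into two shorter ones.
    · by_cases h1 : F (insert e (B.erase (i 1)))
      · refine (ih 1 (by omega) B i j hB he (fun k hk => hi k (by omega))
          (fun k hk => hj k (by omega)) h0 h1).trans ?_
        have := ih (n - 1) (by omega) B (fun k => i (k + 1)) (fun k => j (k + 1)) hB he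
          (fun k hk => hi _ (by omega)) (fun k hk => hj _ (by omega)) h1
          (by simpa [Nat.sub_add_cancel (by omega : 1 ≤ n)] using hn)
        simpa [Nat.sub_add_cancel (by omega : 1 ≤ n)] using this
      -- A chord from j 0 to i k allows the shortcut i 0, j 0, i k, i (k + 1), and so on.
      by_cases h2 : ∃ k, 2 ≤ k ∧ k ≤ n ∧ F (insert (j 0) (B.erase (i k)))
      · obtain ⟨k, hk2, hkn, hk⟩ := h2
        have := ih (n - k + 1) (by omega) B (fun l => if l = 0 then i 0 else i (l - 1 + k))
          (fun l => if l = 0 then j 0 else j (l - 1 + k)) hB he ?_ ?_ (by simpa using h0)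
          (by simpa [Nat.sub_add_cancel hkn] using hn)
        · simpa [Nat.sub_add_cancel hkn] using this
        · intro l hl
          rcases l with _ | l
          · simpa using hi 0 (by omega)
          · simpa using hi (l + k) (by omega)
        · intro l hl
          rcases l with _ | l
          · have := hj 0 (by omega)
            simpa using ⟨this.1, this.2.1, this.2.2.1, hk⟩
          · have := hj (l + k) (by omega)
            simpa [add_right_comm] using this
      -- A chord from j 1 to i 0 allows the path to skip i 1 and j 0.
      by_cases h3 : F (insert (j 1) (B.erase (i 0)))
      · have := ih (n - 1) (by omega) B (fun l => if l = 0 then i 0 else i (l + 1))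
          (fun l => j (l + 1)) hB he ?_ ?_ (by simpa using h0) ?_
        · have hn0 : n - 1 ≠ 0 := by omega
          simpa [Nat.sub_add_cancel (by omega : 1 ≤ n), hn0] using this
        · intro l hl
          rcases l with _ | l
          · simpa using hi 0 (by omega)
          · simpa using hi (l + 1 + 1) (by omega)
        · intro l hl
          have := hj (l + 1) (by omega)
          rcases l with _ | l
          · simpa using ⟨this.1, this.2.1, h3, this.2.2.2⟩
          · simpa using this
        · have hn0 : n - 1 ≠ 0 := by omega
          simpa [Nat.sub_add_cancel (by omega : 1 ≤ n), hn0] using hn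
      -- No shortcut exists, so pivot to B' = B - i 0 + j 0. The missing chords keep i 1, j 1, ...,
      -- i n a path for B'. Exchanging e for i 1 in B' has the same D as exchanging it for i 0 in B
      -- (`d1`), and the values for i n in B' and in B agree (`dn`). The path is now shorter by one.
      · obtain ⟨j0B, j0e, hj00, hj01⟩ := hj 0 (by omega)
        have hne : ∀ k, 2 ≤ k → k ≤ n → i k ≠ i 0 := fun k hk hkn h =>
          h2 ⟨k, hk, hkn, by rw [h]; exact hj00⟩
        have h10 : i 1 ≠ i 0 := fun h => h3 (by rw [← h]; exact (hj 1 (by omega)).2.2.1)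
        have hjne : ∀ k, 1 ≤ k → k < n → j k ≠ j 0 := fun k hk hkn h =>
          h2 ⟨k + 1, by omega, by omega, by rw [← h]; exact (hj k hkn).2.2.2⟩
        have i0B := hi 0 (by omega)
        have i1B := hi 1 (by omega)
        have inB := hi n le_rfl
        have hen : n - 1 + 1 = n := by omega
        have hB' : F (insert (j 0) (B.erase (i 0))) := hj00
        have e1 : insert e ((insert (j 0) (B.erase (i 0))).erase (i 1)) =
            insert (j 0) ((insert e (B.erase (i 0))).erase (i 1)) := by grind
        have f1 : F (insert e ((insert (j 0) (B.erase (i 0))).erase (i 1))) := by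
          rw [e1]
          exact hF.pivot i0B i1B h10.symm he j0B j0e.symm h0 hj01 (fun h => h1 h.2)
        have d1 := hD.pivot i0B i1B h10.symm he j0B j0e.symm hB h0 hj01 (by rw [← e1]; exact f1)
        rw [← e1, hone B hB he, hone _ hj01 (by grind), one_mul, mul_one] at d1
        have hadj : ¬ F (insert (j 0) (B.erase (i n))) := fun h => h2 ⟨n, hn2, le_rfl, h⟩
        have fn := hF.pivot i0B inB (hne n hn2 le_rfl).symm j0B he j0e hj00 hn
          (fun h => hadj h.2)
        have dn := hD.pivot i0B inB (hne n hn2 le_rfl).symm j0B he j0e hB hj00 hn fn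
        rw [hone B hB he, hone _ hj00 (by grind), one_mul, one_mul] at dn
        rw [← d1, ← dn]
        have := ih (n - 1) (by omega) (insert (j 0) (B.erase (i 0))) (fun k => i (k + 1))
          (fun k => j (k + 1)) hB' (by grind) ?_ ?_ f1 (by rw [hen]; exact fn)
        · simpa [hen] using this
        · intro k hk
          have a := hi (k + 1) (by omega)
          have b : i (k + 1) ≠ i 0 := by
            rcases k with _ | k
            · exact h10
            · exact hne _ (by omega) (by omega)
          grind
        · intro k hk
          obtain ⟨a, b, c, d⟩ := hj (k + 1) (by omega)
          have nj := hjne (k + 1) (by omega) (by omega)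
          have ni := hne (k + 1 + 1) (by omega) (by omega)
          have ai := hi (k + 1) (by omega)
          have ai' := hi (k + 1 + 1) (by omega)
          refine ⟨by grind, b, ?_, ?_⟩
          · have b : i (k + 1) ≠ i 0 := by
              rcases k with _ | k
              · exact h10
              · exact hne _ (by omega) (by omega)
            refine hF.pivot i0B ai b.symm j0B a nj.symm hj00 c ?_
            rcases k with _ | k
            · exact fun h => h3 h.1
            · exact fun h => h2 ⟨_, by omega, by omega, h.2⟩
          · exact hF.pivot i0B ai' ni.symm j0B a nj.symm hj00 d
              fun h => h2 ⟨_, by omega, by omega, h.2⟩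

end Paths

end BasisFamily
end

/-! ### Trivial cross ratios force a product formula -/

noncomputable section

namespace BasisFamily

variable {E : Type u} [DecidableEq E] {A : Type v} [CommGroup A]

lemma prod_union_pair (t : E → A) {I : Finset E} {x y : E} (hx : x ∉ I) (hy : y ∉ I)
    (hxy : x ≠ y) : ∏ j ∈ I ∪ {x, y}, t j = (∏ j ∈ I, t j) * (t x * t y) := by
  rw [Finset.prod_union (by simp [hx, hy]), Finset.prod_pair hxy]

/-- Both sides of a cross ratio relation cover I twice and each of x, y, z, w once, so they acquire
the same factor. -/
lemma CrossRatioFree.rescale {F : Finset E → Prop} {D : Finset E → A} (hD : CrossRatioFree F D)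
    (a : A) (t : E → A) : CrossRatioFree F fun J => a * (∏ j ∈ J, t j) * D J := by
  intro I x y z w hx hy hz hw hxy hxz hxw hyz hyw hzw h₁ h₂ h₃ h₄
  have := hD I x y z w hx hy hz hw hxy hxz hxw hyz hyw hzw h₁ h₂ h₃ h₄
  simp only [prod_union_pair t hx hy hxy, prod_union_pair t hy hz hyz, prod_union_pair t hz hw hzw,
    prod_union_pair t hw hx hxw.symm]
  calc _ = (a * a * (∏ j ∈ I, t j) * (∏ j ∈ I, t j) * (t x * t y * t z * t w)) *
        (D (I ∪ {x, y}) * D (I ∪ {z, w})) := by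
        simp only [mul_comm, mul_left_comm, mul_assoc]
    _ = _ := by
      rw [this]
      simp only [mul_comm, mul_left_comm, mul_assoc]

/-- Two elements of `B` are linked if they have a common neighbour other than `e` in the fundamental
graph of `B`. -/
def Linked (F : Finset E → Prop) (B : Finset E) (e : E) (i i' : E) : Prop :=
  i ∈ B ∧ i' ∈ B ∧ ∃ j, j ∉ B ∧ j ≠ e ∧ F (insert j (B.erase i)) ∧ F (insert j (B.erase i'))

lemma Linked.symm {F : Finset E → Prop} {B : Finset E} {e : E} {i i' : E}
    (h : Linked F B e i i') : Linked F B e i' i := by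
  obtain ⟨hi, hi', j, hj, he, h₁, h₂⟩ := h
  exact ⟨hi', hi, j, hj, he, h₂, h₁⟩

lemma Linked.exists_path {F : Finset E → Prop} {B : Finset E} {e : E} {x y : E} (hx : x ∈ B)
    (h : Relation.ReflTransGen (Linked F B e) x y) :
    ∃ (n : ℕ) (i j : ℕ → E), i 0 = x ∧ i n = y ∧ (∀ k ≤ n, i k ∈ B) ∧
      ∀ k < n, j k ∉ B ∧ j k ≠ e ∧ F (insert (j k) (B.erase (i k))) ∧
        F (insert (j k) (B.erase (i (k + 1)))) := by
  induction h with
  | refl => exact ⟨0, fun _ => x, fun _ => x, rfl, rfl, fun _ _ => hx, fun k hk => by omega⟩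
  | @tail y z _ h ih =>
    obtain ⟨n, i, j, h0, hn, hi, hj⟩ := ih
    obtain ⟨hy, hz, j', hj', he, h₁, h₂⟩ := h
    refine ⟨n + 1, fun k => if k ≤ n then i k else z, fun k => if k < n then j k else j', by simp [h0],
      by simp, ?_, ?_⟩
    · intro k hk
      dsimp only
      split_ifs with h
      · exact hi k h
      · exact hz
    · intro k hk
      rcases (Nat.lt_succ_iff.1 hk).lt_or_eq with h | rfl
      · simpa [h, h.le, Nat.succ_le_of_lt h] using hj k h
      · simpa [hn, hj', he, h₂] using h₁

lemma Linked.reverse {F : Finset E → Prop} {B : Finset E} {e : E} {x y : E}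
    (h : Relation.ReflTransGen (Linked F B e) x y) :
    Relation.ReflTransGen (Linked F B e) y x := by
  have : Std.Symm (Linked F B e) := ⟨fun _ _ => Linked.symm⟩
  exact Relation.ReflTransGen.stdSymm.symm _ _ h

lemma Linked.mem {F : Finset E → Prop} {B : Finset E} {e : E} {x y : E} (hx : x ∈ B)
    (h : Relation.ReflTransGen (Linked F B e) x y) : y ∈ B := by
  rcases h.cases_tail with rfl | ⟨_, -, h⟩
  · exact hx
  · exact h.2.1

/-- If `D = 1` on the members of `F` that do not contain `e`, then `D` is trivial up to rescaling. -/
lemma CrossRatioFree.exists_rescale_of_eq_one {F : Finset E → Prop} (hF : Exchange F) {r : ℕ}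
    (hr : ∀ J, F J → J.card = r) {D : Finset E → A} (hD : CrossRatioFree F D) {e : E}
    (hone : ∀ J, F J → e ∉ J → D J = 1) {B : Finset E} (hB : F B) (he : e ∉ B) :
    ∃ (a : A) (s : E → A), ∀ J, F J → a * (∏ j ∈ J, s j) * D J = 1 := by
  classical
  -- `Q x i'` says that i' is a neighbour of e in the component of x in the fundamental graph with e
  -- removed. The weight g of x is the value of D at the exchange of e for such an i', or 1 if there
  -- is none. It depends on the predicate `Q x` alone, so elements with equal predicates receive
  -- literally the same choice.
  let Q : E → E → Prop := fun x i' =>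
    (F (insert e (B.erase i'))) ∧ ((x ∈ B ∧ Relation.ReflTransGen (Linked F B e) x i') ∨
      (x ∉ B ∧ x ≠ e ∧ ∃ i ∈ B, F (insert x (B.erase i)) ∧
        Relation.ReflTransGen (Linked F B e) i i'))
  let g : (E → Prop) → A := fun q => if h : ∃ i', q i' then D (insert e (B.erase h.choose)) else 1
  have base : ∀ x i i', x ∈ B → Relation.ReflTransGen (Linked F B e) x i →
      Relation.ReflTransGen (Linked F B e) x i' → F (insert e (B.erase i)) →
      F (insert e (B.erase i')) → D (insert e (B.erase i)) = D (insert e (B.erase i')) := by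
    intro x i i' hx h h' hi hi'
    obtain ⟨n, p, q, h0, hn, hp, hq⟩ :=
      Linked.exists_path (Linked.mem hx h) ((Linked.reverse h).trans h')
    have := CrossRatioFree.eq_of_path hF hD hone n B p q hB he hp hq (by rwa [h0]) (by rwa [hn])
    rwa [h0, hn] at this
  have wd : ∀ x ∈ B, ∀ i i', Q x i → Q x i' →
      D (insert e (B.erase i)) = D (insert e (B.erase i')) := by
    rintro x hx i i' ⟨h1, h2⟩ ⟨h3, h4⟩
    rcases h2 with ⟨-, h2⟩ | ⟨h2, -⟩
    · rcases h4 with ⟨-, h4⟩ | ⟨h4, -⟩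
      · exact base x i i' hx h2 h4 h1 h3
      · exact absurd hx h4
    · exact absurd hx h2
  have ge : g (Q e) = 1 := by
    refine dif_neg ?_
    rintro ⟨i, -, ⟨h, -⟩ | ⟨-, h, -⟩⟩
    · exact he h
    · exact h rfl
  have gi : ∀ i ∈ B, F (insert e (B.erase i)) → g (Q i) = D (insert e (B.erase i)) := by
    intro i hi h
    have hq : Q i i := ⟨h, Or.inl ⟨hi, Relation.ReflTransGen.refl⟩⟩
    have hex : ∃ i', Q i i' := ⟨i, hq⟩
    rw [show g (Q i) = D (insert e (B.erase hex.choose)) from dif_pos hex]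
    exact wd i hi _ _ hex.choose_spec hq
  have gij : ∀ i ∈ B, ∀ j ∉ B, j ≠ e → F (insert j (B.erase i)) → g (Q j) = g (Q i) := by
    intro i hi j hj hje h
    congr 1
    funext i'
    refine propext ⟨?_, ?_⟩
    · rintro ⟨h1, ⟨h2, -⟩ | ⟨-, -, i'', hi'', h2, h3⟩⟩
      · exact absurd h2 hj
      · exact ⟨h1, Or.inl ⟨hi, Relation.ReflTransGen.head ⟨hi, hi'', j, hj, hje, h, h2⟩ h3⟩⟩
    · rintro ⟨h1, ⟨-, h2⟩ | ⟨h2, -⟩⟩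
      · exact ⟨h1, Or.inr ⟨hj, hje, i, hi, h, h2⟩⟩
      · exact absurd hi h2
  -- The rescaled value at B - i + j is (g(j) / g(i)) D(B - i + j). For j = e the factor cancels D
  -- because g(e) = 1; otherwise i and j share a component and D is already 1. So all exchanges of B
  -- are normalized and `CrossRatioFree.eq_one` applies.
  refine ⟨(∏ j ∈ B, g (Q j))⁻¹, fun x => g (Q x), ?_⟩
  refine (hD.rescale _ _).eq_one hF hr hB ?_ ?_
  · rw [hone B hB he, inv_mul_cancel, one_mul]
  · intro i hi j hj h
    rw [Finset.prod_insert (by simp [hj]), ← Finset.mul_prod_erase B _ hi]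
    by_cases hje : j = e
    · subst hje
      rw [ge, gi i hi h]
      simp
    · rw [gij i hi j hj hje h, hone _ h (by simp [he, Ne.symm hje])]
      simp

/-- A function without cross ratios on the bases of a matroid is of the form
`J ↦ a ∏_{j ∈ J} t(j)`. -/
theorem CrossRatioFree.exists_eq_prod (S : Finset E) :
    ∀ (F : Finset E → Prop) (r : ℕ) (D : Finset E → A), Exchange F →
      (∀ J, F J → J ⊆ S ∧ J.card = r) → CrossRatioFree F D →
      ∃ (a : A) (t : E → A), ∀ J, F J → D J = a * ∏ j ∈ J, t j := by
  classical
  induction S using Finset.induction_on with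
  | empty =>
    intro F r D hF hr hD
    refine ⟨D ∅, fun _ => 1, fun J hJ => ?_⟩
    rw [Finset.subset_empty.1 (hr J hJ).1]
    simp
  | insert e S heS ih =>
    intro F r D hF hr hD
    -- Deletion of e if some member avoids it: the product formula for the members without e is
    -- divided out, after which D = 1 on them.
    by_cases hB : ∃ B, F B ∧ e ∉ B
    · obtain ⟨B, hB, heB⟩ := hB
      have hF' : Exchange fun J => F J ∧ e ∉ J := by
        rintro B C ⟨hB, heB⟩ ⟨hC, heC⟩ x hx
        obtain ⟨y, hy, h⟩ := hF B C hB hC x hx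
        exact ⟨y, hy, h, by grind⟩
      have hr' : ∀ J, (F J ∧ e ∉ J) → J ⊆ S ∧ J.card = r := by
        rintro J ⟨hJ, he⟩
        exact ⟨(Finset.subset_insert_iff_of_notMem he).1 (hr J hJ).1, (hr J hJ).2⟩
      have hD' : CrossRatioFree (fun J => F J ∧ e ∉ J) D := by
        intro I x y z w hx hy hz hw hxy hxz hxw hyz hyw hzw h₁ h₂ h₃ h₄
        exact hD I x y z w hx hy hz hw hxy hxz hxw hyz hyw hzw h₁.1 h₂.1 h₃.1 h₄.1
      obtain ⟨a, t, h⟩ := ih _ r D hF' hr' hD'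
      obtain ⟨b, s, h'⟩ := (hD.rescale a⁻¹ (fun j => (t j)⁻¹)).exists_rescale_of_eq_one hF
        (fun J hJ => (hr J hJ).2) (e := e) (fun J hJ he => by
          rw [h J ⟨hJ, he⟩, Finset.prod_inv_distrib]
          rw [← mul_inv, mul_comm, mul_inv_cancel]) hB heB
      refine ⟨b⁻¹ * a, fun j => (s j)⁻¹ * t j, fun J hJ => ?_⟩
      rw [Finset.prod_mul_distrib, Finset.prod_inv_distrib, ← mul_one (_ * _), ← h' J hJ,
        Finset.prod_inv_distrib]
      generalize ∏ j ∈ J, t j = p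
      generalize ∏ j ∈ J, s j = q
      calc D J = (b⁻¹ * b) * (a * a⁻¹) * (q⁻¹ * q) * (p * p⁻¹) * D J := by simp
        _ = _ := by simp only [mul_comm, mul_left_comm, mul_assoc]
    -- Otherwise e lies in every member, so e is contracted. Its weight does not matter up to a
    -- constant and is set to 1.
    · push Not at hB
      have hF' : Exchange fun J => F (insert e J) ∧ e ∉ J := by
        rintro B C ⟨hB', heB⟩ ⟨hC, heC⟩ x hx
        obtain ⟨y, hy, h⟩ := hF _ _ hB' hC x (by grind)
        refine ⟨y, by grind, ?_, by grind⟩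
        convert h using 1
        grind
      have hr' : ∀ J, (F (insert e J) ∧ e ∉ J) → J ⊆ S ∧ J.card = r - 1 := by
        rintro J ⟨hJ, he⟩
        have := hr _ hJ
        rw [Finset.card_insert_of_notMem he] at this
        exact ⟨(Finset.insert_subset_insert_iff he).1 this.1, by omega⟩
      have hD' : CrossRatioFree (fun J => F (insert e J) ∧ e ∉ J) (fun J => D (insert e J)) := by
        intro I x y z w hx hy hz hw hxy hxz hxw hyz hyw hzw h₁ h₂ h₃ h₄
        have heI : e ∉ I := by grind
        have hxe : x ≠ e := by grind
        have hye : y ≠ e := by grind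
        have hze : z ≠ e := by grind
        have hwe : w ≠ e := by grind
        simp only [← Finset.insert_union] at h₁ h₂ h₃ h₄ ⊢
        refine hD (insert e I) x y z w ?_ ?_ ?_ ?_ hxy hxz hxw hyz hyw hzw h₁.1 h₂.1 h₃.1 h₄.1 <;>
          simp [*]
      obtain ⟨a, t, h⟩ := ih _ _ _ hF' hr' hD'
      refine ⟨a, fun j => if j = e then 1 else t j, fun J hJ => ?_⟩
      have heJ := hB J hJ
      have := h (J.erase e) ⟨by rwa [Finset.insert_erase heJ], by simp⟩
      rw [Finset.insert_erase heJ] at this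
      rw [this, ← Finset.mul_prod_erase J _ heJ, if_pos rfl, one_mul]
      congr 1
      exact Finset.prod_congr rfl fun j hj => (if_neg (Finset.ne_of_mem_erase hj)).symm

end BasisFamily
end

noncomputable section

/-! ### Universal properties of ordered blueprints -/

namespace OrderedBlueprint

lemma Hom.ext_mon {B : OrderedBlueprint.{u}} {C : OrderedBlueprint.{v}} {f g : Hom B C}
    (h : ∀ a ∈ B.mon, f.toRingHom a = g.toRingHom a) : f = g := by
  refine Hom.ext (RingHom.ext fun x => ?_)
  have hx : x ∈ Subsemiring.closure (B.mon : Set B.carrier) := by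
    rw [B.closure_mon]; trivial
  exact RingHom.eqOn_sclosure (f := f.toRingHom) (g := g.toRingHom) (fun a ha => h a ha) hx

lemma Hom.comp_apply {B : OrderedBlueprint.{u}} {C : OrderedBlueprint.{v}}
    {D : OrderedBlueprint.{w}} (f : Hom C D) (g : Hom B C) (x : B.carrier) :
    (f.comp g).toRingHom x = f.toRingHom (g.toRingHom x) := rfl

lemma Hom.le_map_of_zero_le {B : OrderedBlueprint.{u}} {C : OrderedBlueprint.{v}} (f : Hom B C)
    {x : B.carrier} (h : 0 ≤ x) : 0 ≤ f.toRingHom x := by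
  have := f.mono _ _ h
  rwa [map_zero] at this

lemma Hom.isWeakInverse {B : OrderedBlueprint.{u}} {C : OrderedBlueprint.{v}} (f : Hom B C)
    {a b : B.carrier} (h : B.IsWeakInverse a b) :
    C.IsWeakInverse (f.toRingHom a) (f.toRingHom b) := by
  refine ⟨f.map_mon _ h.1, f.map_mon _ h.2.1, ?_⟩
  rw [← map_add]
  exact f.le_map_of_zero_le h.2.2

/-- Elements with a common weak inverse are equal. -/
def UniqueWeakInverses (B : OrderedBlueprint.{u}) : Prop :=
  ∀ a a' b, B.IsWeakInverse a b → B.IsWeakInverse a' b → a = a'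

lemma IsWeakInverse.symm {B : OrderedBlueprint.{u}} {a b : B.carrier} (h : B.IsWeakInverse a b) :
    B.IsWeakInverse b a :=
  ⟨h.2.1, h.1, by rw [add_comm]; exact h.2.2⟩

/-- `B` contains an additive inverse of `1`. -/
def HasNeg (B : OrderedBlueprint.{u}) : Prop := ∃ m ∈ B.mon, 1 + m = 0

/-- Multiply x ≤ y by the additive inverse m of 1 and add x + y: this gives y ≤ x. -/
lemma HasNeg.eq_of_le {B : OrderedBlueprint.{u}} (hB : B.HasNeg) {x y : B.carrier} (h : x ≤ y) :
    x = y := by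
  obtain ⟨m, -, hm⟩ := hB
  refine le_antisymm h ?_
  have e : ∀ z : B.carrier, z + m * z = 0 := fun z => by
    rw [← one_add_mul, hm, zero_mul]
  have h1 : y + m * x ≤ y + m * y := B.add_mono _ _ _ _ le_rfl (B.mul_mono _ _ _ _ le_rfl h)
  calc y = x + (y + m * x) := by rw [add_left_comm, e, add_zero]
    _ ≤ x + (y + m * y) := B.add_mono _ _ _ _ le_rfl h1
    _ = x := by rw [e, add_zero]

lemma HasNeg.uniqueWeakInverses {B : OrderedBlueprint.{u}} (hB : B.HasNeg) :
    B.UniqueWeakInverses := by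
  intro a a' b h h'
  have e := hB.eq_of_le h.2.2
  have e' := hB.eq_of_le h'.2.2
  calc a = a + (a' + b) := by rw [← e', add_zero]
    _ = a' + (a + b) := by rw [add_left_comm]
    _ = a' := by rw [← e, add_zero]

/-- The character of `ℤˣ` that maps `-1` to a square root of `1`. -/
def signHom {R : Type u} [CommMonoid R] (e : R) (he : e * e = 1) : ℤˣ →* R where
  toFun s := if s = 1 then 1 else e
  map_one' := if_pos rfl
  map_mul' s t := by
    rcases Int.units_eq_one_or s with rfl | rfl <;> rcases Int.units_eq_one_or t with rfl | rfl <;>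
      simp [he]

lemma signHom_neg_one {R : Type u} [CommMonoid R] (e : R) (he : e * e = 1) :
    signHom e he (-1) = e := by
  simp [signHom]

lemma signHom_mem {R : Type u} [CommMonoid R] (e : R) (he : e * e = 1) (m : Submonoid R)
    (h : e ∈ m) (s : ℤˣ) : signHom e he s ∈ m := by
  rcases Int.units_eq_one_or s with rfl | rfl
  · rw [map_one]; exact m.one_mem
  · rwa [signHom_neg_one]

/-! #### Blueprints `(G ∪ {0}) ⫽ r` -/

/-- The semiring morphism `ℕ[G] → R` induced by a monoid morphism `G → R`. -/
def natLift {G : Type u} [CommGroup G] {R : Type v} [CommSemiring R] (f : G →* R) :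
    MonoidAlgebra ℕ G →+* R :=
  (MonoidAlgebra.lift ℕ R G f).toRingHom

lemma natLift_of {G : Type u} [CommGroup G] {R : Type v} [CommSemiring R] (f : G →* R) (a : G) :
    natLift f (MonoidAlgebra.of ℕ G a) = f a :=
  MonoidAlgebra.lift_of _ _

lemma natLift_mem {G : Type u} [CommGroup G] {B : OrderedBlueprint.{v}} (f : G →* B.carrier)
    (hf : ∀ a, f a ∈ B.mon) : ∀ a ∈ monomials G, natLift f a ∈ B.mon := by
  rintro _ (rfl | ⟨a, rfl⟩)
  · rw [map_zero]; exact B.zero_mem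
  · rw [natLift_of]; exact hf a

lemma natHom_ext {G : Type u} [CommGroup G] {R : Type v} [CommSemiring R]
    {f g : MonoidAlgebra ℕ G →+* R}
    (h : ∀ a, f (MonoidAlgebra.of ℕ G a) = g (MonoidAlgebra.of ℕ G a)) : f = g := by
  refine RingHom.ext fun x => ?_
  induction x using MonoidAlgebra.induction_on with
  | of a => exact h a
  | add x y hx hy => rw [map_add, map_add, hx, hy]
  | smul n x hx => rw [map_nsmul, map_nsmul, hx]

lemma ofGroup_hom_ext {G : Type u} [CommGroup G] {r : MonoidAlgebra ℕ G → MonoidAlgebra ℕ G → Prop}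
    {B : OrderedBlueprint.{v}} {f g : Hom (ofGroup G r) B}
    (h : ∀ a, f.toRingHom (ofGroupMk G r a : (ofGroup G r).carrier) =
      g.toRingHom (ofGroupMk G r a : (ofGroup G r).carrier)) : f = g := by
  refine Hom.ext_mon ?_
  rintro _ ⟨_, (rfl | ⟨a, rfl⟩), rfl⟩
  · exact (map_zero (f.toRingHom.comp (ofGroupProj G r))).trans
      (map_zero (g.toRingHom.comp (ofGroupProj G r))).symm
  · exact h a

lemma mem_ofGroup_mon {G : Type u} [CommGroup G] {r : MonoidAlgebra ℕ G → MonoidAlgebra ℕ G → Prop}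
    {x : (ofGroup G r).carrier} (hx : x ∈ (ofGroup G r).mon) :
    x = 0 ∨ ∃ a, x = ofGroupMk G r a := by
  obtain ⟨_, (rfl | ⟨a, rfl⟩), rfl⟩ := hx
  · exact Or.inl (map_zero (ofGroupProj G r))
  · exact Or.inr ⟨a, rfl⟩

/-! #### `𝔽₁^±` and `𝔽₁^{±,sq}` -/

/-- The class of `± 1` in `𝔽₁^±`. -/
def F1pm.mk : ℤˣ →* F1pm.mon :=
  ofGroupMk ℤˣ fun x y => x = 0 ∧ y = 1 + MonoidAlgebra.of ℕ ℤˣ (-1)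

/-- The element `ε` of `𝔽₁^±`. -/
def F1pm.eps : F1pm.carrier := F1pm.mk (-1)

lemma F1pm.eps_mem : F1pm.eps ∈ F1pm.mon := (F1pm.mk (-1)).2

lemma F1pm.eps_mul_eps : F1pm.eps * F1pm.eps = 1 := by
  change ((F1pm.mk (-1) * F1pm.mk (-1) : F1pm.mon) : F1pm.carrier) = _
  rw [← map_mul, neg_mul_neg, one_mul, map_one]
  rfl

lemma F1pm.le_one_add_eps : (0 : F1pm.carrier) ≤ 1 + F1pm.eps := by
  have h := ofGroupProj_le ℤˣ (fun x y => x = 0 ∧ y = 1 + MonoidAlgebra.of ℕ ℤˣ (-1)) _ _ ⟨rfl, rfl⟩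
  rw [map_zero, map_add, map_one] at h
  exact h

lemma F1pm.hom_ext {B : OrderedBlueprint.{u}} {f g : Hom F1pm B}
    (h : f.toRingHom F1pm.eps = g.toRingHom F1pm.eps) : f = g := by
  refine ofGroup_hom_ext fun s => ?_
  rcases Int.units_eq_one_or s with rfl | rfl
  · rw [map_one]
    exact (map_one f.toRingHom).trans (map_one g.toRingHom).symm
  · exact h

/-- The morphism `𝔽₁^± → B` that maps `ε` to `e`. -/
def F1pm.lift {B : OrderedBlueprint.{u}} (e : B.carrier) (he : e ∈ B.mon) (hee : e * e = 1)
    (h : 0 ≤ 1 + e) : Hom F1pm B :=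
  ofGroupLift (natLift (signHom e hee)) (natLift_mem _ (signHom_mem e hee _ he)) (by
    rintro x y ⟨rfl, rfl⟩
    rw [map_zero, map_add, map_one, natLift_of, signHom_neg_one]
    exact h)

lemma F1sq.hasNeg : F1sq.HasNeg := by
  refine ⟨F1pm.toSq.toRingHom F1pm.eps, F1pm.toSq.map_mon _ F1pm.eps_mem, le_antisymm ?_ ?_⟩
  · have h := ofGroupProj_le ℤˣ (fun x y =>
      (x = 0 ∧ y = 1 + MonoidAlgebra.of ℕ ℤˣ (-1)) ∨ (y = 0 ∧ x = 1 + MonoidAlgebra.of ℕ ℤˣ (-1)))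
      _ _ (Or.inr ⟨rfl, rfl⟩)
    rw [map_zero, map_add, map_one] at h
    exact h
  · have h := F1pm.toSq.le_map_of_zero_le F1pm.le_one_add_eps
    rwa [map_add, map_one] at h

lemma F1sq.hom_ext {B : OrderedBlueprint.{u}} {f g : Hom F1sq B}
    (h : f.comp F1pm.toSq = g.comp F1pm.toSq) : f = g :=
  ofGroup_hom_ext fun s => congrArg (fun k => k.toRingHom (F1pm.mk s : F1pm.carrier)) h

/-- The morphism `𝔽₁^{±,sq} → B` that maps `-1` to `m`. -/
def F1sq.lift {B : OrderedBlueprint.{u}} (m : B.carrier) (hm : m ∈ B.mon) (hmm : m * m = 1)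
    (h : 1 + m = 0) : Hom F1sq B :=
  ofGroupLift (natLift (signHom m hmm)) (natLift_mem _ (signHom_mem m hmm _ hm)) (by
    rintro x y (⟨rfl, rfl⟩ | ⟨rfl, rfl⟩) <;>
    rw [map_zero, map_add, map_one, natLift_of, signHom_neg_one, h])

lemma F1sq.lift_eps {B : OrderedBlueprint.{u}} (m : B.carrier) (hm : m ∈ B.mon) (hmm : m * m = 1)
    (h : 1 + m = 0) : ((F1sq.lift m hm hmm h).comp F1pm.toSq).toRingHom F1pm.eps = m :=
  (natLift_of _ _).trans (signHom_neg_one m hmm)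

/-! #### Quotients, tensor products and pasteurizations -/

/-- The universal property of `B ⫽ r`. -/
def quotLift {B : OrderedBlueprint.{u}} {r : B.carrier → B.carrier → Prop}
    {C : OrderedBlueprint.{v}} (f : Hom B C)
    (hr : ∀ x y, r x y → f.toRingHom x ≤ f.toRingHom y) : Hom (B.quot r) C :=
  liftRel f.toRingHom f.map_mon (by
    rintro x y (h | h)
    · exact f.mono _ _ h
    · exact hr _ _ h)

lemma quotMk_le {B : OrderedBlueprint.{u}} {r : B.carrier → B.carrier → Prop} {x y : B.carrier}
    (h : r x y) : (B.quotMk r).toRingHom x ≤ (B.quotMk r).toRingHom y :=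
  ofRelMk_le _ _ _ _ x y (GenLE.of _ _ (Or.inr h))

section Tensor

open scoped TensorProduct

variable {A : OrderedBlueprint.{u₁}} {C : OrderedBlueprint.{u₂}} {D : OrderedBlueprint.{u₃}}
  {X : OrderedBlueprint.{v}}

lemma mem_tensor_mon (f : Hom A C) (g : Hom A D) {x : (tensor f g).carrier}
    (hx : x ∈ (tensor f g).mon) : ∃ c ∈ C.mon, ∃ d ∈ D.mon,
      x = (tensorInl f g).toRingHom c * (tensorInr f g).toRingHom d := by
  let _ := f.toRingHom.toAlgebra
  let _ := g.toRingHom.toAlgebra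
  obtain ⟨_, ⟨c, hc, d, hd, rfl⟩, rfl⟩ := hx
  refine ⟨c, hc, d, hd, ?_⟩
  have e : c ⊗ₜ[A.carrier] d = (c ⊗ₜ[A.carrier] 1) * (1 ⊗ₜ[A.carrier] d) := by
    rw [Algebra.TensorProduct.tmul_mul_tmul, mul_one, one_mul]
  rw [e]
  exact map_mul (ofRelMk _ _ _ _) _ _

lemma tensor_hom_ext {f : Hom A C} {g : Hom A D} {p q : Hom (tensor f g) X}
    (hl : p.comp (tensorInl f g) = q.comp (tensorInl f g))
    (hr : p.comp (tensorInr f g) = q.comp (tensorInr f g)) : p = q := by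
  refine Hom.ext_mon fun x hx => ?_
  obtain ⟨c, -, d, -, rfl⟩ := mem_tensor_mon f g hx
  rw [map_mul, map_mul]
  exact congrArg₂ (· * ·) (congrArg (fun k => k.toRingHom c) hl)
    (congrArg (fun k => k.toRingHom d) hr)

lemma tensor_comm (f : Hom A C) (g : Hom A D) :
    (tensorInl f g).comp f = (tensorInr f g).comp g := by
  let _ := f.toRingHom.toAlgebra
  let _ := g.toRingHom.toAlgebra
  refine Hom.ext (RingHom.ext fun a => ?_)
  have : algebraMap A.carrier C.carrier a ⊗ₜ[A.carrier] (1 : D.carrier) =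
      (1 : C.carrier) ⊗ₜ[A.carrier] algebraMap A.carrier D.carrier a := by
    rw [Algebra.algebraMap_eq_smul_one, Algebra.algebraMap_eq_smul_one, TensorProduct.smul_tmul]
  exact congrArg (ofRelMk _ _ _ _) this

/-- The universal property of the tensor product. -/
def tensorLift (f : Hom A C) (g : Hom A D) (p : Hom C X) (q : Hom D X)
    (h : p.comp f = q.comp g) : Hom (tensor f g) X :=
  letI := f.toRingHom.toAlgebra
  letI := g.toRingHom.toAlgebra
  letI := (p.comp f).toRingHom.toAlgebra
  let p' : C.carrier →ₐ[A.carrier] X.carrier := { p.toRingHom with commutes' := fun _ => rfl }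
  let q' : D.carrier →ₐ[A.carrier] X.carrier :=
    { q.toRingHom with commutes' := fun a => congrArg (fun k => k.toRingHom a) h.symm }
  liftRel (Algebra.TensorProduct.productMap p' q' : C.carrier ⊗[A.carrier] D.carrier →+* X.carrier)
    (by
      rintro _ ⟨c, hc, d, hd, rfl⟩
      exact (congrArg (· ∈ X.mon) (Algebra.TensorProduct.productMap_apply_tmul p' q' c d)).mpr
        (X.mon.mul_mem (p.map_mon c hc) (q.map_mon d hd)))
    (by
      rintro _ _ (⟨a, b, hab, rfl, rfl⟩ | ⟨a, b, hab, rfl, rfl⟩)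
      · exact (Algebra.TensorProduct.productMap_left_apply p' q' a).le.trans
          ((p.mono _ _ hab).trans (Algebra.TensorProduct.productMap_left_apply p' q' b).ge)
      · exact (Algebra.TensorProduct.productMap_right_apply p' q' a).le.trans
          ((q.mono _ _ hab).trans (Algebra.TensorProduct.productMap_right_apply p' q' b).ge))

lemma tensorLift_inl (f : Hom A C) (g : Hom A D) (p : Hom C X) (q : Hom D X)
    (h : p.comp f = q.comp g) : (tensorLift f g p q h).comp (tensorInl f g) = p := by
  let _ := f.toRingHom.toAlgebra
  let _ := g.toRingHom.toAlgebra
  let _ := (p.comp f).toRingHom.toAlgebra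
  let p' : C.carrier →ₐ[A.carrier] X.carrier := { p.toRingHom with commutes' := fun _ => rfl }
  let q' : D.carrier →ₐ[A.carrier] X.carrier :=
    { q.toRingHom with commutes' := fun a => congrArg (fun k => k.toRingHom a) h.symm }
  exact Hom.ext (RingHom.ext fun c => Algebra.TensorProduct.productMap_left_apply p' q' c)

end Tensor

lemma F1.hom_ext {B : OrderedBlueprint.{u}} (f g : Hom F1 B) : f = g :=
  Hom.ext (Subsingleton.elim (α := ℕ →+* B.carrier) _ _)

section TensorSq

variable {B : OrderedBlueprint.{u}} (f : Hom F1pm B) {X : OrderedBlueprint.{v}}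

lemma HasNeg.map {B : OrderedBlueprint.{u}} {C : OrderedBlueprint.{v}} (hB : B.HasNeg)
    (f : Hom B C) : C.HasNeg := by
  obtain ⟨m, hm, h⟩ := hB
  exact ⟨f.toRingHom m, f.map_mon m hm, by rw [← map_one f.toRingHom, ← map_add, h, map_zero]⟩

lemma tensorSq_hasNeg : (tensorSq f).HasNeg :=
  F1sq.hasNeg.map (tensorInr f F1pm.toSq)

variable {f} in
-- The right factor imposes no further choice: a morphism from `F1sq` is determined by its
-- composition with `F1pm.toSq`, which the tensor product identifies with the structure map of B.
lemma tensorSq_hom_ext {p q : Hom (tensorSq f) X}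
    (h : p.comp (toTensorSq f) = q.comp (toTensorSq f)) : p = q := by
  refine tensor_hom_ext h (F1sq.hom_ext ?_)
  have e := tensor_comm f F1pm.toSq
  calc _ = Hom.comp (C := tensor f F1pm.toSq) p ((tensorInr f F1pm.toSq).comp F1pm.toSq) := rfl
    _ = Hom.comp (C := tensor f F1pm.toSq) q ((tensorInr f F1pm.toSq).comp F1pm.toSq) := by
      rw [← e]
      exact congrArg (fun k => k.comp f) h

/-- Morphisms from `B` into a blueprint with `-1` extend to `B ⊗ 𝔽₁^{±,sq}`. -/
def tensorSqLift (hX : X.HasNeg) (p : Hom B X) : Hom (tensorSq f) X :=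
  -- The image of -1 is forced to be the image of ε, and 0 ≤ 1 + e is an equality because X contains
  -- -1.
  let e := p.toRingHom (f.toRingHom F1pm.eps)
  tensorLift f F1pm.toSq p
    (F1sq.lift e (p.map_mon _ (f.map_mon _ F1pm.eps_mem))
      (by simp only [e]; rw [← map_mul, ← map_mul, F1pm.eps_mul_eps, map_one, map_one])
      (hX.eq_of_le (by
        have := (p.comp f).le_map_of_zero_le F1pm.le_one_add_eps
        rwa [map_add, map_one] at this)).symm)
    (F1pm.hom_ext (F1sq.lift_eps _ _ _ _).symm)

lemma tensorSqLift_comp (hX : X.HasNeg) (p : Hom B X) :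
    (tensorSqLift f hX p).comp (toTensorSq f) = p := by
  unfold tensorSqLift
  exact tensorLift_inl _ _ _ _ _

end TensorSq

section Pasteurization

variable {B : OrderedBlueprint.{u}} {X : OrderedBlueprint.{v}}

/-- The element `ε` of the pasteurization. -/
def pastEps (B : OrderedBlueprint.{u}) : B.pasteurization.carrier :=
  B.F1pmToPasteurization.toRingHom F1pm.eps

/-- The universal property of the pasteurization. -/
def pasteurizationLift (hX : X.UniqueWeakInverses) (f : Hom B X) (e : X.carrier) (he : e ∈ X.mon)
    (hee : e * e = 1) (h : 0 ≤ 1 + e) : Hom B.pasteurization X :=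
  quotLift (tensorLift (F1.toHom B) (F1.toHom F1pm) f (F1pm.lift e he hee h) (F1.hom_ext _ _)) (by
    rintro x y ⟨b, h₁, h₂⟩
    exact (hX _ _ _ (Hom.isWeakInverse _ h₁) (Hom.isWeakInverse _ h₂)).le)

lemma pasteurizationLift_comp (hX : X.UniqueWeakInverses) (f : Hom B X) (e : X.carrier)
    (he : e ∈ X.mon) (hee : e * e = 1) (h : 0 ≤ 1 + e) :
    (pasteurizationLift hX f e he hee h).comp B.toPasteurization = f :=
  tensorLift_inl (F1.toHom B) (F1.toHom F1pm) f (F1pm.lift e he hee h) (F1.hom_ext _ _)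

/-- The projection `B ⊗ 𝔽₁^± → B^±`. -/
def pasteurizationProj (B : OrderedBlueprint.{u}) :
    Hom (tensor (F1.toHom B) (F1.toHom F1pm)) B.pasteurization :=
  quotMk _ _

lemma pasteurizationProj_eq {a a' b : (tensor (F1.toHom B) (F1.toHom F1pm)).carrier}
    (h : (tensor (F1.toHom B) (F1.toHom F1pm)).IsWeakInverse a b)
    (h' : (tensor (F1.toHom B) (F1.toHom F1pm)).IsWeakInverse a' b) :
    B.pasteurizationProj.toRingHom a = B.pasteurizationProj.toRingHom a' :=
  le_antisymm (quotMk_le ⟨b, h, h'⟩) (quotMk_le ⟨b, h', h⟩)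

/-- The morphism `B ⊗ 𝔽₁^± → C ⊗ 𝔽₁^±` induced by `B → C`. -/
def tensorF1pmMap {C : OrderedBlueprint.{v}} (f : Hom B C) :
    Hom (tensor (F1.toHom B) (F1.toHom F1pm)) (tensor (F1.toHom C) (F1.toHom F1pm)) :=
  tensorLift _ _ ((tensorInl (F1.toHom C) (F1.toHom F1pm)).comp f)
    (tensorInr (F1.toHom C) (F1.toHom F1pm)) (F1.hom_ext _ _)

/-- A morphism `B → C` induces a morphism `B^± → C^±`. -/
def pasteurizationMap {C : OrderedBlueprint.{v}} (f : Hom B C) :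
    Hom B.pasteurization C.pasteurization :=
  quotLift (C.pasteurizationProj.comp (tensorF1pmMap f)) (by
    rintro x y ⟨b, h₁, h₂⟩
    exact (pasteurizationProj_eq (Hom.isWeakInverse _ h₁) (Hom.isWeakInverse _ h₂)).le)

lemma pasteurizationMap_comp {C : OrderedBlueprint.{v}} (f : Hom B C) :
    (pasteurizationMap f).comp B.toPasteurization = C.toPasteurization.comp f := by
  have h : (tensorF1pmMap f).comp (tensorInl _ _) = (tensorInl _ _).comp f :=
    tensorLift_inl _ _ _ _ _
  exact congrArg (C.pasteurizationProj.comp ·) h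

/-- Both e and the adjoined ε have 1 as a weak inverse, and pasteurization identifies such elements.
-/
lemma toPasteurization_eq_eps {e : B.carrier} (h : B.IsWeakInverse 1 e) :
    B.toPasteurization.toRingHom e = B.pastEps := by
  refine pasteurizationProj_eq (b := 1) ?_ ?_
  · have := (tensorInl (F1.toHom B) (F1.toHom F1pm)).isWeakInverse h
    rw [map_one] at this
    exact this.symm
  · have := (tensorInr (F1.toHom B) (F1.toHom F1pm)).isWeakInverse
      (⟨F1pm.mon.one_mem, F1pm.eps_mem, F1pm.le_one_add_eps⟩ : F1pm.IsWeakInverse 1 F1pm.eps)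
    rw [map_one] at this
    exact this.symm

lemma mem_pasteurization_mon {x : B.pasteurization.carrier} (hx : x ∈ B.pasteurization.mon) :
    x = 0 ∨ ∃ c ∈ B.mon, ∃ s : ℤˣ, x = B.toPasteurization.toRingHom c *
      B.F1pmToPasteurization.toRingHom (F1pm.mk s : F1pm.carrier) := by
  obtain ⟨y, hy, rfl⟩ := hx
  obtain ⟨c, hc, d, hd, rfl⟩ := mem_tensor_mon _ _ hy
  rcases mem_ofGroup_mon hd with rfl | ⟨s, rfl⟩
  · left
    rw [show (0 : (ofGroup ℤˣ _).carrier) = (0 : F1pm.carrier) from rfl, map_zero, mul_zero]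
    exact map_zero (pasteurizationProj B).toRingHom
  · exact Or.inr ⟨c, hc, s, map_mul (pasteurizationProj B).toRingHom _ _⟩

end Pasteurization

end OrderedBlueprint
end

noncomputable section

/-! ### Laurent monomials in the bases of a matroid -/

namespace Matroid

variable {E : Type u}

/-- The morphism from the group of Laurent monomials that is given by its values on the `x_J`. -/
def monLift (M : Matroid E) {A : Type v} [CommGroup A] (f : M.Basis → A) :
    M.LaurentMonomial →* A :=
  AddMonoidHom.toMultiplicativeLeft
    (Finsupp.liftAddHom fun J => zmultiplesHom (Additive A) (Additive.ofMul (f J)))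

lemma monLift_xMon (M : Matroid E) {A : Type v} [CommGroup A] (f : M.Basis → A) (J : M.Basis) :
    M.monLift f (M.xMon J) = f J := by
  change Additive.toMul ((Finsupp.liftAddHom fun J => zmultiplesHom (Additive A)
    (Additive.ofMul (f J))) (Finsupp.single J (1 : ℤ))) = _
  rw [Finsupp.liftAddHom_apply_single]
  simp

/-- A homomorphism from a group to a monoid takes values in the units, so the universal property of
the free abelian group L applies. -/
lemma mon_hom_ext {M : Matroid E} {A : Type v} [Monoid A] {f g : M.LaurentMonomial →* A}
    (h : ∀ J, f (M.xMon J) = g (M.xMon J)) : f = g := by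
  have key : AddMonoidHom.toMultiplicativeLeft.symm f.toHomUnits =
      AddMonoidHom.toMultiplicativeLeft.symm g.toHomUnits := by
    refine Finsupp.addHom_ext' fun J => AddMonoidHom.ext_int ?_
    refine congrArg Additive.ofMul (Units.ext ?_)
    exact h J
  have key' := AddMonoidHom.toMultiplicativeLeft.symm.injective key
  exact MonoidHom.ext fun x => congrArg (fun k => ((k x : Aˣ) : A)) key'

/-- The quotient map L → L/H is trivial on the generators x_J, hence trivial. -/
lemma mon_induction {M : Matroid E} {H : Subgroup M.LaurentMonomial} (h : ∀ J, M.xMon J ∈ H)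
    (x : M.LaurentMonomial) : x ∈ H := by
  have : (QuotientGroup.mk' H : M.LaurentMonomial →* M.LaurentMonomial ⧸ H) = 1 :=
    mon_hom_ext fun J => (QuotientGroup.eq_one_iff _).2 (h J)
  exact (QuotientGroup.eq_one_iff _).1 (congrArg (fun k => k x) this)

variable [LinearOrder E]

lemma exchange (M : Matroid E) :
    BasisFamily.Exchange fun J : Finset E => M.IsBase (J : Set E) := by
  intro B C hB hC a ha
  obtain ⟨b, hb, h⟩ := IsBase.exchange hB hC (e := a) (by simpa using ha)
  refine ⟨b, by simpa using hb, ?_⟩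
  convert h using 1
  simp

lemma IsBase.eRank_eq {M : Matroid E} {J : Finset E} (h : M.IsBase (J : Set E)) :
    M.eRank = J.card := by
  rw [← h.encard_eq_eRank, Set.encard_coe_eq_coe_finsetCard]

lemma IsBase.eRank_eq_add_two {M : Matroid E} {I : Finset E} {x y : E} (hx : x ∉ I) (hy : y ∉ I)
    (hxy : x ≠ y) (h : M.IsBase ((I ∪ {x, y} : Finset E) : Set E)) :
    M.eRank = (I.card : ℕ∞) + 2 := by
  rw [h.eRank_eq, Finset.card_union_of_disjoint (by simp [hx, hy]), Finset.card_pair hxy]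
  rfl

lemma IsBase.card_eq {M : Matroid E} {J J' : Finset E} (h : M.IsBase (J : Set E))
    (h' : M.IsBase (J' : Set E)) : J.card = J'.card := by
  have := h.eRank_eq.symm.trans h'.eRank_eq
  exact_mod_cast this

instance [Finite E] (M : Matroid E) : Nonempty M.Basis := by
  obtain ⟨B, hB⟩ := M.exists_isBase
  exact ⟨⟨B.toFinite.toFinset, by simpa using hB⟩⟩

/-- The cross ratio as a Laurent monomial. -/
def crossMon (M : Matroid E) (t : M.Omega) : M.LaurentMonomial :=
  M.xMon ⟨_, t.base₁₂⟩ * M.xMon ⟨_, t.base₃₄⟩ / (M.xMon ⟨_, t.base₂₃⟩ * M.xMon ⟨_, t.base₄₁⟩)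

/-- The group of monomials generated by the cross ratios. -/
def crossGroup (M : Matroid E) : Subgroup M.LaurentMonomial :=
  Subgroup.closure (Set.range M.crossMon)

lemma crossMon_mem (M : Matroid E) (t : M.Omega) : M.crossMon t ∈ M.crossGroup :=
  Subgroup.subset_closure ⟨t, rfl⟩

lemma monomialUnit_crossMon (M : Matroid E) (t : M.Omega) :
    M.monomialUnit (M.crossMon t) = M.crossRatio t := by
  simp only [crossMon, crossRatio, xUnit, map_div, map_mul]

lemma degree_crossMon (M : Matroid E) (t : M.Omega) : M.degree (M.crossMon t) = 1 := by
  unfold crossMon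
  rw [map_div, map_mul, map_mul, degree_xMon, degree_xMon, degree_xMon, degree_xMon, div_self']

lemma degree_eq_one_of_mem (M : Matroid E) {x : M.LaurentMonomial} (hx : x ∈ M.crossGroup) :
    M.degree x = 1 := by
  have : M.crossGroup ≤ M.degree.ker := by
    refine (Subgroup.closure_le _).2 ?_
    rintro _ ⟨t, rfl⟩
    exact M.degree_crossMon t
  exact this hx

open Classical in
/-- The value `f(x_J)` if `J` is a basis, and `0` otherwise. -/
def value (M : Matroid E) {R : Type v} [CommSemiring R] (f : M.LaurentMonomial →* R)
    (J : Finset E) : R :=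
  if h : M.IsBase (J : Set E) then f (M.xMon ⟨J, h⟩) else 0

lemma value_of_base {M : Matroid E} {R : Type v} [CommSemiring R] (f : M.LaurentMonomial →* R)
    {J : Finset E} (h : M.IsBase (J : Set E)) : M.value f J = f (M.xMon ⟨J, h⟩) :=
  dif_pos h

lemma value_of_not_base {M : Matroid E} {R : Type v} [CommSemiring R] (f : M.LaurentMonomial →* R)
    {J : Finset E} (h : ¬ M.IsBase (J : Set E)) : M.value f J = 0 :=
  dif_neg h

lemma map_value {M : Matroid E} {R : Type v} {S : Type w} [CommSemiring R] [CommSemiring S]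
    (g : R →+* S) (f : M.LaurentMonomial →* R) (J : Finset E) :
    g (M.value f J) = M.value ((g : R →* S).comp f) J := by
  by_cases h : M.IsBase (J : Set E)
  · rw [value_of_base _ h, value_of_base _ h]; rfl
  · rw [value_of_not_base _ h, value_of_not_base _ h, map_zero]

/-- The `3`-term expression `f(x_{I,1,2}) f(x_{I,3,4}) + e f(x_{I,1,3}) f(x_{I,2,4}) +
f(x_{I,1,4}) f(x_{I,2,3})`. -/
def plucker (M : Matroid E) {R : Type v} [CommSemiring R] (f : M.LaurentMonomial →* R) (e : R)
    (p : M.PluckerIndex) : R :=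
  M.value f (p.sub 0 1) * M.value f (p.sub 2 3) + e * (M.value f (p.sub 0 2) * M.value f (p.sub 1 3))
    + M.value f (p.sub 0 3) * M.value f (p.sub 1 2)

lemma map_plucker {M : Matroid E} {R : Type v} {S : Type w} [CommSemiring R] [CommSemiring S]
    (g : R →+* S) (f : M.LaurentMonomial →* R) (e : R) (p : M.PluckerIndex) :
    g (M.plucker f e p) = M.plucker ((g : R →* S).comp f) (g e) p := by
  simp only [plucker, map_add, map_mul, map_value]

lemma PluckerIndex.ne {M : Matroid E} (p : M.PluckerIndex) {k l : Fin 4} (h : k ≠ l) :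
    p.i k ≠ p.i l := fun h' => h (p.strictMono.injective h')

/-- The morphism `x_J ↦ a ∏_{j ∈ J} t(j)`. -/
def rescaling (M : Matroid E) {A : Type v} [CommGroup A] (a : A) (t : E → A) :
    M.LaurentMonomial →* A :=
  M.monLift fun J => a * ∏ j ∈ J.1, t j

lemma rescaling_xMon (M : Matroid E) {A : Type v} [CommGroup A] (a : A) (t : E → A)
    (J : M.Basis) : M.rescaling a t (M.xMon J) = a * ∏ j ∈ J.1, t j :=
  M.monLift_xMon _ J

/-- Each of the four bases has |I| + 2 elements, which leaves no room for coincidences. Only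
cyclically adjacent indices are separated: i₁ = i₃ and i₂ = i₄ remain possible, and then the cross
ratio is 1 (`crossMon_eq_one`). -/
lemma Omega.notMem {M : Matroid E} (t : M.Omega) :
    (t.i₁ ∉ t.I ∧ t.i₂ ∉ t.I ∧ t.i₃ ∉ t.I ∧ t.i₄ ∉ t.I) ∧
      t.i₁ ≠ t.i₂ ∧ t.i₂ ≠ t.i₃ ∧ t.i₃ ≠ t.i₄ ∧ t.i₄ ≠ t.i₁ := by
  have key : ∀ x y, M.IsBase ((t.I ∪ {x, y} : Finset E) : Set E) → x ∉ t.I ∧ y ∉ t.I ∧ x ≠ y := by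
    intro x y h
    have h1 : (t.I ∪ {x, y}).card = t.I.card + 2 := by
      have := h.eRank_eq.symm.trans t.card_I
      exact_mod_cast this
    have h2 : t.I ∪ {x, y} = insert x (insert y t.I) := by grind
    refine ⟨fun h => ?_, fun h => ?_, fun h => ?_⟩
    · rw [h2, Finset.insert_eq_of_mem (Finset.mem_insert_of_mem h)] at h1
      have := Finset.card_insert_le y t.I
      omega
    · rw [h2, Finset.insert_eq_of_mem h] at h1
      have := Finset.card_insert_le x t.I
      omega
    · subst h
      rw [h2, Finset.insert_eq_of_mem (Finset.mem_insert_self _ _)] at h1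
      have := Finset.card_insert_le x t.I
      omega
  have h1 := key _ _ t.base₁₂
  have h2 := key _ _ t.base₂₃
  have h3 := key _ _ t.base₃₄
  have h4 := key _ _ t.base₄₁
  tauto

/-- Numerator and denominator of a cross ratio contain the same elements of E with the same
multiplicities. Hence restricting to K forgets rescalings. -/
lemma rescaling_eq_one (M : Matroid E) {A : Type v} [CommGroup A] (a : A) (t : E → A)
    {x : M.LaurentMonomial} (hx : x ∈ M.crossGroup) : M.rescaling a t x = 1 := by
  have : M.crossGroup ≤ (M.rescaling a t).ker := by
    refine (Subgroup.closure_le _).2 ?_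
    rintro _ ⟨s, rfl⟩
    obtain ⟨⟨h1, h2, h3, h4⟩, h12, h23, h34, h41⟩ := s.notMem
    simp only [SetLike.mem_coe, MonoidHom.mem_ker, crossMon, map_div, map_mul, rescaling_xMon]
    rw [BasisFamily.prod_union_pair t h1 h2 h12, BasisFamily.prod_union_pair t h2 h3 h23,
      BasisFamily.prod_union_pair t h3 h4 h34, BasisFamily.prod_union_pair t h4 h1 h41,
      div_eq_one]
    simp only [mul_comm, mul_left_comm]
  exact this hx

/-- `3`-term Plücker relations are homogeneous with respect to rescaling. -/
lemma plucker_mul_rescaling (M : Matroid E) {R : Type v} [CommSemiring R]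
    (f : M.LaurentMonomial →* R) {A : Type w} [CommGroup A] (g : A →* R) (a : A) (t : E → A)
    (e : R) (p : M.PluckerIndex) :
    M.plucker (f * g.comp (M.rescaling a t)) e p =
      g (a * a * (∏ j ∈ p.I, t j) * (∏ j ∈ p.I, t j) *
        (t (p.i 0) * t (p.i 1) * t (p.i 2) * t (p.i 3))) * M.plucker f e p := by
  -- The factor of a product is symmetric in the four indices, so it is common to all three terms;
  -- products with a non-basis vanish on both sides.
  have key : ∀ k l m n : Fin 4, k ≠ l → m ≠ n →
      M.value (f * g.comp (M.rescaling a t)) (p.sub k l) *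
        M.value (f * g.comp (M.rescaling a t)) (p.sub m n) =
      g (a * a * (∏ j ∈ p.I, t j) * (∏ j ∈ p.I, t j) *
        (t (p.i k) * t (p.i l) * t (p.i m) * t (p.i n))) *
          (M.value f (p.sub k l) * M.value f (p.sub m n)) := by
    intro k l m n hkl hmn
    by_cases h1 : M.IsBase (p.sub k l : Set E)
    · by_cases h2 : M.IsBase (p.sub m n : Set E)
      · rw [value_of_base _ h1, value_of_base _ h2, value_of_base _ h1, value_of_base _ h2]
        simp only [MonoidHom.mul_apply, MonoidHom.comp_apply, rescaling_xMon, PluckerIndex.sub]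
        rw [BasisFamily.prod_union_pair t (p.notMem k) (p.notMem l) (p.ne hkl),
          BasisFamily.prod_union_pair t (p.notMem m) (p.notMem n) (p.ne hmn)]
        simp only [map_mul]
        ring
      · rw [value_of_not_base _ h2, value_of_not_base f h2]
        simp
    · rw [value_of_not_base _ h1, value_of_not_base f h1]
      simp
  unfold plucker
  rw [key 0 1 2 3 (by decide) (by decide), key 0 2 1 3 (by decide) (by decide),
    key 0 3 1 2 (by decide) (by decide)]
  simp only [map_mul]
  ring

open Classical in
/-- The class of `x_J` modulo cross ratios. -/
def classMod (M : Matroid E) (J : Finset E) : M.LaurentMonomial ⧸ M.crossGroup :=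
  if h : M.IsBase (J : Set E) then QuotientGroup.mk' M.crossGroup (M.xMon ⟨J, h⟩) else 1

lemma classMod_of_base {M : Matroid E} {J : Finset E} (h : M.IsBase (J : Set E)) :
    M.classMod J = QuotientGroup.mk' M.crossGroup (M.xMon ⟨J, h⟩) :=
  dif_pos h

lemma crossRatioFree_classMod (M : Matroid E) :
    BasisFamily.CrossRatioFree (fun J : Finset E => M.IsBase (J : Set E)) M.classMod := by
  intro I x y z w hx hy hz hw hxy hxz hxw hyz hyw hzw h₁ h₂ h₃ h₄
  rw [classMod_of_base h₁, classMod_of_base h₂, classMod_of_base h₃, classMod_of_base h₄,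
    ← div_eq_one, ← map_mul, ← map_mul, ← map_div]
  exact (QuotientGroup.eq_one_iff _).2 (M.crossMon_mem
    ⟨I, h₁.eRank_eq_add_two hx hy hxy, x, y, z, w, h₁, h₂, h₃, h₄⟩)

/-- The classes of the x_J in L/K have trivial cross ratios, so `CrossRatioFree.exists_eq_prod`
writes them as a ∏ t(j). Lifting a and t to L and inverting gives a rescaling that moves every
monomial into K. -/
lemma exists_rescaling (M : Matroid E) [Finite E] :
    ∃ (a : M.LaurentMonomial) (t : E → M.LaurentMonomial),
      ∀ x, x * M.rescaling a t x ∈ M.crossGroup := by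
  have := Fintype.ofFinite E
  obtain ⟨B⟩ : Nonempty M.Basis := inferInstance
  obtain ⟨a, t, h⟩ := BasisFamily.CrossRatioFree.exists_eq_prod Finset.univ _ B.1.card M.classMod
    M.exchange (fun J hJ => ⟨Finset.subset_univ J, IsBase.card_eq hJ B.2⟩) M.crossRatioFree_classMod
  obtain ⟨a', ha⟩ := QuotientGroup.mk'_surjective M.crossGroup a
  choose t' ht using fun j => QuotientGroup.mk'_surjective M.crossGroup (t j)
  refine ⟨a'⁻¹, fun j => (t' j)⁻¹, fun x => ?_⟩
  refine mon_induction (H := M.crossGroup.comap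
    (MonoidHom.id _ * M.rescaling a'⁻¹ fun j => (t' j)⁻¹)) (fun J => ?_) x
  have hJ := h J.1 J.2
  rw [classMod_of_base J.2] at hJ
  have key : QuotientGroup.mk' M.crossGroup
      (M.xMon J * M.rescaling a'⁻¹ (fun j => (t' j)⁻¹) (M.xMon J)) = 1 := by
    rw [rescaling_xMon, map_mul, hJ, map_mul, map_prod, map_inv, ha]
    simp only [map_inv, ht, Finset.prod_inv_distrib]
    rw [← mul_inv, mul_inv_cancel]
  change M.xMon J * M.rescaling a'⁻¹ (fun j => (t' j)⁻¹) (M.xMon J) ∈ M.crossGroup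
  exact (QuotientGroup.eq_one_iff _).1 key

/-- A retraction of the group of Laurent monomials onto the group generated by the cross ratios, by
rescaling. -/
def retraction (M : Matroid E) [Finite E] : M.LaurentMonomial →* M.LaurentMonomial :=
  MonoidHom.id _ * M.rescaling M.exists_rescaling.choose M.exists_rescaling.choose_spec.choose

lemma retraction_mem (M : Matroid E) [Finite E] (x : M.LaurentMonomial) :
    M.retraction x ∈ M.crossGroup :=
  M.exists_rescaling.choose_spec.choose_spec x

lemma retraction_eq_self (M : Matroid E) [Finite E] {x : M.LaurentMonomial}
    (hx : x ∈ M.crossGroup) : M.retraction x = x := by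
  change x * M.rescaling _ _ x = x
  rw [M.rescaling_eq_one _ _ hx, mul_one]

/-- The retraction differs from the identity by a rescaling, so each relation changes only by a
factor in the image of f. Solutions can thus be normalized to depend on K alone while all relations
survive. -/
lemma plucker_comp_retraction (M : Matroid E) [Finite E] {R : Type v} [CommSemiring R]
    (f : M.LaurentMonomial →* R) (e : R) (p : M.PluckerIndex) :
    ∃ v : M.LaurentMonomial, M.plucker (f.comp M.retraction) e p = f v * M.plucker f e p := by
  have h := M.plucker_mul_rescaling f f M.exists_rescaling.choose
    M.exists_rescaling.choose_spec.choose e p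
  have h' : f * f.comp (M.rescaling M.exists_rescaling.choose
      M.exists_rescaling.choose_spec.choose) = f.comp M.retraction :=
    MonoidHom.ext fun x => (map_mul f _ _).symm
  rw [h'] at h
  exact ⟨_, h⟩

/-! #### Plücker relations for arbitrary quadruples -/

section Signs

variable {R : Type v} [CommSemiring R]

/-- A function on pairs satisfies the `3`-term relations for increasing quadruples outside of `I`,
up to an element of `N`. -/
def ThreeTerm (I : Finset E) (e : R) (N : Set R) (G : E → E → R) : Prop :=
  (∀ a b, G a b = G b a) ∧ ∀ i₁ i₂ i₃ i₄, i₁ ∉ I → i₂ ∉ I → i₃ ∉ I → i₄ ∉ I → i₁ < i₂ →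
    i₂ < i₃ → i₃ < i₄ → G i₁ i₂ * G i₃ i₄ + e * (G i₁ i₃ * G i₂ i₄) + G i₁ i₄ * G i₂ i₃ ∈ N

/-- The `3`-term relations for `(x, y, z, w)`, with some signs. -/
def SignedThreeTerm (I : Finset E) (e : R) (N : Set R) (x y z w : E) : Prop :=
  -- The exponents precede G, so two functions on pairs satisfy the relation with the same signs.
  -- This is what allows `minor_exchangeMatrix_eq_value` to subtract two such relations.
  ∃ a b c : ℕ, ∀ G : E → E → R, ThreeTerm I e N G →
    e ^ a * (G x y * G z w) + e ^ b * (G x z * G y w) + e ^ c * (G x w * G y z) ∈ N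

variable {I : Finset E} {e : R} {N : Set R} {x y z w : E}

lemma SignedThreeTerm.swap₁ (h : SignedThreeTerm I e N x y z w) : SignedThreeTerm I e N y x z w := by
  obtain ⟨a, b, c, h⟩ := h
  refine ⟨a, c, b, fun G hG => ?_⟩
  convert h G hG using 1
  rw [hG.1 y x, add_right_comm, mul_comm (G y z), mul_comm (G y w)]

lemma SignedThreeTerm.swap₂ (h : SignedThreeTerm I e N x y z w) : SignedThreeTerm I e N x z y w := by
  obtain ⟨a, b, c, h⟩ := h
  refine ⟨b, a, c, fun G hG => ?_⟩
  convert h G hG using 1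
  rw [hG.1 z y, add_comm (_ * (G x y * _))]

lemma SignedThreeTerm.swap₃ (h : SignedThreeTerm I e N x y z w) : SignedThreeTerm I e N x y w z := by
  obtain ⟨a, b, c, h⟩ := h
  refine ⟨a, c, b, fun G hG => ?_⟩
  convert h G hG using 1
  rw [hG.1 w z, add_right_comm]

/-- Sort the quadruple by adjacent transpositions. Each of them permutes the three products, which
carry their powers of e along, so no property of e is required. -/
lemma signedThreeTerm (I : Finset E) (e : R) (N : Set R) {x y z w : E} (hx : x ∉ I) (hy : y ∉ I)
    (hz : z ∉ I) (hw : w ∉ I) (hxy : x ≠ y) (hxz : x ≠ z) (hxw : x ≠ w) (hyz : y ≠ z) (hyw : y ≠ w)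
    (hzw : z ≠ w) : SignedThreeTerm I e N x y z w := by
  have base : ∀ x y z w, x ∉ I → y ∉ I → z ∉ I → w ∉ I → x < y → y < z → z < w →
      SignedThreeTerm I e N x y z w := by
    intro x y z w hx hy hz hw hxy hyz hzw
    refine ⟨0, 1, 0, fun G hG => ?_⟩
    rw [pow_zero, pow_one, one_mul, one_mul]
    exact hG.2 x y z w hx hy hz hw hxy hyz hzw
  have three : ∀ x y z w, x ∉ I → y ∉ I → z ∉ I → w ∉ I → x ≠ y → x ≠ z → x ≠ w → y < z → z < w →
      SignedThreeTerm I e N x y z w := by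
    intro x y z w hx hy hz hw hxy hxz hxw hyz hzw
    rcases lt_or_gt_of_ne hxy with h | h
    · exact base x y z w hx hy hz hw h hyz hzw
    rcases lt_or_gt_of_ne hxz with h' | h'
    · exact (base y x z w hy hx hz hw h h' hzw).swap₁
    rcases lt_or_gt_of_ne hxw with h'' | h''
    · exact (base y z x w hy hz hx hw hyz h' h'').swap₂.swap₁
    · exact (base y z w x hy hz hw hx hyz hzw h'').swap₃.swap₂.swap₁
  have two : ∀ x y z w, x ∉ I → y ∉ I → z ∉ I → w ∉ I → x ≠ y → x ≠ z → x ≠ w → y ≠ z → y ≠ w →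
      z < w → SignedThreeTerm I e N x y z w := by
    intro x y z w hx hy hz hw hxy hxz hxw hyz hyw hzw
    rcases lt_or_gt_of_ne hyz with h | h
    · exact three x y z w hx hy hz hw hxy hxz hxw h hzw
    rcases lt_or_gt_of_ne hyw with h' | h'
    · exact (three x z y w hx hz hy hw hxz hxy hxw h h').swap₂
    · exact (three x z w y hx hz hw hy hxz hxw hxy hzw h').swap₃.swap₂
  rcases lt_or_gt_of_ne hzw with h | h
  · exact two x y z w hx hy hz hw hxy hxz hxw hyz hyw h
  · exact (two x y w z hx hy hw hz hxy hxw hxz hyw hyz h).swap₃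

lemma threeTerm_of_plucker {M : Matroid E} {I : Finset E} (hI : M.eRank = (I.card : ℕ∞) + 2)
    {e : R} {N : Set R} {f : M.LaurentMonomial →* R} (h : ∀ p, M.plucker f e p ∈ N) :
    ThreeTerm I e N fun a b => M.value f (I ∪ {a, b}) := by
  refine ⟨fun a b => by simp only [Finset.pair_comm], ?_⟩
  intro i₁ i₂ i₃ i₄ h₁ h₂ h₃ h₄ h₁₂ h₂₃ h₃₄
  refine h ⟨I, hI, ![i₁, i₂, i₃, i₄], ?_, ?_⟩
  · rw [Fin.strictMono_iff_lt_succ]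
    intro k
    fin_cases k
    · exact h₁₂
    · exact h₂₃
    · exact h₃₄
  · intro k
    fin_cases k <;> assumption

end Signs

end Matroid
end

noncomputable section

/-! ### The weak universal pasture -/

namespace OrderedBlueprint

lemma zero_le_mul_left {B : OrderedBlueprint.{u}} (x : B.carrier) {y : B.carrier} (hy : 0 ≤ y) :
    0 ≤ x * y := by
  simpa using B.mul_mono x x _ _ le_rfl hy

end OrderedBlueprint

namespace Matroid

open OrderedBlueprint

variable {E : Type u} [LinearOrder E] (M : Matroid E)

/-- The data of a morphism from `𝔽₁^±[x_J^{±1}] ⫽ Pl^w` to `B`. -/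
structure PluckerData (B : OrderedBlueprint.{v}) where
  toMonoidHom : M.LaurentMonomial →* B.carrier
  eps : B.carrier
  map_mem : ∀ x, toMonoidHom x ∈ B.mon
  eps_mem : eps ∈ B.mon
  eps_mul_eps : eps * eps = 1
  le_one_add_eps : 0 ≤ 1 + eps
  le_plucker : ∀ p, 0 ≤ M.plucker toMonoidHom eps p

variable {M}

/-- The image of `ε^i ∏ x_J^{e_J}`. -/
def PluckerData.signed {B : OrderedBlueprint.{v}} (d : M.PluckerData B) :
    M.SignedMonomial →* B.carrier :=
  (signHom d.eps d.eps_mul_eps).coprod d.toMonoidHom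

lemma PluckerData.signed_mem {B : OrderedBlueprint.{v}} (d : M.PluckerData B)
    (h : M.SignedMonomial) : d.signed h ∈ B.mon :=
  B.mon.mul_mem (signHom_mem d.eps d.eps_mul_eps B.mon d.eps_mem h.1) (d.map_mem h.2)

lemma PluckerData.signed_one {B : OrderedBlueprint.{v}} (d : M.PluckerData B)
    (x : M.LaurentMonomial) : d.signed (1, x) = d.toMonoidHom x := by
  simp [signed]

lemma PluckerData.signed_neg_one {B : OrderedBlueprint.{v}} (d : M.PluckerData B) :
    d.signed (-1, 1) = d.eps := by
  simp [signed, signHom_neg_one]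

lemma PluckerData.signed_apply {B : OrderedBlueprint.{v}} (d : M.PluckerData B)
    (h : M.SignedMonomial) : d.signed h = signHom d.eps d.eps_mul_eps h.1 * d.toMonoidHom h.2 := rfl

lemma natLift_xNat {R : Type v} [CommSemiring R] (f : M.SignedMonomial →* R) (J : Finset E) :
    natLift f (M.xNat J) = M.value (f.comp (MonoidHom.inr ℤˣ M.LaurentMonomial)) J := by
  by_cases h : M.IsBase (J : Set E)
  · rw [value_of_base _ h, xNat, dif_pos h, natLift_of]; rfl
  · rw [value_of_not_base _ h, xNat, dif_neg h, map_zero]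

lemma natLift_plucker {R : Type v} [CommSemiring R] (f : M.SignedMonomial →* R)
    (p : M.PluckerIndex) :
    natLift f (M.xNat (p.sub 0 1) * M.xNat (p.sub 2 3)
        + M.epsNat * (M.xNat (p.sub 0 2) * M.xNat (p.sub 1 3))
        + M.xNat (p.sub 0 3) * M.xNat (p.sub 1 2)) =
      M.plucker (f.comp (MonoidHom.inr ℤˣ M.LaurentMonomial)) (f (-1, 1)) p := by
  simp only [map_add, map_mul, natLift_xNat, plucker, epsNat, natLift_of]

/-- The morphism from `𝔽₁^±[x_J^{±1}] ⫽ Pl^w` given by `PluckerData`. -/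
def PluckerData.gradedLift {B : OrderedBlueprint.{v}} (d : M.PluckerData B) :
    Hom M.gradedWeakPasture B :=
  ofGroupLift (natLift d.signed) (natLift_mem _ d.signed_mem) (by
    rintro _ _ ⟨rfl, rfl | ⟨p, rfl⟩⟩
    · rw [map_zero, map_add, map_one, epsNat, natLift_of, signed_neg_one]
      exact d.le_one_add_eps
    · rw [map_zero, natLift_plucker, signed_neg_one]
      convert d.le_plucker p using 2
      exact MonoidHom.ext fun x => d.signed_one x)

lemma PluckerData.gradedLift_mk {B : OrderedBlueprint.{v}} (d : M.PluckerData B)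
    (h : M.SignedMonomial) : d.gradedLift.toRingHom (M.gradedMk h) = d.signed h :=
  natLift_of _ _

variable (M)

lemma gradedMk_mem (h : M.SignedMonomial) : M.gradedMk h ∈ M.gradedWeakPasture.mon :=
  (ofGroupMk M.SignedMonomial M.weakPluckerRel h).2

lemma gradedProj_eq : ofGroupProj M.SignedMonomial M.weakPluckerRel = natLift M.gradedMk :=
  natHom_ext fun h => (natLift_of M.gradedMk h).symm

lemma graded_le {x y : MonoidAlgebra ℕ M.SignedMonomial} (h : M.weakPluckerRel x y) :
    natLift M.gradedMk x ≤ natLift M.gradedMk y := by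
  rw [← gradedProj_eq]
  exact ofGroupProj_le M.SignedMonomial M.weakPluckerRel x y h

lemma graded_le_one_add_eps : 0 ≤ 1 + M.gradedMk (-1, 1) := by
  have h := M.graded_le ⟨rfl, Or.inl rfl⟩
  rwa [map_zero, map_add, map_one, epsNat, natLift_of] at h

lemma graded_le_plucker (p : M.PluckerIndex) :
    0 ≤ M.plucker (M.gradedMk.comp (MonoidHom.inr ℤˣ M.LaurentMonomial)) (M.gradedMk (-1, 1)) p := by
  have h := M.graded_le ⟨rfl, Or.inr ⟨p, rfl⟩⟩
  rwa [map_zero, natLift_plucker] at h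

/-- The group of signed monomials of degree `0`. -/
def zeroGroup : Subgroup M.SignedMonomial := (M.degree.comp (MonoidHom.snd _ _)).ker

lemma mem_zeroGroup {h : M.SignedMonomial} : h ∈ M.zeroGroup ↔ M.degree h.2 = 1 := Iff.rfl

/-- The class of a monomial in the degree-`0` part. -/
def zeroMk : M.zeroGroup →* M.degreeZeroPasture.carrier where
  toFun h := ⟨M.gradedMk h, Subsemiring.subset_closure (Or.inr ⟨h, h.2, rfl⟩)⟩
  map_one' := Subtype.ext (map_one M.gradedMk)
  map_mul' _ _ := Subtype.ext (map_mul M.gradedMk _ _)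

/-- The inclusion of the degree-`0` part. -/
def zeroIncl : Hom M.degreeZeroPasture M.gradedWeakPasture :=
  M.gradedWeakPasture.subIncl M.degreeZeroMon (Or.inl rfl) (by
    rintro _ (rfl | ⟨h, -, rfl⟩)
    · exact M.gradedWeakPasture.zero_mem
    · exact M.gradedMk_mem h)

lemma zeroIncl_zeroMk (h : M.zeroGroup) :
    M.zeroIncl.toRingHom (M.zeroMk h) = M.gradedMk h := rfl

lemma zeroMk_mem (h : M.zeroGroup) : M.zeroMk h ∈ M.degreeZeroPasture.mon :=
  Or.inr ⟨h, h.2, rfl⟩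

lemma mem_degreeZero_mon {x : M.degreeZeroPasture.carrier} (hx : x ∈ M.degreeZeroPasture.mon) :
    x = 0 ∨ ∃ h, x = M.zeroMk h := by
  rcases hx with h | ⟨h, h0, e⟩
  · exact Or.inl (Subtype.ext h)
  · exact Or.inr ⟨⟨h, h0⟩, Subtype.ext e⟩

/-- The sign `-1` as a monomial of degree `0`. -/
def zeroNeg : M.zeroGroup := ⟨(-1, 1), map_one M.degree⟩

lemma zeroMk_neg : M.degreeZeroPasture.IsWeakInverse 1 (M.zeroMk M.zeroNeg) :=
  ⟨M.degreeZeroPasture.mon.one_mem, M.zeroMk_mem _, M.graded_le_one_add_eps⟩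

/-- The canonical morphism from the degree-`0` part to `k_M^w`. -/
def toWeak : Hom M.degreeZeroPasture M.weakUniversalPasture :=
  M.degreeZeroPasture.toPasteurization

/-- The class of a monomial of degree `0` in `k_M^w`. -/
def weakMk : M.zeroGroup →* M.weakUniversalPasture.carrier :=
  (M.toWeak.toRingHom : _ →* _).comp M.zeroMk

lemma weakMk_mem (h : M.zeroGroup) : M.weakMk h ∈ M.weakUniversalPasture.mon :=
  M.toWeak.map_mon _ (M.zeroMk_mem h)

lemma weakMk_neg : M.weakMk M.zeroNeg = M.degreeZeroPasture.pastEps :=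
  toPasteurization_eq_eps M.zeroMk_neg

lemma weakMk_isWeakInverse : M.weakUniversalPasture.IsWeakInverse 1 (M.weakMk M.zeroNeg) := by
  have := M.toWeak.isWeakInverse M.zeroMk_neg
  rwa [map_one] at this

lemma zeroNeg_mul_self : M.zeroNeg * M.zeroNeg = 1 := by
  refine Subtype.ext (Prod.ext ?_ ?_) <;> simp [zeroNeg]

/-- The ε adjoined by pasteurization equals the sign already present in degree 0 (`weakMk_neg`), so
no further elements arise. -/
lemma mem_weak_mon {x : M.weakUniversalPasture.carrier} (hx : x ∈ M.weakUniversalPasture.mon) :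
    x = 0 ∨ ∃ h, x = M.weakMk h := by
  rcases mem_pasteurization_mon hx with rfl | ⟨c, hc, s, rfl⟩
  · exact Or.inl rfl
  · rcases M.mem_degreeZero_mon hc with rfl | ⟨h, rfl⟩
    · left
      rw [map_zero, zero_mul]
      rfl
    · right
      rcases Int.units_eq_one_or s with rfl | rfl
      · refine ⟨h, ?_⟩
        rw [map_one]
        change _ * M.degreeZeroPasture.F1pmToPasteurization.toRingHom 1 = _
        rw [map_one, mul_one]
        rfl
      · refine ⟨h * M.zeroNeg, ?_⟩
        rw [map_mul, weakMk_neg]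
        rfl

variable {M}

lemma weak_hom_ext {B : OrderedBlueprint.{v}} {f g : Hom M.weakUniversalPasture B}
    (h : ∀ x, f.toRingHom (M.weakMk x) = g.toRingHom (M.weakMk x)) : f = g := by
  refine Hom.ext_mon fun a ha => ?_
  rcases M.mem_weak_mon ha with rfl | ⟨x, rfl⟩
  · rw [map_zero, map_zero]
  · exact h x

/-- The morphism from `k_M^w` given by `PluckerData`. -/
def PluckerData.lift {B : OrderedBlueprint.{v}} (d : M.PluckerData B)
    (hB : B.UniqueWeakInverses) : Hom M.weakUniversalPasture B :=
  pasteurizationLift hB (d.gradedLift.comp M.zeroIncl) d.eps d.eps_mem d.eps_mul_eps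
    d.le_one_add_eps

lemma PluckerData.lift_mk {B : OrderedBlueprint.{v}} (d : M.PluckerData B)
    (hB : B.UniqueWeakInverses) (h : M.zeroGroup) :
    (d.lift hB).toRingHom (M.weakMk h) = d.signed h := by
  have := pasteurizationLift_comp hB (d.gradedLift.comp M.zeroIncl) d.eps d.eps_mem d.eps_mul_eps
    d.le_one_add_eps
  refine (congrArg (fun k => k.toRingHom (M.zeroMk h)) this).trans ?_
  exact d.gradedLift_mk h

variable (M)

/-- The monomial `x_I / x_J` of degree `0`. -/
def zeroRatio (I J : M.Basis) : M.zeroGroup :=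
  ⟨(1, M.xMon I / M.xMon J), by
    rw [mem_zeroGroup, map_div, degree_xMon, degree_xMon, div_self']⟩

lemma xRatio_eq (I J : M.Basis) : M.xRatio I J = M.weakMk (M.zeroRatio I J) := rfl

/-! #### Fundamental elements -/

/-- The blueprint `ℕ[L]` in which `0 ≤ n` if and only if no coefficient of `n` is equal to `1`. -/
def testBlueprint (L : Type u) [CommGroup L] : OrderedBlueprint.{u} :=
  -- Within each class l this is the addition rule of the Krasner hyperfield: a sum is null unless
  -- it has exactly one term. The natural numbers different from 1 are closed under sums and
  -- multiples, so N is an ideal.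
  let N : Set (MonoidAlgebra ℕ L) := {n | ∀ l, n.coeff l ≠ 1}
  have hadd : ∀ m n, m ∈ N → n ∈ N → m + n ∈ N := fun m n hm hn l => by
    have h₁ := hm l
    have h₂ := hn l
    rw [MonoidAlgebra.coeff_add, Finsupp.add_apply]
    omega
  have hmul : ∀ x n, n ∈ N → x * n ∈ N := fun x n hn => by
    induction x using MonoidAlgebra.induction_on with
    | of a =>
      intro l
      rw [MonoidAlgebra.of_apply, MonoidAlgebra.coeff_single_mul_apply, one_mul]
      exact hn _
    | add x y hx hy => rw [add_mul]; exact hadd _ _ hx hy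
    | smul c x hx =>
      intro l h
      rw [smul_mul_assoc, MonoidAlgebra.coeff_smul, Finsupp.smul_apply, smul_eq_mul] at h
      exact hx l (Nat.eq_one_of_mul_eq_one_left h)
  { carrier := MonoidAlgebra ℕ L
    order :=
      { le := fun x y => ∃ n ∈ N, y = x + n
        le_refl := fun x => ⟨0, fun l => by simp, by simp⟩
        le_trans := by
          rintro x _ _ ⟨m, hm, rfl⟩ ⟨n, hn, rfl⟩
          exact ⟨m + n, hadd _ _ hm hn, add_assoc _ _ _⟩
        le_antisymm := by
          rintro x _ ⟨m, hm, rfl⟩ ⟨n, hn, h⟩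
          refine MonoidAlgebra.coeff_injective (Finsupp.ext fun l => ?_)
          have := congrArg (fun y => y.coeff l) h
          simp only [MonoidAlgebra.coeff_add, Finsupp.add_apply] at this ⊢
          omega }
    add_mono := by
      rintro x _ z _ ⟨m, hm, rfl⟩ ⟨n, hn, rfl⟩
      exact ⟨m + n, hadd _ _ hm hn, add_add_add_comm _ _ _ _⟩
    mul_mono := by
      rintro x _ z _ ⟨m, hm, rfl⟩ ⟨n, hn, rfl⟩
      refine ⟨x * n + (z * m + m * n), hadd _ _ (hmul _ _ hn) (hadd _ _ (hmul _ _ hm)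
        (hmul _ _ hn)), ?_⟩
      ring
    mon := monomials L
    zero_mem := Or.inl rfl
    closure_mon := closure_monomials L }

lemma testBlueprint_zero_le {L : Type u} [CommGroup L] {n : MonoidAlgebra ℕ L} :
    (0 : (testBlueprint L).carrier) ≤ n ↔ ∀ l, n.coeff l ≠ 1 := by
  constructor
  · rintro ⟨m, hm, rfl⟩ l
    have := hm l
    change (0 + m).coeff l ≠ 1
    rwa [zero_add]
  · exact fun h => ⟨n, h, (zero_add n).symm⟩

end Matroid
end

noncomputable section

/-! ### The foundation -/

namespace Matroid

open OrderedBlueprint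

/-- The class of an element of `L` in the test blueprint. -/
def testOf (L : Type u) [CommGroup L] : L →* (testBlueprint L).carrier := MonoidAlgebra.of ℕ L

/-- The coefficients of elements of the test blueprint. -/
def testCoeff {L : Type u} [CommGroup L] (l : L) : (testBlueprint L).carrier →+ ℕ where
  toFun n := MonoidAlgebra.coeff (R := ℕ) (M := L) n l
  map_zero' := rfl
  map_add' _ _ := rfl

lemma testCoeff_ne_one_iff {L : Type u} [CommGroup L] {n : (testBlueprint L).carrier} :
    0 ≤ n ↔ ∀ l, testCoeff l n ≠ 1 :=
  testBlueprint_zero_le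

lemma testCoeff_of_ne {L : Type u} [CommGroup L] {l m : L} (h : l ≠ m) :
    testCoeff m (testOf L l) = 0 := by
  change (MonoidAlgebra.of ℕ L l).coeff m = 0
  rw [MonoidAlgebra.of_apply, MonoidAlgebra.coeff_single]
  exact Finsupp.single_eq_of_ne h.symm

lemma testCoeff_of_self {L : Type u} [CommGroup L] (l : L) : testCoeff l (testOf L l) = 1 := by
  change (MonoidAlgebra.of ℕ L l).coeff l = 1
  rw [MonoidAlgebra.of_apply, MonoidAlgebra.coeff_single]
  exact Finsupp.single_eq_same

lemma mem_testBlueprint_mon {L : Type u} [CommGroup L] {x : (testBlueprint L).carrier}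
    (hx : x ∈ (testBlueprint L).mon) : x = 0 ∨ ∃ l, x = testOf L l := hx

lemma testBlueprint_two {L : Type u} [CommGroup L] (l : L) : 0 ≤ testOf L l + testOf L l := by
  rw [testCoeff_ne_one_iff]
  intro m h
  rw [map_add] at h
  omega

lemma testBlueprint_three {L : Type u} [CommGroup L] (l : L) :
    0 ≤ testOf L l + testOf L l + testOf L l := by
  rw [testCoeff_ne_one_iff]
  intro m h
  rw [map_add, map_add] at h
  omega

lemma testBlueprint_isWeakInverse {L : Type u} [CommGroup L] {a b : (testBlueprint L).carrier}
    (h : (testBlueprint L).IsWeakInverse a b) : a = b := by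
  obtain ⟨ha, hb, h⟩ := h
  have h' := testCoeff_ne_one_iff.1 h
  rcases mem_testBlueprint_mon ha with rfl | ⟨l, rfl⟩ <;>
    rcases mem_testBlueprint_mon hb with rfl | ⟨m, rfl⟩
  · rfl
  · exact absurd (by rw [zero_add]; exact testCoeff_of_self m) (h' m)
  · exact absurd (by rw [add_zero]; exact testCoeff_of_self l) (h' l)
  · by_contra hne
    have hlm : m ≠ l := fun e => hne (by rw [e])
    refine h' l ?_
    rw [map_add, testCoeff_of_self, testCoeff_of_ne hlm]

lemma testBlueprint_uniqueWeakInverses (L : Type u) [CommGroup L] :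
    (testBlueprint L).UniqueWeakInverses := fun _ _ _ h h' =>
  (testBlueprint_isWeakInverse h).trans (testBlueprint_isWeakInverse h').symm

/-- If l ≠ 1, the coefficients at l and at 1 both need a further term, but b is zero or a single
monomial and can supply only one of them. -/
lemma testBlueprint_fundamental {L : Type u} [CommGroup L] {l : L} {b : (testBlueprint L).carrier}
    (hb : b ∈ (testBlueprint L).mon) (h : 0 ≤ testOf L l + b + 1) : l = 1 := by
  by_contra hne
  have h' := testCoeff_ne_one_iff.1 h
  have h1 := h' 1
  have hl := h' l
  rw [← map_one (testOf L)] at h1 hl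
  rw [map_add, map_add, testCoeff_of_self, testCoeff_of_ne hne] at h1
  rw [map_add, map_add, testCoeff_of_self, testCoeff_of_ne (Ne.symm hne)] at hl
  rcases mem_testBlueprint_mon hb with rfl | ⟨m, rfl⟩
  · rw [map_zero] at hl
    exact hl rfl
  · by_cases hm : m = 1
    · subst hm
      rw [testCoeff_of_ne (Ne.symm hne)] at hl
      exact hl rfl
    · rw [testCoeff_of_ne hm] at h1
      exact h1 rfl

variable {E : Type u} [LinearOrder E] (M : Matroid E)

/-- The morphism `x_J ↦ [x_J]` to the test blueprint of the group of Laurent monomials modulo cross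
ratios. -/
def testHom : M.LaurentMonomial →* (testBlueprint (M.LaurentMonomial ⧸ M.crossGroup)).carrier :=
  (testOf (M.LaurentMonomial ⧸ M.crossGroup)).comp (QuotientGroup.mk' M.crossGroup)

lemma value_testHom {J : Finset E} (h : M.IsBase (J : Set E)) :
    M.value M.testHom J = testOf _ (M.classMod J) := by
  rw [value_of_base _ h, classMod_of_base h]; rfl

/-- By basis exchange the number of nonzero products among the three is not 1. Any two nonzero
products differ by a cross ratio, so they have the same class modulo K. The relation therefore is 0
or a sum of two or three copies of one monomial. -/
lemma testBlueprint_plucker (p : M.PluckerIndex) : 0 ≤ M.plucker M.testHom 1 p := by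
  have hI := p.notMem
  have pairs : ∀ a b c d : Fin 4, a ≠ b → a ≠ c → a ≠ d → b ≠ c → b ≠ d → c ≠ d →
      M.IsBase (p.sub a b : Set E) → M.IsBase (p.sub c d : Set E) →
      (M.IsBase (p.sub a c : Set E) ∧ M.IsBase (p.sub b d : Set E)) ∨
      (M.IsBase (p.sub a d : Set E) ∧ M.IsBase (p.sub b c : Set E)) :=
    fun a b c d hab hac had hbc hbd hcd h h' => M.exchange.pairs (hI a) (hI b) (hI c) (hI d)
      (p.ne hab) (p.ne hac) (p.ne had) (p.ne hbc) (p.ne hbd) (p.ne hcd) h h'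
  have cross : ∀ a b c d : Fin 4, a ≠ b → a ≠ c → a ≠ d → b ≠ c → b ≠ d → c ≠ d →
      M.IsBase (p.sub a b : Set E) → M.IsBase (p.sub b c : Set E) →
      M.IsBase (p.sub c d : Set E) → M.IsBase (p.sub d a : Set E) →
      M.classMod (p.sub a b) * M.classMod (p.sub c d) =
        M.classMod (p.sub b c) * M.classMod (p.sub d a) :=
    fun a b c d hab hac had hbc hbd hcd => M.crossRatioFree_classMod p.I _ _ _ _ (hI a) (hI b)
      (hI c) (hI d) (p.ne hab) (p.ne hac) (p.ne had) (p.ne hbc) (p.ne hbd) (p.ne hcd)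
  have comm : ∀ a b, p.sub a b = p.sub b a := fun a b => by
    rw [PluckerIndex.sub, PluckerIndex.sub, Finset.pair_comm]
  have e1 := pairs 0 1 2 3 (by decide) (by decide) (by decide) (by decide) (by decide) (by decide)
  have e2 := pairs 0 2 1 3 (by decide) (by decide) (by decide) (by decide) (by decide) (by decide)
  have e3 := pairs 0 3 1 2 (by decide) (by decide) (by decide) (by decide) (by decide) (by decide)
  have c12 := cross 0 1 3 2 (by decide) (by decide) (by decide) (by decide) (by decide) (by decide)
  have c13 := cross 0 1 2 3 (by decide) (by decide) (by decide) (by decide) (by decide) (by decide)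
  have c23 := cross 0 2 1 3 (by decide) (by decide) (by decide) (by decide) (by decide) (by decide)
  rw [comm 3 2, comm 2 0, mul_comm (M.classMod (p.sub 1 3))] at c12
  rw [comm 3 0, mul_comm (M.classMod (p.sub 1 2))] at c13
  rw [comm 3 0, comm 2 1, mul_comm (M.classMod (p.sub 1 2))] at c23
  rw [comm 2 1] at e2
  rw [comm 3 1, comm 3 2] at e3
  have prod : ∀ J K : Finset E, M.IsBase (J : Set E) ∧ M.IsBase (K : Set E) →
      M.value M.testHom J * M.value M.testHom K =
        testOf _ (M.classMod J * M.classMod K) := by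
    intro J K h
    rw [M.value_testHom h.1, M.value_testHom h.2, map_mul]
  have zero : ∀ J K : Finset E, ¬ (M.IsBase (J : Set E) ∧ M.IsBase (K : Set E)) →
      M.value M.testHom J * M.value M.testHom K = 0 := by
    intro J K h
    rcases not_and_or.1 h with h | h <;> rw [value_of_not_base _ h]
    · exact zero_mul _
    · exact mul_zero _
  rw [plucker, one_mul]
  by_cases h1 : M.IsBase (p.sub 0 1 : Set E) ∧ M.IsBase (p.sub 2 3 : Set E)
  · by_cases h2 : M.IsBase (p.sub 0 2 : Set E) ∧ M.IsBase (p.sub 1 3 : Set E)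
    · have q1 := c12 h1.1 h2.2 h1.2 h2.1
      by_cases h3 : M.IsBase (p.sub 0 3 : Set E) ∧ M.IsBase (p.sub 1 2 : Set E)
      · have q2 := c13 h1.1 h3.2 h1.2 h3.1
        rw [prod _ _ h1, prod _ _ h2, prod _ _ h3, ← q1, ← q2]
        exact testBlueprint_three _
      · rw [prod _ _ h1, prod _ _ h2, zero _ _ h3, ← q1, add_zero]
        exact testBlueprint_two _
    · have h3 := (e1 h1.1 h1.2).resolve_left h2
      have q2 := c13 h1.1 h3.2 h1.2 h3.1
      rw [prod _ _ h1, zero _ _ h2, prod _ _ h3, ← q2, add_zero]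
      exact testBlueprint_two _
  · rw [zero _ _ h1, zero_add]
    by_cases h2 : M.IsBase (p.sub 0 2 : Set E) ∧ M.IsBase (p.sub 1 3 : Set E)
    · have h3 := (e2 h2.1 h2.2).resolve_left h1
      have q2 := c23 h2.1 h3.2 h2.2 h3.1
      rw [prod _ _ h2, prod _ _ h3, ← q2]
      exact testBlueprint_two _
    · have h3 : ¬ (M.IsBase (p.sub 0 3 : Set E) ∧ M.IsBase (p.sub 1 2 : Set E)) := by
        intro h3
        rcases e3 h3.1 h3.2 with h | ⟨h, h'⟩
        · exact h1 h
        · exact h2 ⟨h, h'⟩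
      rw [zero _ _ h2, zero _ _ h3, add_zero]

/-- The morphism from `k_M^w` to the test blueprint. -/
def testData : M.PluckerData (testBlueprint (M.LaurentMonomial ⧸ M.crossGroup)) where
  toMonoidHom := M.testHom
  eps := 1
  map_mem x := Or.inr ⟨_, rfl⟩
  eps_mem := (testBlueprint _).mon.one_mem
  eps_mul_eps := one_mul 1
  le_one_add_eps := by
    have := testBlueprint_two (1 : M.LaurentMonomial ⧸ M.crossGroup)
    rwa [map_one] at this
  le_plucker := M.testBlueprint_plucker

lemma testData_signed (h : M.SignedMonomial) :
    M.testData.signed h = testOf _ (QuotientGroup.mk' M.crossGroup h.2) := by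
  rw [PluckerData.signed_apply]
  have : signHom M.testData.eps M.testData.eps_mul_eps h.1 = 1 := by
    rcases Int.units_eq_one_or h.1 with h | h <;> rw [h]
    · exact map_one _
    · exact signHom_neg_one _ _
  rw [this, one_mul]
  rfl

/-- A signed element of the group generated by the cross ratios, as a monomial of degree `0`. -/
def crossZero : ℤˣ × M.crossGroup →* M.zeroGroup where
  toFun h := ⟨(h.1, h.2), M.degree_eq_one_of_mem h.2.2⟩
  map_one' := rfl
  map_mul' _ _ := rfl

/-- In the test blueprint ε becomes 1, and `testBlueprint_fundamental` forces the image of the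
element in L/K to be trivial. -/
lemma mem_crossZero_of_isFundamental {h : M.zeroGroup}
    (hx : M.weakUniversalPasture.IsFundamental (M.weakMk h)) : ∃ k, h = M.crossZero k := by
  obtain ⟨-, b, hb, e, he, hle⟩ := hx
  let φ := M.testData.lift (testBlueprint_uniqueWeakInverses _)
  have h1 : φ.toRingHom (M.weakMk h) = _ := M.testData.lift_mk _ h
  rw [testData_signed] at h1
  have hb' : φ.toRingHom b ∈ (testBlueprint _).mon := φ.map_mon b hb
  have he' : φ.toRingHom e = 1 := by
    have := testBlueprint_isWeakInverse (φ.isWeakInverse he)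
    rw [← this, map_one]
  have hle' : 0 ≤ φ.toRingHom (M.weakMk h) + φ.toRingHom b + 1 := by
    rcases hle with hle | hle
    · have := φ.le_map_of_zero_le hle
      rwa [map_add, map_add, map_one] at this
    · have := φ.le_map_of_zero_le hle
      rwa [map_add, map_add, he'] at this
  rw [h1] at hle'
  have := testBlueprint_fundamental hb' hle'
  exact ⟨(h.1.1, ⟨h.1.2, (QuotientGroup.eq_one_iff _).1 this⟩), rfl⟩

lemma crossMon_rotate (t : M.Omega) : ∃ t' : M.Omega, M.crossMon t' = (M.crossMon t)⁻¹ := by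
  refine ⟨⟨t.I, t.card_I, t.i₂, t.i₃, t.i₄, t.i₁, t.base₂₃, t.base₃₄, t.base₄₁, t.base₁₂⟩, ?_⟩
  simp only [crossMon, inv_div]
  rw [mul_comm (M.xMon ⟨t.I ∪ {t.i₃, t.i₄}, _⟩)]

lemma crossMon_eq_one (t : M.Omega) (h : t.i₁ = t.i₃ ∨ t.i₂ = t.i₄) : M.crossMon t = 1 := by
  obtain ⟨I, hI, x, y, z, w, h₁, h₂, h₃, h₄⟩ := t
  have comm : ∀ a b (h : M.IsBase ((I ∪ {a, b} : Finset E) : Set E))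
      (h' : M.IsBase ((I ∪ {b, a} : Finset E) : Set E)),
      M.xMon ⟨I ∪ {a, b}, h⟩ = M.xMon ⟨I ∪ {b, a}, h'⟩ := by
    intro a b h h'
    congr 2
    rw [Finset.pair_comm]
  rw [crossMon, div_eq_one]
  dsimp only at h ⊢
  rcases h with rfl | rfl
  · rw [comm x y h₁ h₂, comm x w h₃ h₄]
  · rw [comm x y h₁ h₄, comm z y h₃ h₂, mul_comm]

/-- Cross ratios are fundamental up to sign. -/
lemma exists_zero_le_crossMon (t : M.Omega) (h₁₃ : t.i₁ ≠ t.i₃) (h₂₄ : t.i₂ ≠ t.i₄) :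
    ∃ s : ℤˣ, ∃ b ∈ M.degreeZeroPasture.mon,
      0 ≤ M.zeroMk ⟨(s, M.crossMon t), M.degree_crossMon t⟩ + b + 1 := by
  obtain ⟨⟨n1, n2, n3, n4⟩, h12, h23, h34, h41⟩ := t.notMem
  set f := M.gradedMk.comp (MonoidHom.inr ℤˣ M.LaurentMonomial) with hf
  have tt := threeTerm_of_plucker (f := f) (e := M.gradedMk (-1, 1)) (N := {y | 0 ≤ y}) t.card_I
    M.graded_le_plucker
  obtain ⟨a, b, c, H⟩ := signedThreeTerm t.I (M.gradedMk (-1, 1)) {y | 0 ≤ y} n1 n2 n3 n4 h12 h₁₃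
    h41.symm h23 h₂₄ h34
  have H := H _ tt
  simp only [Set.mem_ofPred_eq] at H
  rw [value_of_base _ t.base₁₂, value_of_base _ t.base₃₄, value_of_base _ t.base₂₃,
    Finset.pair_comm t.i₁ t.i₄, value_of_base _ t.base₄₁] at H
  set x₁₂ := M.xMon ⟨_, t.base₁₂⟩
  set x₃₄ := M.xMon ⟨_, t.base₃₄⟩
  set x₂₃ := M.xMon ⟨_, t.base₂₃⟩
  set x₄₁ := M.xMon ⟨_, t.base₄₁⟩
  have ep : ∀ n : ℕ, M.gradedMk (-1, 1) ^ n = M.gradedMk ((-1) ^ n, 1) := fun n => by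
    rw [← map_pow, Prod.pow_mk, one_pow]
  have fx : ∀ x, f x = M.gradedMk (1, x) := fun _ => rfl
  -- Division by the third product together with its sign turns that term into 1 and the first term
  -- into the cross ratio up to sign. The middle term becomes β, which is a signed monomial of
  -- degree 0 or 0.
  have H2 := zero_le_mul_left (M.gradedMk (((-1) ^ c)⁻¹, (x₂₃ * x₄₁)⁻¹)) H
  have key : ∃ β ∈ M.degreeZeroPasture.mon, M.zeroIncl.toRingHom β =
      M.gradedMk (((-1) ^ c)⁻¹, (x₂₃ * x₄₁)⁻¹) * (M.gradedMk (-1, 1) ^ b *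
        (M.value f (t.I ∪ {t.i₁, t.i₃}) * M.value f (t.I ∪ {t.i₂, t.i₄}))) := by
    by_cases h : M.IsBase ((t.I ∪ {t.i₁, t.i₃} : Finset E) : Set E) ∧
      M.IsBase ((t.I ∪ {t.i₂, t.i₄} : Finset E) : Set E)
    · have hd : (((-1) ^ c)⁻¹ * (-1) ^ b, (x₂₃ * x₄₁)⁻¹ * (M.xMon ⟨_, h.1⟩ * M.xMon ⟨_, h.2⟩)) ∈
          M.zeroGroup := by
        rw [mem_zeroGroup]
        simp only [map_mul, map_inv, degree_xMon, x₂₃, x₄₁]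
        exact inv_mul_cancel _
      refine ⟨M.zeroMk ⟨_, hd⟩, M.zeroMk_mem _, ?_⟩
      rw [zeroIncl_zeroMk, value_of_base _ h.1, value_of_base _ h.2, ep, fx, fx, ← map_mul,
        ← map_mul, ← map_mul]
      simp
    · refine ⟨0, M.degreeZeroPasture.zero_mem, ?_⟩
      rw [map_zero]
      rcases not_and_or.1 h with h | h <;> rw [value_of_not_base _ h] <;> simp
  obtain ⟨β, hβ, hβe⟩ := key
  refine ⟨((-1) ^ c)⁻¹ * (-1) ^ a, β, hβ, ?_⟩
  -- The degree-0 part carries the restricted order, so the inequality may be checked in the graded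
  -- blueprint.
  change 0 ≤ M.zeroIncl.toRingHom (M.zeroMk _ + β + 1)
  rw [map_add, map_add, map_one, zeroIncl_zeroMk, hβe]
  convert H2 using 1
  rw [mul_add, mul_add]
  congr 1
  · congr 1
    rw [ep, fx, fx, ← map_mul, ← map_mul, ← map_mul]
    congr 1
    refine Prod.ext ?_ ?_
    · simp
    · change M.crossMon t = (x₂₃ * x₄₁)⁻¹ * (1 * (x₁₂ * x₃₄))
      rw [one_mul, mul_comm, ← div_eq_mul_inv]
      rfl
  · rw [ep, fx, fx, ← map_mul, ← map_mul, ← map_mul]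
    refine (map_one M.gradedMk).symm.trans (congrArg _ ?_)
    refine Prod.ext ?_ ?_
    · simp
    · change 1 = (x₂₃ * x₄₁)⁻¹ * (1 * (x₄₁ * x₂₃))
      rw [one_mul, mul_comm x₄₁, inv_mul_cancel]

/-- The generators are fundamental up to the sign ε, which is fundamental itself. Since the
fundamental elements generate only a monoid, inverses need an argument: rotating the indices inverts
a cross ratio (`crossMon_rotate`), and the induction below carries k and its inverse together. -/
lemma weakMk_crossZero_mem (k : ℤˣ × M.crossGroup) :
    M.weakMk (M.crossZero k) ∈ M.weakUniversalPasture.foundationMon := by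
  have hneg : M.weakMk M.zeroNeg ∈ M.weakUniversalPasture.foundationMon := by
    refine Submonoid.subset_closure (Or.inr ⟨M.weakMk_mem _, 0, M.weakUniversalPasture.zero_mem, _,
      M.weakMk_isWeakInverse, Or.inl ?_⟩)
    rw [add_zero]
    exact M.weakMk_isWeakInverse.symm.2.2
  have hsign : ∀ s : ℤˣ, M.weakMk (M.crossZero (s, 1)) ∈ M.weakUniversalPasture.foundationMon := by
    intro s
    rcases Int.units_eq_one_or s with rfl | rfl
    · have : M.weakMk (M.crossZero (1, 1)) = 1 := map_one _
      rw [this]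
      exact one_mem _
    · exact hneg
  have hcross : ∀ t, M.weakMk (M.crossZero (1, ⟨M.crossMon t, M.crossMon_mem t⟩)) ∈
      M.weakUniversalPasture.foundationMon := by
    intro t
    by_cases h : t.i₁ = t.i₃ ∨ t.i₂ = t.i₄
    · have : M.crossZero (1, ⟨M.crossMon t, M.crossMon_mem t⟩) = 1 :=
        Subtype.ext (Prod.ext rfl (M.crossMon_eq_one t h))
      rw [this, map_one]
      exact one_mem _
    · push Not at h
      obtain ⟨s, b, hb, hle⟩ := M.exists_zero_le_crossMon t h.1 h.2
      have h1 : M.crossZero (1, ⟨M.crossMon t, M.crossMon_mem t⟩) = M.crossZero (s, 1) *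
          ⟨(s, M.crossMon t), M.degree_crossMon t⟩ :=
        Subtype.ext (Prod.ext (Int.units_mul_self s).symm (one_mul _).symm)
      rw [h1, map_mul]
      refine mul_mem (hsign s) (Submonoid.subset_closure (Or.inr ⟨M.weakMk_mem _,
        M.toWeak.toRingHom b, M.toWeak.map_mon b hb, _, M.weakMk_isWeakInverse, Or.inl ?_⟩))
      have := M.toWeak.le_map_of_zero_le hle
      rwa [map_add, map_add, map_one] at this
  obtain ⟨s, k, hk⟩ := k
  have h1 : M.crossZero (s, ⟨k, hk⟩) = M.crossZero (s, 1) * M.crossZero (1, ⟨k, hk⟩) := by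
    rw [← map_mul, Prod.mk_mul_mk, mul_one, one_mul]
  rw [h1, map_mul]
  refine mul_mem (hsign s) ?_
  have key : ∀ k (hk : k ∈ M.crossGroup), M.weakMk (M.crossZero (1, ⟨k, hk⟩)) ∈
      M.weakUniversalPasture.foundationMon ∧ M.weakMk (M.crossZero (1, ⟨k, hk⟩⁻¹)) ∈
      M.weakUniversalPasture.foundationMon := by
    intro k hk
    induction hk using Subgroup.closure_induction with
    | mem x hx =>
      obtain ⟨t, rfl⟩ := hx
      refine ⟨hcross t, ?_⟩
      obtain ⟨t', ht'⟩ := M.crossMon_rotate t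
      have e : (⟨M.crossMon t, M.crossMon_mem t⟩ : M.crossGroup)⁻¹ =
        ⟨M.crossMon t', M.crossMon_mem t'⟩ := Subtype.ext ht'.symm
      rw [e]
      exact hcross t'
    | one =>
      have e1 : M.weakMk (M.crossZero (1, 1)) = 1 := map_one _
      have e2 : M.weakMk (M.crossZero (1, (1 : M.crossGroup)⁻¹)) = 1 := by rw [inv_one]; exact e1
      exact ⟨e1 ▸ one_mem _, e2 ▸ one_mem _⟩
    | mul x y hx hy h h' =>
      refine ⟨?_, ?_⟩
      · have := mul_mem h.1 h'.1
        rw [← map_mul, ← map_mul] at this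
        exact this
      · have := mul_mem h.2 h'.2
        rw [← map_mul, ← map_mul, Prod.mk_mul_mk, ← mul_inv] at this
        exact this
    | inv x hx h =>
      have e : (⟨x⁻¹, inv_mem hx⟩ : M.crossGroup)⁻¹ = ⟨x, hx⟩ := Subtype.ext (inv_inv x)
      refine ⟨h.2, ?_⟩
      rw [e]
      exact h.1
  exact (key k hk).1

/-- Converse of `weakMk_crossZero_mem`: the monoid of the foundation is exactly 0 together with the
classes of ±K. -/
lemma mem_foundationMon {x : M.weakUniversalPasture.carrier}
    (hx : x ∈ M.weakUniversalPasture.foundationMon) :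
    x = 0 ∨ ∃ k, x = M.weakMk (M.crossZero k) := by
  induction hx using Submonoid.closure_induction with
  | mem x hx =>
    rcases hx with rfl | hx
    · exact Or.inl rfl
    · rcases M.mem_weak_mon hx.1 with rfl | ⟨h, rfl⟩
      · exact Or.inl rfl
      · obtain ⟨k, rfl⟩ := M.mem_crossZero_of_isFundamental hx
        exact Or.inr ⟨k, rfl⟩
  | one => exact Or.inr ⟨1, by rw [map_one, map_one]⟩
  | mul x y _ _ hx hy =>
    rcases hx with rfl | ⟨k, rfl⟩
    · exact Or.inl (zero_mul _)
    · rcases hy with rfl | ⟨l, rfl⟩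
      · exact Or.inl (mul_zero _)
      · exact Or.inr ⟨k * l, by rw [map_mul, map_mul]⟩

/-- The class of a signed element of the group generated by the cross ratios in the foundation. -/
def foundMk : ℤˣ × M.crossGroup →* M.foundation.carrier where
  toFun k := ⟨M.weakMk (M.crossZero k), Subsemiring.subset_closure (M.weakMk_crossZero_mem k)⟩
  map_one' := Subtype.ext ((congrArg M.weakMk (map_one M.crossZero)).trans (map_one M.weakMk))
  map_mul' k l := Subtype.ext ((congrArg M.weakMk (map_mul M.crossZero k l)).trans
    (map_mul M.weakMk _ _))

variable {M} in
lemma foundation_hom_ext {B : OrderedBlueprint.{v}} {f g : Hom M.foundation B}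
    (h : ∀ k, f.toRingHom (M.foundMk k) = g.toRingHom (M.foundMk k)) : f = g := by
  refine Hom.ext_mon fun a ha => ?_
  rcases M.mem_foundationMon ha with h0 | ⟨k, hk⟩
  · have : a = 0 := Subtype.ext h0
    rw [this, map_zero, map_zero]
  · have : a = M.foundMk k := Subtype.ext hk
    rw [this, h]

variable [Finite E]

/-- The retraction as `PluckerData` with values in the degree-`0` part. -/
def retractionData : M.PluckerData M.degreeZeroPasture where
  toMonoidHom := (M.zeroMk.comp M.crossZero).comp
    ((MonoidHom.inr ℤˣ M.crossGroup).comp (M.retraction.codRestrict M.crossGroup M.retraction_mem))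
  eps := M.zeroMk M.zeroNeg
  map_mem x := M.zeroMk_mem _
  eps_mem := M.zeroMk_mem _
  eps_mul_eps := by rw [← map_mul, zeroNeg_mul_self, map_one]
  le_one_add_eps := M.graded_le_one_add_eps
  le_plucker p := by
    obtain ⟨v, hv⟩ := M.plucker_comp_retraction
      (M.gradedMk.comp (MonoidHom.inr ℤˣ M.LaurentMonomial)) (M.gradedMk (-1, 1)) p
    have h := zero_le_mul_left (M.gradedMk.comp (MonoidHom.inr ℤˣ M.LaurentMonomial) v)
      (M.graded_le_plucker p)
    rw [← hv] at h
    have h' : 0 ≤ M.zeroIncl.toRingHom (M.plucker ((M.zeroMk.comp M.crossZero).comp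
        ((MonoidHom.inr ℤˣ M.crossGroup).comp
          (M.retraction.codRestrict M.crossGroup M.retraction_mem))) (M.zeroMk M.zeroNeg) p) := by
      rw [map_plucker]
      exact h
    exact h'

lemma retractionData_signed (h : M.SignedMonomial) :
    M.retractionData.signed h =
      M.zeroMk (M.crossZero (h.1, ⟨M.retraction h.2, M.retraction_mem h.2⟩)) := by
  rw [PluckerData.signed_apply]
  have e : signHom M.retractionData.eps M.retractionData.eps_mul_eps h.1 =
      M.zeroMk (M.crossZero (h.1, 1)) := by
    rcases Int.units_eq_one_or h.1 with h | h <;> rw [h]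
    · exact (map_one _).trans (map_one (M.zeroMk.comp M.crossZero)).symm
    · exact signHom_neg_one _ _
  rw [e]
  change _ * M.zeroMk (M.crossZero (1, ⟨M.retraction h.2, M.retraction_mem h.2⟩)) = _
  rw [← map_mul, ← map_mul, Prod.mk_mul_mk, mul_one, one_mul]

/-- The retraction of `k_M^w` onto the foundation. -/
def foundRetraction : Hom M.weakUniversalPasture M.foundation :=
  (pasteurizationMap (M.retractionData.gradedLift.comp M.zeroIncl)).corestrict
    M.weakUniversalPasture.foundationMon M.weakUniversalPasture.zero_mem_foundationMon (by
      intro a ha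
      rcases M.mem_weak_mon ha with rfl | ⟨h, rfl⟩
      · have : (pasteurizationMap (M.retractionData.gradedLift.comp M.zeroIncl)).toRingHom 0 = 0 :=
          map_zero _
        exact this ▸ M.weakUniversalPasture.zero_mem_foundationMon
      · have e := congrArg (fun k => k.toRingHom (M.zeroMk h))
          (pasteurizationMap_comp (M.retractionData.gradedLift.comp M.zeroIncl))
        have e' : (M.retractionData.gradedLift.comp M.zeroIncl).toRingHom (M.zeroMk h) =
          M.zeroMk (M.crossZero (h.1.1, ⟨M.retraction h.1.2, M.retraction_mem h.1.2⟩)) :=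
          (M.retractionData.gradedLift_mk h).trans (M.retractionData_signed h)
        have e'' := e.trans (congrArg M.toWeak.toRingHom e')
        exact e'' ▸ M.weakMk_crossZero_mem _)

lemma foundRetraction_weakMk (h : M.zeroGroup) :
    M.foundRetraction.toRingHom (M.weakMk h) =
      M.foundMk (h.1.1, ⟨M.retraction h.1.2, M.retraction_mem h.1.2⟩) := by
  refine Subtype.ext ?_
  have e := congrArg (fun k => k.toRingHom (M.zeroMk h))
    (pasteurizationMap_comp (M.retractionData.gradedLift.comp M.zeroIncl))
  have e' : (M.retractionData.gradedLift.comp M.zeroIncl).toRingHom (M.zeroMk h) =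
    M.zeroMk (M.crossZero (h.1.1, ⟨M.retraction h.1.2, M.retraction_mem h.1.2⟩)) :=
    (M.retractionData.gradedLift_mk h).trans (M.retractionData_signed h)
  exact e.trans (congrArg M.toWeak.toRingHom e')

/-- The retraction of L fixes K pointwise. The foundation is thus a retract of k_M^w, and every
morphism from it extends by composition with `foundRetraction`. -/
lemma foundRetraction_comp_incl : M.foundRetraction.comp M.foundationIncl = Hom.id _ := by
  refine foundation_hom_ext fun k => ?_
  refine (M.foundRetraction_weakMk (M.crossZero k)).trans ?_
  change _ = M.foundMk k
  congr 1
  exact Prod.ext rfl (Subtype.ext (M.retraction_eq_self k.2.2))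

end Matroid
end

noncomputable section

/-! ### Blueprints of partial fields -/

namespace OrderedBlueprint

/-- A semiring as an ordered blueprint with trivial order. -/
def discrete (R : Type u) [CommSemiring R] : OrderedBlueprint.{u} where
  carrier := R
  order :=
    { le := Eq
      lt := fun _ _ => False
      lt_iff_le_not_ge := fun _ _ => ⟨False.elim, fun h => h.2 h.1.symm⟩
      le_refl := fun _ => rfl
      le_trans := fun _ _ _ => Eq.trans
      le_antisymm := fun _ _ h _ => h }
  add_mono _ _ _ _ h k := congrArg₂ (· + ·) h k
  mul_mono _ _ _ _ h k := congrArg₂ (· * ·) h k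
  mon := ⊤
  zero_mem := trivial
  closure_mon := top_le_iff.1 Subsemiring.subset_closure

/-- The ring structure of an ordered blueprint that contains `-1`. -/
@[reducible]
def HasNeg.commRing {B : OrderedBlueprint.{u}} (h : B.HasNeg) : CommRing B.carrier :=
  letI : Neg B.carrier := ⟨fun x => h.choose * x⟩
  { B.semiring with
    neg := fun x => h.choose * x
    zsmul := zsmulRec
    neg_add_cancel := fun x => by
      change h.choose * x + x = 0
      have : (1 + h.choose) * x = 0 := by rw [h.choose_spec.2, zero_mul]
      rwa [add_mul, one_mul, add_comm] at this }

lemma ofGroup_eq_of_rel {G : Type u} [CommGroup G] {r : MonoidAlgebra ℕ G → MonoidAlgebra ℕ G → Prop}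
    {x y : MonoidAlgebra ℕ G} (h : r x y) (h' : r y x) : ofGroupProj G r x = ofGroupProj G r y :=
  le_antisymm (ofGroupProj_le G r x y h) (ofGroupProj_le G r y x h')

lemma ofGroupProj_surjective (G : Type u) [CommGroup G]
    (r : MonoidAlgebra ℕ G → MonoidAlgebra ℕ G → Prop) : Function.Surjective (ofGroupProj G r) :=
  (genCon r).mk'_surjective

end OrderedBlueprint

namespace PartialFieldDatum

open OrderedBlueprint

variable (P : PartialFieldDatum.{u})

/-- The evaluation of `P^blpr` in the ambient ring. -/
def blprEval : OrderedBlueprint.Hom P.blpr (discrete P.R) :=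
  ofGroupLift (B := discrete P.R) P.natπ (fun _ _ => trivial) fun _ _ h => h

/-- The evaluation of `P^blpr` in the ambient ring, as a ring homomorphism. -/
def blprEvalHom : P.blpr.carrier →+* P.R := P.blprEval.toRingHom

lemma blprEvalHom_toBlpr (a : P.G) :
    P.blprEvalHom (P.toBlpr a : P.blpr.carrier) = P.π (MonoidAlgebra.of ℤ P.G a) :=
  P.natπ_of a

/-- The relations defining P^blpr are exactly the equalities in R_P, so identities in P^blpr may be
verified in the ambient ring. -/
lemma blprEvalHom_injective : Function.Injective P.blprEvalHom := by
  intro x y h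
  obtain ⟨x, rfl⟩ := ofGroupProj_surjective _ _ x
  obtain ⟨y, rfl⟩ := ofGroupProj_surjective _ _ y
  have h' : P.natπ x = P.natπ y := h
  exact ofGroup_eq_of_rel h' h'.symm

lemma toBlpr_mem (a : P.G) : (P.toBlpr a : P.blpr.carrier) ∈ P.blpr.mon := (P.toBlpr a).2

/-- A homomorphism from the ambient ring induces a morphism from `P^blpr`. -/
def blprLift {B : OrderedBlueprint.{v}} (ψ : P.R →+* B.carrier)
    (hψ : ∀ a, ψ (P.π (MonoidAlgebra.of ℤ P.G a)) ∈ B.mon) : OrderedBlueprint.Hom P.blpr B :=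
  ofGroupLift (ψ.comp P.natπ) (by
    rintro _ (rfl | ⟨a, rfl⟩)
    · rw [map_zero]; exact B.zero_mem
    · rw [RingHom.comp_apply, natπ_of]; exact hψ a) fun x y h => (congrArg ψ h).le

lemma blprLift_toBlpr {B : OrderedBlueprint.{v}} (ψ : P.R →+* B.carrier)
    (hψ : ∀ a, ψ (P.π (MonoidAlgebra.of ℤ P.G a)) ∈ B.mon) (a : P.G) :
    (P.blprLift ψ hψ).toRingHom (P.toBlpr a : P.blpr.carrier) =
      ψ (P.π (MonoidAlgebra.of ℤ P.G a)) :=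
  congrArg ψ (P.natπ_of a)

variable {P} in
lemma blpr_hom_ext {B : OrderedBlueprint.{v}} {f g : OrderedBlueprint.Hom P.blpr B}
    (h : ∀ a, f.toRingHom (P.toBlpr a : P.blpr.carrier) =
      g.toRingHom (P.toBlpr a : P.blpr.carrier)) : f = g :=
  ofGroup_hom_ext h

lemma Hom.blpr_toBlpr {P : PartialFieldDatum.{u}} {Q : PartialFieldDatum.{v}} (f : P.Hom Q)
    (a : P.G) : f.blpr.toRingHom (P.toBlpr a : P.blpr.carrier) = Q.toBlpr (f.toMonoidHom a) :=
  congrArg (ofGroupProj Q.G _) (f.natMap_of a)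

lemma blpr_hasNeg {m : P.G} (h : P.π (MonoidAlgebra.of ℤ P.G m) = -1) : P.blpr.HasNeg := by
  refine ⟨P.toBlpr m, P.toBlpr_mem m, P.blprEvalHom_injective ?_⟩
  rw [map_add, map_one, map_zero, blprEvalHom_toBlpr, h, add_neg_cancel]

end PartialFieldDatum

/-! ### The bracket ring -/

namespace Matroid

open OrderedBlueprint PartialFieldDatum

variable {E : Type u} [LinearOrder E] (M : Matroid E)

/-- The class of a monomial in the bracket ring. -/
def bracketMk : M.LaurentMonomial →* M.BracketRing :=
  (Units.coeHom M.BracketRing).comp M.monomialUnit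

lemma mk_xInt (J : Finset E) :
    Ideal.Quotient.mk M.pluckerIdeal (M.xInt J) = M.value M.bracketMk J := by
  by_cases h : M.IsBase (J : Set E)
  · rw [value_of_base _ h, xInt, dif_pos h]; rfl
  · rw [value_of_not_base _ h, xInt, dif_neg h, map_zero]

lemma plucker_bracketMk (p : M.PluckerIndex) : M.plucker M.bracketMk (-1) p = 0 := by
  have h : Ideal.Quotient.mk M.pluckerIdeal (M.xInt (p.sub 0 1) * M.xInt (p.sub 2 3)
      - M.xInt (p.sub 0 2) * M.xInt (p.sub 1 3)
      + M.xInt (p.sub 0 3) * M.xInt (p.sub 1 2)) = 0 :=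
    Ideal.Quotient.eq_zero_iff_mem.2 (Ideal.subset_span ⟨p, rfl⟩)
  rw [← h, map_add, map_sub, map_mul, map_mul, map_mul]
  simp only [mk_xInt, plucker]
  ring

lemma lift_xInt {R : Type v} [CommRing R] (f : M.LaurentMonomial →* R) (J : Finset E) :
    (MonoidAlgebra.lift ℤ R M.LaurentMonomial f) (M.xInt J) = M.value f J := by
  by_cases h : M.IsBase (J : Set E)
  · rw [value_of_base _ h, xInt, dif_pos h, MonoidAlgebra.lift_of]
  · rw [value_of_not_base _ h, xInt, dif_neg h, map_zero]

/-- The universal property of the bracket ring. -/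
def bracketLift {R : Type v} [CommRing R] (f : M.LaurentMonomial →* R)
    (h : ∀ p, M.plucker f (-1) p = 0) : M.BracketRing →+* R :=
  Ideal.Quotient.lift M.pluckerIdeal (MonoidAlgebra.lift ℤ R M.LaurentMonomial f).toRingHom (by
    intro y hy
    have : M.pluckerIdeal ≤ RingHom.ker (MonoidAlgebra.lift ℤ R M.LaurentMonomial f).toRingHom := by
      refine Ideal.span_le.2 ?_
      rintro _ ⟨p, rfl⟩
      change (MonoidAlgebra.lift ℤ R M.LaurentMonomial f) _ = 0
      rw [← h p, map_add, map_sub, map_mul, map_mul, map_mul]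
      simp only [lift_xInt, plucker]
      ring
    exact this hy)

lemma bracketLift_mk {R : Type v} [CommRing R] (f : M.LaurentMonomial →* R)
    (h : ∀ p, M.plucker f (-1) p = 0) (x : M.LaurentMonomial) :
    M.bracketLift f h (M.bracketMk x) = f x :=
  MonoidAlgebra.lift_of _ _

variable {M}

lemma PluckerData.one_add_eps {B : OrderedBlueprint.{v}} (d : M.PluckerData B) (hB : B.HasNeg) :
    1 + d.eps = 0 :=
  (hB.eq_of_le d.le_one_add_eps).symm

/-- With -1 present the order is equality, so ε = -1 and each 0 ≤ becomes an equation, as in the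
definition of the bracket ring. The ring structure on B is auxiliary; the statement refers only to
its semiring. -/
lemma PluckerData.exists_bracketLift {B : OrderedBlueprint.{v}} (d : M.PluckerData B)
    (hB : B.HasNeg) :
    ∃ ψ : M.BracketRing →+* B.carrier, ∀ x, ψ (M.bracketMk x) = d.toMonoidHom x := by
  let _ := hB.commRing
  have he : d.eps = -1 := eq_neg_of_add_eq_zero_right (d.one_add_eps hB)
  have h : ∀ p, M.plucker d.toMonoidHom (-1) p = 0 := fun p => by
    rw [← he]
    exact (hB.eq_of_le (d.le_plucker p)).symm
  exact ⟨M.bracketLift d.toMonoidHom h, M.bracketLift_mk d.toMonoidHom h⟩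

/-- The ring homomorphism from the bracket ring given by `PluckerData`. -/
def PluckerData.bracketLift {B : OrderedBlueprint.{v}} (d : M.PluckerData B)
    (hB : B.HasNeg) : M.BracketRing →+* B.carrier :=
  (d.exists_bracketLift hB).choose

lemma PluckerData.bracketLift_mk {B : OrderedBlueprint.{v}} (d : M.PluckerData B)
    (hB : B.HasNeg) (x : M.LaurentMonomial) : d.bracketLift hB (M.bracketMk x) = d.toMonoidHom x :=
  (d.exists_bracketLift hB).choose_spec x

lemma neg_one_mul_unit (a : M.BracketRingˣ) : (-1 : M.BracketRingˣ) * a = -a :=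
  Units.ext (neg_one_mul (a : M.BracketRing))

variable (M) in
/-- The unit of the bracket ring given by a signed monomial. -/
def signedUnit : M.SignedMonomial →* M.BracketRingˣ :=
  (signHom (-1 : M.BracketRingˣ) (Units.ext ((neg_mul_neg (1 : M.BracketRing) 1).trans (one_mul 1)))).coprod M.monomialUnit

lemma signedUnit_one (x : M.LaurentMonomial) : M.signedUnit (1, x) = M.monomialUnit x := by
  simp [signedUnit]

lemma signedUnit_neg_one (x : M.LaurentMonomial) : M.signedUnit (-1, x) = -M.monomialUnit x := by
  simp [signedUnit, signHom_neg_one, neg_one_mul_unit]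

lemma PluckerData.bracketLift_signedUnit {B : OrderedBlueprint.{v}} (d : M.PluckerData B)
    (hB : B.HasNeg) (h : M.SignedMonomial) :
    d.bracketLift hB (M.signedUnit h : M.BracketRing) = d.signed h := by
  obtain ⟨s, x⟩ := h
  rcases Int.units_eq_one_or s with rfl | rfl
  · rw [signedUnit_one, d.signed_one, ← d.bracketLift_mk hB]
    rfl
  · have e : d.signed (-1, x) = d.eps * d.toMonoidHom x := by
      rw [d.signed_apply, signHom_neg_one]
    rw [signedUnit_neg_one, e, ← d.bracketLift_mk hB]
    change d.bracketLift hB (-M.bracketMk x) = _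
    -- In the semiring B the images of -x and of ε x are both additive inverses of the image of x,
    -- hence equal.
    have h1 : d.bracketLift hB (-M.bracketMk x) + d.bracketLift hB (M.bracketMk x) = 0 := by
      rw [← map_add, neg_add_cancel, map_zero]
    have h2 : d.bracketLift hB (M.bracketMk x) + d.eps * d.bracketLift hB (M.bracketMk x) = 0 := by
      rw [← one_add_mul, d.one_add_eps hB, zero_mul]
    calc _ = d.bracketLift hB (-M.bracketMk x) + (d.bracketLift hB (M.bracketMk x) +
          d.eps * d.bracketLift hB (M.bracketMk x)) := by rw [h2, add_zero]
      _ = _ := by rw [← add_assoc, h1, zero_add]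

/-- The image of `PluckerData` under a morphism. -/
def PluckerData.map {B : OrderedBlueprint.{v}} {C : OrderedBlueprint.{w}} (d : M.PluckerData B)
    (g : OrderedBlueprint.Hom B C) : M.PluckerData C where
  toMonoidHom := (g.toRingHom : _ →* _).comp d.toMonoidHom
  eps := g.toRingHom d.eps
  map_mem x := g.map_mon _ (d.map_mem x)
  eps_mem := g.map_mon _ d.eps_mem
  eps_mul_eps := by rw [← map_mul, d.eps_mul_eps, map_one]
  le_one_add_eps := by
    have := g.le_map_of_zero_le d.le_one_add_eps
    rwa [map_add, map_one] at this
  le_plucker p := by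
    have := g.le_map_of_zero_le (d.le_plucker p)
    rwa [map_plucker] at this

lemma PluckerData.map_signed {B : OrderedBlueprint.{v}} {C : OrderedBlueprint.{w}}
    (d : M.PluckerData B) (g : OrderedBlueprint.Hom B C) (h : M.SignedMonomial) :
    (d.map g).signed h = g.toRingHom (d.signed h) := by
  rw [PluckerData.signed_apply, PluckerData.signed_apply, map_mul]
  refine congrArg (· * _) ?_
  rcases Int.units_eq_one_or h.1 with h | h <;> rw [h]
  · rw [map_one, map_one, map_one]
  · rw [signHom_neg_one, signHom_neg_one]; rfl

variable (M)

/-- The signed units of the bracket ring with monomials in `H`. -/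
def signedUnits (H : Subgroup M.LaurentMonomial) : Subgroup M.BracketRingˣ :=
  Subgroup.closure {-1} ⊔ H.map M.monomialUnit

lemma crossRatioUnits_eq : M.crossRatioUnits = M.signedUnits M.crossGroup := by
  rw [crossRatioUnits, signedUnits, crossGroup, MonoidHom.map_closure, ← Set.range_comp,
    ← Subgroup.closure_union]
  congr 3
  exact funext fun t => (M.monomialUnit_crossMon t).symm

variable {M} in
lemma signedUnit_mem {H : Subgroup M.LaurentMonomial} (s : ℤˣ) {x : M.LaurentMonomial}
    (hx : x ∈ H) : M.signedUnit (s, x) ∈ M.signedUnits H := by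
  have h : M.signedUnit (1, x) ∈ M.signedUnits H := by
    rw [signedUnit_one]
    exact Subgroup.mem_sup_right ⟨x, hx, rfl⟩
  rcases Int.units_eq_one_or s with rfl | rfl
  · exact h
  · have h' : (-1 : M.BracketRingˣ) ∈ M.signedUnits H :=
      Subgroup.mem_sup_left (Subgroup.subset_closure (Set.mem_singleton _))
    have := mul_mem h' h
    rwa [signedUnit_one, neg_one_mul_unit, ← signedUnit_neg_one] at this

variable {M} in
lemma exists_of_mem_signedUnits {H : Subgroup M.LaurentMonomial} {a : M.BracketRingˣ}
    (ha : a ∈ M.signedUnits H) : ∃ s : ℤˣ, ∃ x ∈ H, a = M.signedUnit (s, x) := by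
  have : M.signedUnits H ≤ (Subgroup.prod ⊤ H).map M.signedUnit := by
    refine sup_le ((Subgroup.closure_le _).2 ?_) ?_
    · rintro _ rfl
      exact ⟨(-1, 1), ⟨trivial, H.one_mem⟩, by rw [signedUnit_neg_one, map_one]⟩
    · rintro _ ⟨x, hx, rfl⟩
      exact ⟨(1, x), ⟨trivial, hx⟩, signedUnit_one x⟩
  obtain ⟨⟨s, x⟩, hx, rfl⟩ := this ha
  exact ⟨s, x, hx.2, rfl⟩

/-! ### Blueprints of subgroups of the unit group of the bracket ring -/

section Units

variable (G : Subgroup M.BracketRingˣ)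

/-- The inclusion of the ambient ring of `ofUnits B_M G` in the bracket ring. -/
def unitsSubtype : (ofUnits M.BracketRing G).R →+* M.BracketRing :=
  (unitsLift M.BracketRing G).range.subtype

lemma unitsSubtype_injective : Function.Injective (M.unitsSubtype G) := Subtype.val_injective

lemma unitsSubtype_π (a : G) : M.unitsSubtype G ((ofUnits M.BracketRing G).π
    (MonoidAlgebra.of ℤ (ofUnits M.BracketRing G).G a)) = (a : M.BracketRingˣ) :=
  unitsLift_of _ G a

/-- The evaluation of `(ofUnits B_M G)^blpr` in the bracket ring. -/
def unitsEval : (ofUnits M.BracketRing G).blpr.carrier →+* M.BracketRing :=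
  (M.unitsSubtype G).comp (ofUnits M.BracketRing G).blprEvalHom

/-- This embeds the blueprint in B_M; the axioms of `unitsData` are verified there, where the
Plücker relations hold by definition. -/
lemma unitsEval_injective : Function.Injective (M.unitsEval G) :=
  (M.unitsSubtype_injective G).comp (blprEvalHom_injective _)

variable {M} in
/-- The morphism from `(ofUnits B_M G)^blpr` given by `PluckerData`. -/
def PluckerData.unitsHom {B : OrderedBlueprint.{v}} (d : M.PluckerData B) (hB : B.HasNeg)
    (hd : ∀ a : G, d.bracketLift hB (a : M.BracketRingˣ) ∈ B.mon) :
    OrderedBlueprint.Hom (ofUnits M.BracketRing G).blpr B :=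
  blprLift _ ((d.bracketLift hB).comp (M.unitsSubtype G)) fun a => by
    rw [RingHom.comp_apply]
    exact (M.unitsSubtype_π G a).symm ▸ hd a

variable {M} in
lemma PluckerData.unitsHom_toBlpr {B : OrderedBlueprint.{v}} (d : M.PluckerData B) (hB : B.HasNeg)
    (hd : ∀ a : G, d.bracketLift hB (a : M.BracketRingˣ) ∈ B.mon) (a : G) :
    (d.unitsHom G hB hd).toRingHom
      ((ofUnits M.BracketRing G).toBlpr a : (ofUnits M.BracketRing G).blpr.carrier) =
      d.bracketLift hB (a : M.BracketRingˣ) :=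
  (blprLift_toBlpr _ _ _ _).trans (congrArg (d.bracketLift hB) (M.unitsSubtype_π G a))

lemma unitsEval_toBlpr (a : G) :
    M.unitsEval G ((ofUnits M.BracketRing G).toBlpr a : (ofUnits M.BracketRing G).blpr.carrier) =
      (a : M.BracketRingˣ) :=
  (congrArg (M.unitsSubtype G) (blprEvalHom_toBlpr (ofUnits M.BracketRing G) a)).trans
    (M.unitsSubtype_π G a)

variable {G}

lemma units_hasNeg (hG : -1 ∈ G) : (ofUnits M.BracketRing G).blpr.HasNeg :=
  blpr_hasNeg _ (m := ⟨-1, hG⟩) (Subtype.ext (unitsLift_of _ G ⟨-1, hG⟩))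

/-- A rescaling of the canonical morphism with values in `G` yields `PluckerData` with values in
`(ofUnits B_M G)^blpr`. -/
def unitsData (hG : -1 ∈ G) (σ : M.LaurentMonomial →* M.LaurentMonomial)
    (hσ : ∀ x, M.monomialUnit (σ x) ∈ G)
    (hpl : ∀ p, ∃ v, M.plucker (M.bracketMk.comp σ) (-1) p = v * M.plucker M.bracketMk (-1) p) :
    M.PluckerData (ofUnits M.BracketRing G).blpr where
  toMonoidHom := ((ofUnits M.BracketRing G).blpr.mon.subtype.comp
    (ofUnits M.BracketRing G).toBlpr).comp ((M.monomialUnit.comp σ).codRestrict G hσ)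
  eps := ((ofUnits M.BracketRing G).toBlpr ⟨-1, hG⟩ : (ofUnits M.BracketRing G).blpr.mon)
  map_mem x := toBlpr_mem _ _
  eps_mem := toBlpr_mem _ _
  eps_mul_eps := M.unitsEval_injective G (by
    rw [map_mul, map_one, unitsEval_toBlpr]
    simp)
  le_one_add_eps := (M.unitsEval_injective G (by
    rw [map_add, map_one, unitsEval_toBlpr, map_zero]
    simp)).le
  le_plucker p := (M.unitsEval_injective G (by
    obtain ⟨v, hv⟩ := hpl p
    rw [map_plucker, map_zero, unitsEval_toBlpr]
    rw [plucker_bracketMk, mul_zero] at hv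
    rw [← hv]
    congr 1
    exact MonoidHom.ext fun x => (M.unitsEval_toBlpr G ⟨M.monomialUnit (σ x), hσ x⟩).symm)).le

lemma unitsEval_unitsData_signed (hG : -1 ∈ G) (σ : M.LaurentMonomial →* M.LaurentMonomial)
    (hσ : ∀ x, M.monomialUnit (σ x) ∈ G)
    (hpl : ∀ p, ∃ v, M.plucker (M.bracketMk.comp σ) (-1) p = v * M.plucker M.bracketMk (-1) p)
    (h : M.SignedMonomial) :
    M.unitsEval G ((M.unitsData hG σ hσ hpl).signed h) = M.signedUnit (h.1, σ h.2) := by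
  rw [PluckerData.signed_apply, map_mul]
  have e : M.unitsEval G ((M.unitsData hG σ hσ hpl).toMonoidHom h.2) = M.monomialUnit (σ h.2) :=
    M.unitsEval_toBlpr G _
  rw [e]
  rcases Int.units_eq_one_or h.1 with h | h <;> rw [h]
  · rw [map_one, map_one, one_mul, signedUnit_one]
  · rw [signHom_neg_one, signedUnit_neg_one]
    refine (congrArg (· * _) (M.unitsEval_toBlpr G _)).trans ?_
    simp

end Units

end Matroid
end

noncomputable section

/-! ### Comparison of the universal pasture with the bracket ring -/

namespace Matroid

open OrderedBlueprint PartialFieldDatum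

variable {E : Type u} [LinearOrder E] (M : Matroid E) [Finite E]

/-- A retraction of the group of Laurent monomials onto the group of monomials of degree `0`. -/
def shift : M.LaurentMonomial →* M.LaurentMonomial :=
  MonoidHom.id _ * M.rescaling (M.xMon (Classical.arbitrary M.Basis))⁻¹ fun _ => 1

lemma rescaling_one {A : Type v} [CommGroup A] (a : A) :
    M.rescaling a (fun _ => 1) = (zpowersHom A a).comp M.degree :=
  mon_hom_ext fun J => by
    rw [rescaling_xMon, MonoidHom.comp_apply, degree_xMon, zpowersHom_apply]
    simp

lemma degree_shift (x : M.LaurentMonomial) : M.degree (M.shift x) = 1 := by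
  have : M.degree.comp M.shift = 1 := mon_hom_ext fun J => by
    change M.degree (M.xMon J * M.rescaling _ _ (M.xMon J)) = 1
    rw [rescaling_xMon, Finset.prod_const_one, mul_one, map_mul, map_inv, degree_xMon, degree_xMon,
      mul_inv_cancel]
  exact congrArg (fun k => k x) this

lemma shift_eq_self {x : M.LaurentMonomial} (hx : M.degree x = 1) : M.shift x = x := by
  change x * M.rescaling _ _ x = x
  rw [rescaling_one, MonoidHom.comp_apply, hx, map_one, mul_one]

/-- Same mechanism as for the retraction: the shift to degree 0 is a rescaling with constant weights
t = 1, so it preserves the relations up to a factor. -/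
lemma plucker_comp_shift {R : Type v} [CommSemiring R] (f : M.LaurentMonomial →* R) (e : R)
    (p : M.PluckerIndex) :
    ∃ v : M.LaurentMonomial, M.plucker (f.comp M.shift) e p = f v * M.plucker f e p := by
  have h := M.plucker_mul_rescaling f f (M.xMon (Classical.arbitrary M.Basis))⁻¹ (fun _ => 1) e p
  have h' : f * f.comp (M.rescaling (M.xMon (Classical.arbitrary M.Basis))⁻¹ fun _ => 1) =
      f.comp M.shift :=
    MonoidHom.ext fun x => (map_mul f _ _).symm
  rw [h'] at h
  exact ⟨_, h⟩

/-- The monomials of degree `0` without sign. -/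
def shiftZero : M.LaurentMonomial →* M.zeroGroup where
  toFun x := ⟨(1, M.shift x), M.degree_shift x⟩
  map_one' := Subtype.ext (Prod.ext rfl (map_one M.shift))
  map_mul' x y := Subtype.ext (Prod.ext rfl (map_mul M.shift x y))

/-- The canonical `PluckerData` with values in the degree-`0` part. -/
def shiftData : M.PluckerData M.degreeZeroPasture where
  toMonoidHom := M.zeroMk.comp M.shiftZero
  eps := M.zeroMk M.zeroNeg
  map_mem x := M.zeroMk_mem _
  eps_mem := M.zeroMk_mem _
  eps_mul_eps := by rw [← map_mul, zeroNeg_mul_self, map_one]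
  le_one_add_eps := M.graded_le_one_add_eps
  le_plucker p := by
    obtain ⟨v, hv⟩ := M.plucker_comp_shift
      (M.gradedMk.comp (MonoidHom.inr ℤˣ M.LaurentMonomial)) (M.gradedMk (-1, 1)) p
    have h := zero_le_mul_left (M.gradedMk.comp (MonoidHom.inr ℤˣ M.LaurentMonomial) v)
      (M.graded_le_plucker p)
    rw [← hv] at h
    have h' : 0 ≤ M.zeroIncl.toRingHom (M.plucker (M.zeroMk.comp M.shiftZero)
        (M.zeroMk M.zeroNeg) p) := by
      rw [map_plucker]
      exact h
    exact h'

lemma shiftData_signed (h : M.zeroGroup) : M.shiftData.signed h = M.zeroMk h := by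
  rw [PluckerData.signed_apply]
  have e : signHom M.shiftData.eps M.shiftData.eps_mul_eps h.1.1 =
      M.zeroMk ⟨(h.1.1, 1), map_one M.degree⟩ := by
    rcases Int.units_eq_one_or h.1.1 with h | h <;> rw [h]
    · exact (map_one _).trans (map_one M.zeroMk).symm
    · exact signHom_neg_one _ _
  rw [e]
  change _ * M.zeroMk (M.shiftZero h.1.2) = _
  rw [← map_mul]
  congr 1
  refine Subtype.ext (Prod.ext (mul_one _) ?_)
  change 1 * M.shift h.1.2 = _
  rw [one_mul, M.shift_eq_self (x := h.1.2) h.2]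

/-- The canonical `PluckerData` with values in `k_M^w`. -/
def weakData : M.PluckerData M.weakUniversalPasture := M.shiftData.map M.toWeak

lemma weakData_signed (h : M.zeroGroup) : M.weakData.signed h = M.weakMk h := by
  rw [weakData, PluckerData.map_signed, shiftData_signed]
  rfl

/-- The `PluckerData` with values in the foundation. -/
def foundData : M.PluckerData M.foundation := M.weakData.map M.foundRetraction

lemma foundData_signed (k : ℤˣ × M.crossGroup) :
    M.foundData.signed (M.crossZero k) = M.foundMk k := by
  rw [foundData, PluckerData.map_signed, weakData_signed]
  exact congrArg (fun f => f.toRingHom (M.foundMk k)) M.foundRetraction_comp_incl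

lemma neg_one_mem_degreeZeroUnits : -1 ∈ M.degreeZeroUnits :=
  Subgroup.mem_sup_left (Subgroup.subset_closure (Set.mem_singleton _))

lemma neg_one_mem_crossRatioUnits : -1 ∈ M.crossRatioUnits :=
  Subgroup.subset_closure (Or.inl rfl)

lemma signedUnit_mem_degreeZeroUnits (h : M.zeroGroup) : M.signedUnit h ∈ M.degreeZeroUnits :=
  signedUnit_mem h.1.1 h.2

lemma signedUnit_mem_crossRatioUnits (k : ℤˣ × M.crossGroup) :
    M.signedUnit (M.crossZero k) ∈ M.crossRatioUnits := by
  rw [crossRatioUnits_eq]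
  exact signedUnit_mem k.1 k.2.2

lemma exists_of_degreeZeroUnits (a : M.degreeZeroUnits) :
    ∃ h : M.zeroGroup, a = ⟨M.signedUnit h, M.signedUnit_mem_degreeZeroUnits h⟩ := by
  obtain ⟨s, x, hx, h⟩ := exists_of_mem_signedUnits (H := M.degree.ker) a.2
  exact ⟨⟨(s, x), hx⟩, Subtype.ext h⟩

lemma exists_of_crossRatioUnits (a : M.crossRatioUnits) :
    ∃ k, a = ⟨M.signedUnit (M.crossZero k), M.signedUnit_mem_crossRatioUnits k⟩ := by
  have h' : a.1 ∈ M.signedUnits M.crossGroup := by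
    rw [← crossRatioUnits_eq]; exact a.2
  obtain ⟨s, x, hx, h⟩ := exists_of_mem_signedUnits h'
  exact ⟨(s, ⟨x, hx⟩), Subtype.ext h⟩

/-- The `PluckerData` for `P_{M,0}^blpr`. -/
def bracketFieldData : M.PluckerData M.partialBracketField.blpr :=
  M.unitsData M.neg_one_mem_degreeZeroUnits M.shift
    (fun x => by
      rw [← signedUnit_one]
      exact signedUnit_mem 1 (M.degree_shift x))
    (fun p => by
      obtain ⟨v, hv⟩ := M.plucker_comp_shift M.bracketMk (-1) p
      exact ⟨_, hv⟩)

lemma bracketFieldData_signed (h : M.zeroGroup) : M.bracketFieldData.signed h =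
    M.partialBracketField.toBlpr ⟨M.signedUnit h, M.signedUnit_mem_degreeZeroUnits h⟩ := by
  refine M.unitsEval_injective M.degreeZeroUnits ?_
  refine (M.unitsEval_unitsData_signed _ _ _ _ _).trans ?_
  refine Eq.trans ?_ (M.unitsEval_toBlpr _ _).symm
  rw [M.shift_eq_self (x := h.1.2) h.2]

/-- The `PluckerData` for `ℙ_M^blpr`. -/
def universalData : M.PluckerData M.universalPartialField.blpr :=
  M.unitsData M.neg_one_mem_crossRatioUnits M.retraction
    (fun x => by
      rw [← signedUnit_one, crossRatioUnits_eq]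
      exact signedUnit_mem 1 (M.retraction_mem x))
    (fun p => by
      obtain ⟨v, hv⟩ := M.plucker_comp_retraction M.bracketMk (-1) p
      exact ⟨_, hv⟩)

lemma universalData_signed (k : ℤˣ × M.crossGroup) : M.universalData.signed (M.crossZero k) =
    M.universalPartialField.toBlpr
      ⟨M.signedUnit (M.crossZero k), M.signedUnit_mem_crossRatioUnits k⟩ := by
  refine M.unitsEval_injective M.crossRatioUnits ?_
  refine (M.unitsEval_unitsData_signed _ _ _ _ _).trans ?_
  refine Eq.trans ?_ (M.unitsEval_toBlpr _ _).symm
  change (M.signedUnit (k.1, M.retraction k.2.1) : M.BracketRing) = _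
  rw [M.retraction_eq_self k.2.2]
  rfl

lemma partialBracketField_hasNeg : M.partialBracketField.blpr.HasNeg :=
  M.units_hasNeg M.neg_one_mem_degreeZeroUnits

lemma universalPartialField_hasNeg : M.universalPartialField.blpr.HasNeg :=
  M.units_hasNeg M.neg_one_mem_crossRatioUnits

lemma weakSq_hasNeg : M.weakUniversalPastureSq.HasNeg := tensorSq_hasNeg _

lemma foundationSq_hasNeg : M.foundationSq.HasNeg := tensorSq_hasNeg _

/-- The morphism `k_M^w ⊗ 𝔽₁^{±,sq} → P_{M,0}^blpr`. -/
def thetaHom : OrderedBlueprint.Hom M.weakUniversalPastureSq M.partialBracketField.blpr :=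
  tensorSqLift _ M.partialBracketField_hasNeg
    (M.bracketFieldData.lift M.partialBracketField_hasNeg.uniqueWeakInverses)

lemma thetaHom_mk (h : M.zeroGroup) :
    M.thetaHom.toRingHom (M.toWeakUniversalPastureSq.toRingHom (M.weakMk h)) =
      M.partialBracketField.toBlpr ⟨M.signedUnit h, M.signedUnit_mem_degreeZeroUnits h⟩ := by
  refine (congrArg (fun f : OrderedBlueprint.Hom _ _ => f.toRingHom (M.weakMk h))
    (tensorSqLift_comp M.weakUniversalPastureStr M.partialBracketField_hasNeg _)).trans ?_
  exact (M.bracketFieldData.lift_mk _ h).trans (M.bracketFieldData_signed h)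

/-- The morphism `P_{M,0}^blpr → k_M^w ⊗ 𝔽₁^{±,sq}`. -/
def thetaInv : OrderedBlueprint.Hom M.partialBracketField.blpr M.weakUniversalPastureSq :=
  (M.weakData.map M.toWeakUniversalPastureSq).unitsHom M.degreeZeroUnits M.weakSq_hasNeg fun a => by
    obtain ⟨h, rfl⟩ := M.exists_of_degreeZeroUnits a
    rw [PluckerData.bracketLift_signedUnit]
    exact PluckerData.signed_mem _ _

lemma thetaInv_toBlpr (h : M.zeroGroup) :
    M.thetaInv.toRingHom (M.partialBracketField.toBlpr
      ⟨M.signedUnit h, M.signedUnit_mem_degreeZeroUnits h⟩ : M.partialBracketField.blpr.mon) =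
      M.toWeakUniversalPastureSq.toRingHom (M.weakMk h) := by
  refine (PluckerData.unitsHom_toBlpr _ _ _ _ _).trans ?_
  rw [PluckerData.bracketLift_signedUnit, PluckerData.map_signed, weakData_signed]

/-- The isomorphism `k_M^w ⊗ 𝔽₁^{±,sq} ≃ P_{M,0}^blpr`. -/
def theta : OrderedBlueprint.Iso M.weakUniversalPastureSq M.partialBracketField.blpr where
  hom := M.thetaHom
  inv := M.thetaInv
  hom_inv := tensorSq_hom_ext (weak_hom_ext fun h =>
    (congrArg M.thetaInv.toRingHom (M.thetaHom_mk h)).trans (M.thetaInv_toBlpr h))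
  inv_hom := blpr_hom_ext fun a => by
    obtain ⟨h, rfl⟩ := M.exists_of_degreeZeroUnits a
    exact (congrArg M.thetaHom.toRingHom (M.thetaInv_toBlpr h)).trans (M.thetaHom_mk h)

lemma theta_xRatio (I J : M.Basis) :
    M.theta.hom.toRingHom (M.toWeakUniversalPastureSq.toRingHom (M.xRatio I J)) =
      (M.partialBracketField.toBlpr (M.bracketRatio I J) : M.partialBracketField.blpr.carrier) := by
  rw [xRatio_eq]
  refine (M.thetaHom_mk _).trans ?_
  congr 2
  refine Subtype.ext ?_
  change M.signedUnit (1, M.xMon I / M.xMon J) = _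
  rw [signedUnit_one, map_div]
  rfl

/-- The morphism `k_M^f ⊗ 𝔽₁^{±,sq} → ℙ_M^blpr`. -/
def thetaFoundHom : OrderedBlueprint.Hom M.foundationSq M.universalPartialField.blpr :=
  tensorSqLift _ M.universalPartialField_hasNeg
    ((M.universalData.lift M.universalPartialField_hasNeg.uniqueWeakInverses).comp
      M.foundationIncl)

lemma thetaFoundHom_mk (k : ℤˣ × M.crossGroup) :
    M.thetaFoundHom.toRingHom (M.toFoundationSq.toRingHom (M.foundMk k)) =
      M.universalPartialField.toBlpr
        ⟨M.signedUnit (M.crossZero k), M.signedUnit_mem_crossRatioUnits k⟩ := by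
  refine (congrArg (fun f : OrderedBlueprint.Hom _ _ => f.toRingHom (M.foundMk k))
    (tensorSqLift_comp M.foundationStr M.universalPartialField_hasNeg _)).trans ?_
  exact (M.universalData.lift_mk M.universalPartialField_hasNeg.uniqueWeakInverses
    (M.crossZero k)).trans (M.universalData_signed k)

/-- The morphism `ℙ_M^blpr → k_M^f ⊗ 𝔽₁^{±,sq}`. -/
def thetaFoundInv : OrderedBlueprint.Hom M.universalPartialField.blpr M.foundationSq :=
  (M.foundData.map M.toFoundationSq).unitsHom M.crossRatioUnits M.foundationSq_hasNeg fun a => by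
    obtain ⟨k, rfl⟩ := M.exists_of_crossRatioUnits a
    rw [PluckerData.bracketLift_signedUnit]
    exact PluckerData.signed_mem _ _

lemma thetaFoundInv_toBlpr (k : ℤˣ × M.crossGroup) :
    M.thetaFoundInv.toRingHom (M.universalPartialField.toBlpr ⟨M.signedUnit (M.crossZero k),
      M.signedUnit_mem_crossRatioUnits k⟩ : M.universalPartialField.blpr.mon) =
      M.toFoundationSq.toRingHom (M.foundMk k) := by
  refine (PluckerData.unitsHom_toBlpr _ _ _ _ _).trans ?_
  rw [PluckerData.bracketLift_signedUnit, PluckerData.map_signed, foundData_signed]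

/-- The isomorphism `k_M^f ⊗ 𝔽₁^{±,sq} ≃ ℙ_M^blpr`. -/
def thetaFound : OrderedBlueprint.Iso M.foundationSq M.universalPartialField.blpr where
  hom := M.thetaFoundHom
  inv := M.thetaFoundInv
  hom_inv := tensorSq_hom_ext (foundation_hom_ext fun k =>
    (congrArg M.thetaFoundInv.toRingHom (M.thetaFoundHom_mk k)).trans (M.thetaFoundInv_toBlpr k))
  inv_hom := blpr_hom_ext fun a => by
    obtain ⟨k, rfl⟩ := M.exists_of_crossRatioUnits a
    exact (congrArg M.thetaFoundHom.toRingHom (M.thetaFoundInv_toBlpr k)).trans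
      (M.thetaFoundHom_mk k)

/-- Both composites are morphisms from k_M^f, so it suffices to compare them on ±K, where each sends
a signed monomial to the unit of B_M that it represents. -/
lemma thetaFound_compat (a : M.foundation.carrier) :
    M.universalPartialFieldIncl.blpr.toRingHom
        (M.thetaFound.hom.toRingHom (M.toFoundationSq.toRingHom a)) =
      M.theta.hom.toRingHom (M.toWeakUniversalPastureSq.toRingHom
        (M.foundationIncl.toRingHom a)) := by
  have : M.universalPartialFieldIncl.blpr.comp (M.thetaFound.hom.comp M.toFoundationSq) =
      M.theta.hom.comp (M.toWeakUniversalPastureSq.comp M.foundationIncl) := by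
    refine foundation_hom_ext fun k => ?_
    refine (congrArg M.universalPartialFieldIncl.blpr.toRingHom (M.thetaFoundHom_mk k)).trans ?_
    refine Eq.trans ?_ (M.thetaHom_mk (M.crossZero k)).symm
    exact Hom.blpr_toBlpr _ _
  exact congrArg (fun f => f.toRingHom a) this

/-! #### The universal partial field -/

/-- The element of the universal partial field given by a signed monomial. -/
def universalMk : ℤˣ × M.crossGroup →* M.universalPartialField.G where
  toFun k := (⟨M.signedUnit (M.crossZero k), M.signedUnit_mem_crossRatioUnits k⟩ :
    M.crossRatioUnits)
  map_one' := Subtype.ext (map_one M.signedUnit)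
  map_mul' k l := Subtype.ext (map_mul M.signedUnit (M.crossZero k).1 (M.crossZero l).1)

lemma universalMk_surjective : Function.Surjective M.universalMk := fun a => by
  obtain ⟨k, h⟩ := M.exists_of_crossRatioUnits a
  exact ⟨k, h.symm⟩

/-- The image of a Laurent monomial in the universal partial field. -/
def toUniversal : M.LaurentMonomial →* M.universalPartialField.G :=
  M.universalMk.comp ((MonoidHom.inr ℤˣ M.crossGroup).comp
    (M.retraction.codRestrict M.crossGroup M.retraction_mem))

/-- The canonical map from the unit group of `ℙ_M` to the bracket ring. -/
def universalCoe : MonoidAlgebra ℤ M.universalPartialField.G →+* M.BracketRing :=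
  (M.unitsSubtype M.crossRatioUnits).comp M.universalPartialField.π

lemma universalCoe_of (k : ℤˣ × M.crossGroup) :
    M.universalCoe (MonoidAlgebra.of ℤ _ (M.universalMk k)) = M.signedUnit (M.crossZero k) :=
  M.unitsSubtype_π M.crossRatioUnits _

lemma universalCoe_one (k : M.crossGroup) :
    M.universalCoe (MonoidAlgebra.of ℤ _ (M.universalMk (1, k))) = M.bracketMk k := by
  refine (M.universalCoe_of (1, k)).trans ?_
  change (M.signedUnit (1, k.1) : M.BracketRing) = _
  rw [signedUnit_one]
  rfl

lemma universalCoe_neg_one (k : M.crossGroup) :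
    M.universalCoe (MonoidAlgebra.of ℤ _ (M.universalMk (-1, k))) = -M.bracketMk k := by
  refine (M.universalCoe_of (-1, k)).trans ?_
  change (M.signedUnit (-1, k.1) : M.BracketRing) = _
  rw [signedUnit_neg_one]
  rfl

lemma universalMk_neg_one_mul (k : M.crossGroup) :
    M.universalMk (-1, k) = M.universalMk (-1, 1) * M.universalMk (1, k) := by
  rw [← map_mul, Prod.mk_mul_mk, one_mul, mul_one]

lemma universalPartialField_π_eq_iff {x y : MonoidAlgebra ℤ M.universalPartialField.G} :
    M.universalPartialField.π x = M.universalPartialField.π y ↔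
      M.universalCoe x = M.universalCoe y :=
  (M.unitsSubtype_injective M.crossRatioUnits).eq_iff.symm

lemma universalPartialField_π_eq_zero {x : MonoidAlgebra ℤ M.universalPartialField.G} :
    M.universalPartialField.π x = 0 ↔ M.universalCoe x = 0 := by
  rw [← map_zero M.universalPartialField.π, universalPartialField_π_eq_iff, map_zero]

/-- `P = P^× ∪ {0}` for the universal partial field. -/
def universalElements : Submonoid (MonoidAlgebra ℤ M.universalPartialField.G) where
  carrier := M.universalPartialField.elements
  one_mem' := Or.inr ⟨1, map_one _⟩
  mul_mem' := by
    rintro _ _ (rfl | ⟨a, rfl⟩) (rfl | ⟨b, rfl⟩)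
    · exact Or.inl (mul_zero _)
    · exact Or.inl (zero_mul _)
    · exact Or.inl (mul_zero _)
    · exact Or.inr ⟨a * b, map_mul _ _ _⟩

/-- The ideal generated by the three term relations of the universal partial field. -/
def universalIdeal : Ideal (MonoidAlgebra ℤ M.universalPartialField.G) :=
  Ideal.span {x | M.universalPartialField.π x = 0 ∧ ∃ a ∈ M.universalPartialField.elements,
    ∃ b ∈ M.universalPartialField.elements, ∃ c ∈ M.universalPartialField.elements, x = a + b + c}

lemma universalIdeal_neg :
    Ideal.Quotient.mk M.universalIdeal (MonoidAlgebra.of ℤ _ (M.universalMk (-1, 1))) = -1 := by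
  have h : MonoidAlgebra.of ℤ _ (M.universalMk (-1, 1)) + 1 + 0 ∈ M.universalIdeal := by
    refine Ideal.subset_span ⟨?_, _, Or.inr ⟨_, rfl⟩, 1, Or.inr ⟨1, map_one _⟩, 0, Or.inl rfl, rfl⟩
    rw [universalPartialField_π_eq_zero, add_zero, map_add, map_one, universalCoe_neg_one,
      Subgroup.coe_one, map_one, neg_add_cancel]
  have h := Ideal.Quotient.eq_zero_iff_mem.2 h
  rw [add_zero, map_add, map_one] at h
  exact eq_neg_of_add_eq_zero_left h

/-- After the retraction every product in a Plücker relation is an element of P = P^× ∪ {0}, and the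
relation still vanishes in B_M. It is therefore a generator of the ideal of three term relations. -/
lemma universalIdeal_plucker (p : M.PluckerIndex) :
    M.plucker ((((Ideal.Quotient.mk M.universalIdeal : MonoidAlgebra ℤ M.universalPartialField.G →*
      MonoidAlgebra ℤ M.universalPartialField.G ⧸ M.universalIdeal)).comp
      (MonoidAlgebra.of ℤ M.universalPartialField.G)).comp M.toUniversal) (-1) p = 0 := by
  have mem : ∀ J, M.value ((MonoidAlgebra.of ℤ M.universalPartialField.G).comp M.toUniversal) J ∈
      M.universalElements := by
    intro J
    by_cases h : M.IsBase (J : Set E)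
    · rw [value_of_base _ h]; exact Or.inr ⟨_, rfl⟩
    · rw [value_of_not_base _ h]; exact Or.inl rfl
  have h : M.plucker ((MonoidAlgebra.of ℤ M.universalPartialField.G).comp M.toUniversal)
      (MonoidAlgebra.of ℤ _ (M.universalMk (-1, 1))) p ∈ M.universalIdeal := by
    refine Ideal.subset_span ⟨?_, _, M.universalElements.mul_mem (mem _) (mem _), _,
      M.universalElements.mul_mem (Or.inr ⟨_, rfl⟩) (M.universalElements.mul_mem (mem _) (mem _)),
      _, M.universalElements.mul_mem (mem _) (mem _), rfl⟩
    obtain ⟨v, hv⟩ := M.plucker_comp_retraction M.bracketMk (-1) p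
    rw [plucker_bracketMk, mul_zero] at hv
    rw [universalPartialField_π_eq_zero, map_plucker, universalCoe_neg_one, Subgroup.coe_one,
      map_one, ← hv]
    congr 1
    exact MonoidHom.ext fun x => M.universalCoe_one ⟨M.retraction x, M.retraction_mem x⟩
  have h := Ideal.Quotient.eq_zero_iff_mem.2 h
  rw [map_plucker, universalIdeal_neg] at h
  exact h

lemma toUniversal_of_mem (k : M.crossGroup) : M.toUniversal k = M.universalMk (1, k) := by
  change M.universalMk (1, ⟨M.retraction k, M.retraction_mem k⟩) = _
  congr 2
  exact Subtype.ext (M.retraction_eq_self k.2)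

/-- The Plücker relations hold in ℤ[P^×] modulo the three term ideal, which gives ψ from B_M to this
quotient. The retraction fixes K, so ψ after evaluation in B_M is the quotient map, and whatever
evaluates to 0 lies in the ideal. -/
lemma ker_universalCoe : RingHom.ker M.universalCoe ≤ M.universalIdeal := by
  set ψ := M.bracketLift _ M.universalIdeal_plucker with hψ
  have hid : ψ.comp M.universalCoe = Ideal.Quotient.mk M.universalIdeal := by
    refine MonoidAlgebra.ringHom_ext' (Subsingleton.elim _ _) (MonoidHom.ext fun a => ?_)
    change ψ (M.universalCoe (MonoidAlgebra.of ℤ _ a)) =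
      Ideal.Quotient.mk M.universalIdeal (MonoidAlgebra.of ℤ _ a)
    obtain ⟨⟨s, k⟩, rfl⟩ := M.universalMk_surjective a
    have key : ψ (M.bracketMk k) = Ideal.Quotient.mk M.universalIdeal
        (MonoidAlgebra.of ℤ _ (M.universalMk (1, k))) := by
      refine (M.bracketLift_mk _ _ k).trans ?_
      rw [← toUniversal_of_mem]
      rfl
    rcases Int.units_eq_one_or s with rfl | rfl
    · rw [universalCoe_one, key]
    · rw [universalCoe_neg_one, map_neg, key, universalMk_neg_one_mul, map_mul, map_mul,
        universalIdeal_neg]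
      exact neg_eq_neg_one_mul (Ideal.Quotient.mk M.universalIdeal _)
  intro x hx
  refine Ideal.Quotient.eq_zero_iff_mem.1 ?_
  rw [← hid, RingHom.comp_apply, hx, map_zero]

lemma universalPartialField_isPartialField [Nontrivial M.BracketRing] :
    M.universalPartialField.IsPartialField where
  injOn := by
    -- Here nontriviality of B_M enters: its units are nonzero. Distinct elements of the unit group
    -- are distinct in B_M by construction.
    have ne : ∀ a, M.universalPartialField.π (MonoidAlgebra.of ℤ _ a) ≠ 0 := by
      intro a h
      obtain ⟨k, rfl⟩ := M.universalMk_surjective a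
      rw [universalPartialField_π_eq_zero, universalCoe_of] at h
      exact Units.ne_zero _ h
    rintro _ (rfl | ⟨a, rfl⟩) _ (rfl | ⟨b, rfl⟩) h
    · rfl
    · rw [map_zero] at h
      exact absurd h.symm (ne b)
    · rw [map_zero] at h
      exact absurd h (ne a)
    · obtain ⟨k, rfl⟩ := M.universalMk_surjective a
      obtain ⟨l, rfl⟩ := M.universalMk_surjective b
      rw [universalPartialField_π_eq_iff, universalCoe_of, universalCoe_of] at h
      rw [show M.universalMk k = M.universalMk l from Subtype.ext (Units.ext h)]
  neg a := by
    obtain ⟨⟨s, k⟩, rfl⟩ := M.universalMk_surjective a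
    have hneg : M.universalCoe (MonoidAlgebra.of ℤ _ (M.universalMk (-1, 1))) = -1 := by
      rw [universalCoe_neg_one, Subgroup.coe_one, map_one]
    refine ⟨M.universalMk (-1, 1) * M.universalMk (s, k), ?_, fun b hb => ?_⟩
    · change M.universalPartialField.π (_ + _) = 0
      rw [universalPartialField_π_eq_zero, map_add, map_mul, map_mul, hneg]
      ring
    · obtain ⟨l, rfl⟩ := M.universalMk_surjective b
      rw [universalPartialField_π_eq_zero, map_add] at hb
      have h : M.universalCoe (MonoidAlgebra.of ℤ _ (M.universalMk l)) =
          M.universalCoe (MonoidAlgebra.of ℤ _ (M.universalMk ((-1, 1) * (s, k)))) := by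
        rw [map_mul, map_mul, map_mul, hneg]
        linear_combination hb
      rw [universalCoe_of, universalCoe_of] at h
      rw [← map_mul]
      exact Subtype.ext (Units.ext h)
  ker := by
    refine le_antisymm (fun x hx => ?_) (Ideal.span_le.2 fun x hx => hx.1)
    exact M.ker_universalCoe (M.universalPartialField_π_eq_zero.1 hx)

end Matroid
end

noncomputable section

/-! ### Morphisms into the blueprints of a partial field -/

namespace PartialFieldDatum

open OrderedBlueprint

/-- Sums with natural coefficients suffice, because m evaluates to -1 and absorbs negative
coefficients. -/
lemma blprEvalHom_surjective (P : PartialFieldDatum.{u}) {m : P.G}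
    (hm : P.π (MonoidAlgebra.of ℤ P.G m) = -1) : Function.Surjective P.blprEvalHom := by
  intro r
  obtain ⟨x, rfl⟩ := P.surj r
  induction x using MonoidAlgebra.induction_on with
  | of a => exact ⟨_, P.blprEvalHom_toBlpr a⟩
  | add x y hx hy =>
    obtain ⟨a, ha⟩ := hx
    obtain ⟨b, hb⟩ := hy
    exact ⟨a + b, by rw [map_add, map_add, ha, hb]⟩
  | smul n x hx =>
    obtain ⟨a, ha⟩ := hx
    have hneg : P.blprEvalHom (P.toBlpr m : P.blpr.carrier) = -1 := by
      rw [blprEvalHom_toBlpr, hm]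
    obtain ⟨k, rfl | rfl⟩ := n.eq_nat_or_neg
    · exact ⟨k • a, by rw [map_nsmul, ha, natCast_zsmul, map_nsmul]⟩
    · refine ⟨(P.toBlpr m : P.blpr.carrier) * k • a, ?_⟩
      rw [map_mul, hneg, map_nsmul, ha, neg_smul, map_neg, natCast_zsmul, map_nsmul]
      ring

lemma Hom.comp_blpr {P : PartialFieldDatum.{u}} {Q : PartialFieldDatum.{v}}
    {T : PartialFieldDatum.{w}} (f : Hom Q T) (g : Hom P Q) :
    (f.comp g).blpr = f.blpr.comp g.blpr :=
  blpr_hom_ext fun a => by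
    rw [blpr_toBlpr, OrderedBlueprint.Hom.comp_apply, blpr_toBlpr, blpr_toBlpr]
    rfl

/-- The class of `a ∈ P^×` in `P^oblpr`. -/
def toOblpr (P : PartialFieldDatum.{u}) : P.G →* P.oblpr.carrier :=
  P.oblpr.mon.subtype.comp (ofGroupMk P.G _)

lemma toOblpr_mem (P : PartialFieldDatum.{u}) (a : P.G) : P.toOblpr a ∈ P.oblpr.mon :=
  (ofGroupMk P.G _ a).2

/-- The evaluation of `P^oblpr` in the ambient ring. -/
def oblprEval (P : PartialFieldDatum.{u}) : OrderedBlueprint.Hom P.oblpr (discrete P.R) :=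
  P.blprEval.comp P.oblprToBlpr

/-- The evaluation of `P^oblpr` in the ambient ring, as a ring homomorphism. -/
def oblprEvalHom (P : PartialFieldDatum.{u}) : P.oblpr.carrier →+* P.R := P.oblprEval.toRingHom

lemma oblprToBlpr_toOblpr (P : PartialFieldDatum.{u}) (a : P.G) :
    P.oblprToBlpr.toRingHom (P.toOblpr a) = P.toBlpr a := rfl

lemma oblprEvalHom_toOblpr (P : PartialFieldDatum.{u}) (a : P.G) :
    P.oblprEvalHom (P.toOblpr a) = P.π (MonoidAlgebra.of ℤ P.G a) :=
  P.blprEvalHom_toBlpr a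

lemma oblprEvalHom_eq_zero (P : PartialFieldDatum.{u}) {x : P.oblpr.carrier} (h : 0 ≤ x) :
    P.oblprEvalHom x = 0 :=
  (P.oblprEval.le_map_of_zero_le h : (0 : P.R) = _).symm

lemma Hom.oblpr_toOblpr {P : PartialFieldDatum.{u}} {Q : PartialFieldDatum.{v}} (f : P.Hom Q)
    (a : P.G) : f.oblpr.toRingHom (P.toOblpr a) = Q.toOblpr (f.toMonoidHom a) :=
  congrArg (ofGroupProj Q.G _) (f.natMap_of a)

lemma mem_oblpr_mon {P : PartialFieldDatum.{u}} {x : P.oblpr.carrier} (hx : x ∈ P.oblpr.mon) :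
    x = 0 ∨ ∃ a, x = P.toOblpr a :=
  mem_ofGroup_mon hx

lemma mem_blpr_mon {P : PartialFieldDatum.{u}} {x : P.blpr.carrier} (hx : x ∈ P.blpr.mon) :
    x = 0 ∨ ∃ a, x = P.toBlpr a :=
  mem_ofGroup_mon hx

lemma Hom.oblprToBlpr_comp {P : PartialFieldDatum.{u}} {Q : PartialFieldDatum.{v}} (f : P.Hom Q) :
    Q.oblprToBlpr.comp f.oblpr = f.blpr.comp P.oblprToBlpr :=
  ofGroup_hom_ext fun a =>
    ((congrArg Q.oblprToBlpr.toRingHom (f.oblpr_toOblpr a)).trans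
      (f.blpr_toBlpr a).symm : _)

/-- Sums of three elements that vanish in the ambient ring are positive in `P^oblpr`. -/
lemma oblpr_zero_le {P : PartialFieldDatum.{u}} {x y z : P.oblpr.carrier} (hx : x ∈ P.oblpr.mon)
    (hy : y ∈ P.oblpr.mon) (hz : z ∈ P.oblpr.mon) (h : P.oblprEvalHom (x + y + z) = 0) :
    0 ≤ x + y + z := by
  obtain ⟨a, ha, rfl⟩ := hx
  obtain ⟨b, hb, rfl⟩ := hy
  obtain ⟨c, hc, rfl⟩ := hz
  have h' : P.natπ (a + b + c) = 0 := h
  exact ofGroupProj_le P.G _ 0 (a + b + c) ⟨rfl, h', a, ha, b, hb, c, hc, rfl⟩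

end PartialFieldDatum

namespace PartialField

open OrderedBlueprint PartialFieldDatum

variable (P : PartialField.{v})

lemma exists_neg_one : ∃ m : P.G, P.π (MonoidAlgebra.of ℤ P.G m) = -1 := by
  obtain ⟨m, hm, -⟩ := P.isPartialField.neg 1
  refine ⟨m, ?_⟩
  change P.π (_ + _) = 0 at hm
  rw [map_add, map_one, map_one] at hm
  exact eq_neg_of_add_eq_zero_right hm

/-- The element `-1` of a partial field. -/
def negOne : P.G := P.exists_neg_one.choose

lemma π_negOne : P.π (MonoidAlgebra.of ℤ P.G P.negOne) = -1 := P.exists_neg_one.choose_spec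

lemma π_of_injective {a b : P.G}
    (h : P.π (MonoidAlgebra.of ℤ P.G a) = P.π (MonoidAlgebra.of ℤ P.G b)) : a = b :=
  MonoidAlgebra.of_injective (P.isPartialField.injOn (Or.inr ⟨a, rfl⟩) (Or.inr ⟨b, rfl⟩) h)

lemma π_of_ne_zero (a : P.G) : P.π (MonoidAlgebra.of ℤ P.G a) ≠ 0 := by
  intro h
  rw [← map_zero P.π] at h
  have h' := P.isPartialField.injOn (Or.inr ⟨a, rfl⟩) (Or.inl rfl) h
  have := congrArg (fun x => x.coeff a) h'
  simp [MonoidAlgebra.of_apply] at this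

instance : Nontrivial P.R :=
  ⟨_, _, P.π_of_ne_zero 1⟩

lemma negOne_mul_self : P.negOne * P.negOne = 1 := by
  refine P.π_of_injective ?_
  rw [map_mul, map_mul, π_negOne, map_one, map_one]
  ring

lemma blpr_hasNeg : P.blpr.HasNeg := PartialFieldDatum.blpr_hasNeg _ P.π_negOne

lemma oblprEvalHom_injOn {x y : P.oblpr.carrier} (hx : x ∈ P.oblpr.mon) (hy : y ∈ P.oblpr.mon)
    (h : P.oblprEvalHom x = P.oblprEvalHom y) : x = y := by
  rcases mem_oblpr_mon hx with rfl | ⟨a, rfl⟩ <;> rcases mem_oblpr_mon hy with rfl | ⟨b, rfl⟩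
  · rfl
  · rw [map_zero, oblprEvalHom_toOblpr] at h
    exact absurd h.symm (P.π_of_ne_zero b)
  · rw [map_zero, oblprEvalHom_toOblpr] at h
    exact absurd h (P.π_of_ne_zero a)
  · rw [oblprEvalHom_toOblpr, oblprEvalHom_toOblpr] at h
    rw [P.π_of_injective h]

/-- Weak inverses become negatives in R_P, and the elements of P are separated there by the first
axiom of partial fields. -/
lemma oblpr_uniqueWeakInverses : P.oblpr.UniqueWeakInverses := by
  intro a a' b h h'
  refine P.oblprEvalHom_injOn h.1 h'.1 ?_
  have e := P.oblprEvalHom_eq_zero h.2.2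
  have e' := P.oblprEvalHom_eq_zero h'.2.2
  rw [map_add] at e e'
  exact add_right_cancel (e.trans e'.symm)

lemma oblpr_isWeakInverse : P.oblpr.IsWeakInverse 1 (P.toOblpr P.negOne) := by
  refine ⟨P.oblpr.mon.one_mem, P.toOblpr_mem _, ?_⟩
  have := oblpr_zero_le P.oblpr.mon.one_mem (P.toOblpr_mem P.negOne) P.oblpr.zero_mem (by
    rw [map_add, map_add, map_one, oblprEvalHom_toOblpr, π_negOne, map_zero]
    ring)
  rwa [add_zero] at this

lemma toOblpr_negOne_mul_self : P.toOblpr P.negOne * P.toOblpr P.negOne = 1 := by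
  rw [← map_mul, negOne_mul_self, map_one]

lemma toBlpr_injective {a b : P.G}
    (h : (P.toBlpr a : P.blpr.carrier) = P.toBlpr b) : a = b := by
  refine P.π_of_injective ?_
  rw [← blprEvalHom_toBlpr, h, blprEvalHom_toBlpr]

/-- Morphisms from groups to `P^blpr` factor through `P^×`. -/
lemma exists_factor {G : Type w} [Group G] (f : G →* P.blpr.carrier)
    (hf : ∀ x, f x ∈ P.blpr.mon) : ∃ g : G →* P.G, ∀ x, f x = P.toBlpr (g x) := by
  have key : ∀ x, ∃ a, f x = P.toBlpr a := by
    intro x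
    -- The value 0 is impossible: f x is invertible and 1 ≠ 0 in R_P.
    refine (mem_blpr_mon (hf x)).resolve_left fun h => ?_
    have h1 : f x * f x⁻¹ = 1 := by rw [← map_mul, mul_inv_cancel, map_one]
    rw [h, zero_mul] at h1
    have h2 := congrArg P.blprEvalHom h1
    rw [map_zero, map_one] at h2
    exact zero_ne_one h2
  choose g hg using key
  refine ⟨⟨⟨g, ?_⟩, fun x y => ?_⟩, hg⟩
  · refine P.toBlpr_injective ?_
    rw [← hg, map_one, map_one]
    rfl
  · refine P.toBlpr_injective ?_
    rw [← hg, map_mul, map_mul, hg, hg]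
    rfl

end PartialField

namespace Matroid

open OrderedBlueprint PartialFieldDatum

variable {E : Type u} [LinearOrder E] {M : Matroid E}

/-! #### Weak Grassmann-Plücker functions -/

section WeakGP

variable {B : OrderedBlueprint.{v}} {C : OrderedBlueprint.{w}}

/-- The morphism `x_J ↦ Δ(J)`. -/
def WeakGPFunction.unitHom (D : M.WeakGPFunction B) : M.LaurentMonomial →* (B.mon)ˣ :=
  M.monLift fun J => (D.isUnit J.1 J.2).unit

lemma WeakGPFunction.unitHom_xMon (D : M.WeakGPFunction B) (J : M.Basis) :
    (D.unitHom (M.xMon J) : B.mon) = D.Δ J.1 := by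
  rw [unitHom, monLift_xMon]
  rfl

/-- The morphism `x_J ↦ Δ(J)` with values in `B⁺`. -/
def WeakGPFunction.carrierHom (D : M.WeakGPFunction B) : M.LaurentMonomial →* B.carrier :=
  (B.mon.subtype.comp (Units.coeHom B.mon)).comp D.unitHom

lemma WeakGPFunction.value_carrierHom (D : M.WeakGPFunction B) (J : Finset E) :
    M.value D.carrierHom J = D.Δ J := by
  by_cases h : M.IsBase (J : Set E)
  · rw [value_of_base _ h]
    exact congrArg Subtype.val (D.unitHom_xMon ⟨J, h⟩)
  · rw [value_of_not_base _ h, D.eq_zero J h]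

/-- `Δ` as `PluckerData`. -/
def WeakGPFunction.data (D : M.WeakGPFunction B) (hB : B.UniqueWeakInverses) {e : B.carrier}
    (he : B.IsWeakInverse 1 e) (hee : e * e = 1) : M.PluckerData B where
  toMonoidHom := D.carrierHom
  eps := e
  map_mem x := (D.unitHom x : B.mon).2
  eps_mem := he.2.1
  eps_mul_eps := hee
  le_one_add_eps := he.2.2
  le_plucker p := by
    obtain ⟨e', he', h⟩ := D.plucker p
    rw [hB _ _ _ he'.symm he.symm] at h
    simp only [Matroid.plucker, value_carrierHom]
    exact h

/-- The weak Grassmann-Plücker function `J ↦ d(x_J)`. -/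
def PluckerData.toGP (d : M.PluckerData B) : M.WeakGPFunction B where
  Δ J := ⟨M.value d.toMonoidHom J, by
    by_cases h : M.IsBase (J : Set E)
    · rw [value_of_base _ h]; exact d.map_mem _
    · rw [value_of_not_base _ h]; exact B.zero_mem⟩
  isUnit J h := by
    refine IsUnit.of_mul_eq_one ⟨d.toMonoidHom (M.xMon ⟨J, h⟩)⁻¹, d.map_mem _⟩ (Subtype.ext ?_)
    change M.value d.toMonoidHom J * _ = 1
    rw [value_of_base _ h, ← map_mul, mul_inv_cancel, map_one]
  eq_zero J h := value_of_not_base _ h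
  plucker p := ⟨d.eps, ⟨B.mon.one_mem, d.eps_mem, d.le_one_add_eps⟩, d.le_plucker p⟩

lemma PluckerData.carrierHom_toGP (d : M.PluckerData B) : d.toGP.carrierHom = d.toMonoidHom := by
  refine mon_hom_ext fun J => ?_
  refine (congrArg Subtype.val (d.toGP.unitHom_xMon J)).trans ?_
  exact value_of_base _ J.2

lemma PluckerData.signed_congr {d d' : M.PluckerData B} (h : d.toMonoidHom = d'.toMonoidHom)
    (he : d.eps = d'.eps) : d.signed = d'.signed := by
  cases d
  cases d'
  subst h he
  rfl

lemma PluckerData.data_toGP_signed (d : M.PluckerData B) (hB : B.UniqueWeakInverses) {e : B.carrier}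
    (he : B.IsWeakInverse 1 e) (hee : e * e = 1) : (d.toGP.data hB he hee).signed = d.signed :=
  PluckerData.signed_congr d.carrierHom_toGP
    (hB e d.eps 1 he.symm ⟨d.eps_mem, B.mon.one_mem, by
      rw [add_comm]; exact d.le_one_add_eps⟩)

lemma WeakGPFunction.unitHom_eq_mul_rescaling {D D' : M.WeakGPFunction B} {a : (B.mon)ˣ}
    {t : E → (B.mon)ˣ} (h : ∀ J : Finset E,
      D'.Δ J = (a : B.mon) * ((∏ j ∈ J, t j : (B.mon)ˣ) : B.mon) * D.Δ J) :
    D'.unitHom = D.unitHom * M.rescaling a t := by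
  refine mon_hom_ext fun J => Units.ext ?_
  rw [unitHom_xMon, MonoidHom.mul_apply, Units.val_mul, unitHom_xMon, rescaling_xMon, h,
    Units.val_mul, mul_comm]

/-- The quotient q of the two homomorphisms is trivial on K. The monomial x_J times its rescaling
lies in K, so q(x_J) is the inverse of q(a) ∏ q(t(j)), which is the desired rescaling factor. -/
lemma WeakGPFunction.rescalingEquiv_of_eqOn [Finite E] {D D' : M.WeakGPFunction B}
    (h : ∀ k ∈ M.crossGroup, D.unitHom k = D'.unitHom k) : RescalingEquiv D D' := by
  obtain ⟨a, t, hat⟩ := M.exists_rescaling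
  set q := D'.unitHom / D.unitHom with hq
  have hqK : ∀ k ∈ M.crossGroup, q k = 1 := fun k hk => by
    rw [hq, MonoidHom.div_apply, h k hk, div_self']
  refine ⟨(q a)⁻¹, fun j => (q (t j))⁻¹, fun J => ?_⟩
  by_cases hJ : M.IsBase (J : Set E)
  · have e := hqK _ (hat (M.xMon ⟨J, hJ⟩))
    rw [map_mul, rescaling_xMon, map_mul, map_prod] at e
    have e' := eq_inv_of_mul_eq_one_left e
    rw [mul_inv, ← Finset.prod_inv_distrib] at e'
    rw [← D.unitHom_xMon ⟨J, hJ⟩, ← D'.unitHom_xMon ⟨J, hJ⟩, ← Units.val_mul, ← Units.val_mul, ← e',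
      hq, MonoidHom.div_apply, div_mul_cancel]
  · refine Subtype.ext ?_
    rw [D'.eq_zero J hJ, Submonoid.coe_mul, D.eq_zero J hJ, mul_zero]

lemma WeakGPFunction.map_carrierHom (D : M.WeakGPFunction B) (f : OrderedBlueprint.Hom B C) :
    (D.map f).carrierHom = (f.toRingHom : B.carrier →* C.carrier).comp D.carrierHom := by
  refine mon_hom_ext fun J => ?_
  refine (congrArg Subtype.val ((D.map f).unitHom_xMon J)).trans ?_
  exact congrArg f.toRingHom (congrArg Subtype.val (D.unitHom_xMon J)).symm

end WeakGP

/-! ### The three natural bijections -/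

section Bijections

variable [Finite E] (P : PartialField.{v})

/-- The morphism `k_M^w → P^oblpr` given by a weak Grassmann-Plücker function. -/
def WeakGPFunction.dataP {P : PartialField.{v}} (D : M.WeakGPFunction P.oblpr) :
    M.PluckerData P.oblpr :=
  D.data P.oblpr_uniqueWeakInverses P.oblpr_isWeakInverse P.toOblpr_negOne_mul_self

/-- The morphism `k_M^w → P^oblpr` given by a weak Grassmann-Plücker function. -/
def WeakGPFunction.hom {P : PartialField.{v}} (D : M.WeakGPFunction P.oblpr) :
    OrderedBlueprint.Hom M.weakUniversalPasture P.oblpr :=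
  D.dataP.lift P.oblpr_uniqueWeakInverses

lemma WeakGPFunction.hom_mk {P : PartialField.{v}} (D : M.WeakGPFunction P.oblpr)
    (h : M.zeroGroup) : D.hom.toRingHom (M.weakMk h) = D.dataP.signed h :=
  D.dataP.lift_mk _ h

lemma WeakGPFunction.hom_xRatio {P : PartialField.{v}} (D : M.WeakGPFunction P.oblpr)
    (I J : M.Basis) : D.hom.toRingHom (M.xRatio I J) * (D.Δ J.1 : P.oblpr.carrier) = D.Δ I.1 := by
  rw [xRatio_eq, hom_mk]
  change D.dataP.signed (1, M.xMon I / M.xMon J) * _ = _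
  rw [PluckerData.signed_one, ← D.unitHom_xMon I, ← D.unitHom_xMon J]
  change ((D.unitHom (M.xMon I / M.xMon J) : P.oblpr.mon) : P.oblpr.carrier) *
    ((D.unitHom (M.xMon J) : P.oblpr.mon) : P.oblpr.carrier) = _
  rw [← Submonoid.coe_mul, ← Units.val_mul, ← map_mul, div_mul_cancel]

lemma WeakGPFunction.hom_comp_foundationIncl {P : PartialField.{v}} (D : M.WeakGPFunction P.oblpr)
    (k : ℤˣ × M.crossGroup) : (D.hom.comp M.foundationIncl).toRingHom (M.foundMk k) =
      signHom (P.toOblpr P.negOne) P.toOblpr_negOne_mul_self k.1 *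
        ((D.unitHom k.2 : P.oblpr.mon) : P.oblpr.carrier) :=
  D.hom_mk (M.crossZero k)

variable (M) in
/-- The map from rescaling classes to morphisms from the foundation. -/
def classToHom : M.RescalingClass P.oblpr → OrderedBlueprint.Hom M.foundation P.oblpr :=
  Quot.lift (fun D => D.hom.comp M.foundationIncl) (by
    rintro D D' ⟨a, t, h⟩
    refine foundation_hom_ext fun k => ?_
    rw [D.hom_comp_foundationIncl, D'.hom_comp_foundationIncl,
      WeakGPFunction.unitHom_eq_mul_rescaling h, MonoidHom.mul_apply,
      M.rescaling_eq_one a t k.2.2, mul_one])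

lemma classToHom_injective : Function.Injective (M.classToHom P) := by
  rintro ⟨D⟩ ⟨D'⟩ h
  refine Quot.sound (WeakGPFunction.rescalingEquiv_of_eqOn fun k hk => ?_)
  have e := congrArg (fun f => f.toRingHom (M.foundMk (1, ⟨k, hk⟩))) h
  have e' := (D.hom_comp_foundationIncl (1, ⟨k, hk⟩)).symm.trans
    (e.trans (D'.hom_comp_foundationIncl (1, ⟨k, hk⟩)))
  rw [map_one, one_mul, one_mul] at e'
  exact Units.ext (Subtype.ext e')

/-- Extend the morphism to k_M^w by the retraction onto the foundation and read off the values at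
the x_J. -/
lemma classToHom_surjective : Function.Surjective (M.classToHom P) := by
  intro f
  refine ⟨RescalingClass.mk (M.weakData.map (f.comp M.foundRetraction)).toGP, ?_⟩
  refine foundation_hom_ext fun k => ?_
  refine (WeakGPFunction.hom_mk _ (M.crossZero k)).trans ?_
  rw [WeakGPFunction.dataP, PluckerData.data_toGP_signed, PluckerData.map_signed, weakData_signed]
  exact congrArg (fun g => f.toRingHom (g.toRingHom (M.foundMk k))) M.foundRetraction_comp_incl

variable (M) in
/-- The bijection between rescaling classes and morphisms from the foundation. -/
def classEquiv : M.RescalingClass P.oblpr ≃ OrderedBlueprint.Hom M.foundation P.oblpr :=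
  Equiv.ofBijective (M.classToHom P) ⟨classToHom_injective P, classToHom_surjective P⟩

variable {P} {Q : PartialField.{v}}

lemma map_negOne (φ : PartialFieldDatum.Hom P.toPartialFieldDatum Q.toPartialFieldDatum) :
    φ.toMonoidHom P.negOne = Q.negOne := by
  obtain ⟨g, hg⟩ := φ.exists_ringHom
  refine Q.π_of_injective ?_
  rw [← hg, P.π_negOne, Q.π_negOne, map_neg, map_one]

lemma classEquiv_natural
    (φ : PartialFieldDatum.Hom P.toPartialFieldDatum Q.toPartialFieldDatum)
    (c : M.RescalingClass P.oblpr) :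
    M.classEquiv Q (RescalingClass.map φ.oblpr c) = φ.oblpr.comp (M.classEquiv P c) := by
  obtain ⟨D⟩ := c
  refine foundation_hom_ext fun k => ?_
  change ((D.map φ.oblpr).hom.comp M.foundationIncl).toRingHom (M.foundMk k) =
    φ.oblpr.toRingHom (D.hom.toRingHom (M.weakMk (M.crossZero k)))
  rw [D.hom_mk, ← PluckerData.map_signed]
  refine ((D.map φ.oblpr).hom_mk (M.crossZero k)).trans ?_
  refine DFunLike.congr_fun (PluckerData.signed_congr (d := (D.map φ.oblpr).dataP)
    (d' := D.dataP.map φ.oblpr) ?_ ?_) _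
  · exact D.map_carrierHom φ.oblpr
  · exact ((φ.oblpr_toOblpr P.negOne).trans (congrArg Q.toOblpr (map_negOne φ))).symm

variable (P)

variable (M) in
/-- The extension of morphisms from the foundation to `k_M^f ⊗ 𝔽₁^{±,sq}`. -/
def homToSq (f : OrderedBlueprint.Hom M.foundation P.oblpr) :
    OrderedBlueprint.Hom M.foundationSq P.blpr :=
  tensorSqLift _ P.blpr_hasNeg (P.oblprToBlpr.comp f)

lemma homToSq_comp (f : OrderedBlueprint.Hom M.foundation P.oblpr) :
    (M.homToSq P f).comp M.toFoundationSq = P.oblprToBlpr.comp f :=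
  tensorSqLift_comp M.foundationStr P.blpr_hasNeg _

/-- A morphism is determined on the underlying monoid, and the elements of P are distinguished in
P^blpr by evaluation in R_P. -/
lemma homToSq_injective : Function.Injective (M.homToSq P) := by
  intro f g h
  have e := (homToSq_comp P f).symm.trans ((congrArg (fun k => k.comp M.toFoundationSq) h).trans
    (homToSq_comp P g))
  refine Hom.ext_mon fun a ha => P.oblprEvalHom_injOn (f.map_mon a ha) (g.map_mon a ha) ?_
  exact congrArg (fun k => P.blprEvalHom (k.toRingHom a)) e

/-- `PluckerData` with values in `P^blpr` lift to `P^oblpr`. -/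
lemma PluckerData.exists_oblpr (d : M.PluckerData P.blpr) :
    ∃ d' : M.PluckerData P.oblpr, ∀ h, P.oblprToBlpr.toRingHom (d'.signed h) = d.signed h := by
  obtain ⟨γ, hγ⟩ := P.exists_factor d.toMonoidHom d.map_mem
  have heps : d.eps = P.toBlpr P.negOne := by
    have h1 := d.one_add_eps P.blpr_hasNeg
    refine P.blprEvalHom_injective ?_
    have h2 := congrArg P.blprEvalHom h1
    rw [map_add, map_one, map_zero] at h2
    rw [blprEvalHom_toBlpr, P.π_negOne]
    exact eq_neg_of_add_eq_zero_right h2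
  have mem : ∀ J, M.value (P.toOblpr.comp γ) J ∈ P.oblpr.mon := by
    intro J
    by_cases h : M.IsBase (J : Set E)
    · rw [value_of_base _ h]; exact P.toOblpr_mem _
    · rw [value_of_not_base _ h]; exact P.oblpr.zero_mem
  have hγ' : (P.oblprToBlpr.toRingHom : P.oblpr.carrier →* P.blpr.carrier).comp
      (P.toOblpr.comp γ) = d.toMonoidHom := MonoidHom.ext fun x => (hγ x).symm
  let d' : M.PluckerData P.oblpr :=
    { toMonoidHom := P.toOblpr.comp γ
      eps := P.toOblpr P.negOne
      map_mem := fun x => P.toOblpr_mem _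
      eps_mem := P.toOblpr_mem _
      eps_mul_eps := P.toOblpr_negOne_mul_self
      le_one_add_eps := P.oblpr_isWeakInverse.2.2
      -- Each term is a product in P = P^× ∪ {0}, so the relation is a sum of three elements of P.
      -- Such sums are positive in P^oblpr as soon as they vanish in R_P; longer relations would not
      -- lift this way.
      le_plucker := fun p => by
        refine oblpr_zero_le (mul_mem (mem _) (mem _)) (mul_mem (P.toOblpr_mem _)
          (mul_mem (mem _) (mem _))) (mul_mem (mem _) (mem _)) ?_
        change P.blprEvalHom (P.oblprToBlpr.toRingHom
          (M.plucker (P.toOblpr.comp γ) (P.toOblpr P.negOne) p)) = 0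
        rw [map_plucker, hγ', oblprToBlpr_toOblpr, ← heps,
          ← P.blpr_hasNeg.eq_of_le (d.le_plucker p), map_zero] }
  refine ⟨d', fun h => ?_⟩
  rw [← PluckerData.map_signed]
  exact DFunLike.congr_fun (PluckerData.signed_congr (d := d'.map P.oblprToBlpr) (d' := d) hγ'
    heps.symm) h

/-- Pull the morphism back to Plücker data through the foundation, lift them to P^oblpr, and
restrict the resulting morphism from k_M^w. -/
lemma homToSq_surjective : Function.Surjective (M.homToSq P) := by
  intro g
  obtain ⟨d', hd'⟩ := PluckerData.exists_oblpr P (M.foundData.map (g.comp M.toFoundationSq))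
  refine ⟨(d'.lift P.oblpr_uniqueWeakInverses).comp M.foundationIncl, tensorSq_hom_ext ?_⟩
  refine (homToSq_comp P _).trans (foundation_hom_ext fun k => ?_)
  refine (congrArg P.oblprToBlpr.toRingHom (d'.lift_mk P.oblpr_uniqueWeakInverses
    (M.crossZero k))).trans ?_
  rw [hd', PluckerData.map_signed, foundData_signed]
  rfl

variable (M) in
/-- The bijection between morphisms from `k_M^f` and from `k_M^f ⊗ 𝔽₁^{±,sq}`. -/
def sqEquiv : OrderedBlueprint.Hom M.foundation P.oblpr ≃
    OrderedBlueprint.Hom M.foundationSq P.blpr :=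
  Equiv.ofBijective (M.homToSq P) ⟨homToSq_injective P, homToSq_surjective P⟩

variable {P}

lemma sqEquiv_natural (φ : PartialFieldDatum.Hom P.toPartialFieldDatum Q.toPartialFieldDatum)
    (f : OrderedBlueprint.Hom M.foundation P.oblpr) :
    M.sqEquiv Q (φ.oblpr.comp f) = φ.blpr.comp (M.sqEquiv P f) := by
  refine tensorSq_hom_ext ((homToSq_comp Q _).trans ?_)
  refine Eq.trans ?_ (congrArg (fun k => φ.blpr.comp k) (homToSq_comp P f)).symm
  exact congrArg (fun k => k.comp f) φ.oblprToBlpr_comp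

variable (P)

variable (M) in
/-- The morphism from `k_M^f ⊗ 𝔽₁^{±,sq}` given by a morphism from `ℙ_M`. -/
def sqOfHom (φ : PartialFieldDatum.Hom M.universalPartialField P.toPartialFieldDatum) :
    OrderedBlueprint.Hom M.foundationSq P.blpr :=
  φ.blpr.comp M.thetaFound.hom

lemma sqOfHom_injective : Function.Injective (M.sqOfHom P) := by
  intro φ ψ h
  have e : φ.blpr = ψ.blpr := by
    have := congrArg (fun k => k.comp M.thetaFound.inv) h
    refine Eq.trans ?_ (this.trans ?_)
    · exact (congrArg (fun k => φ.blpr.comp k) M.thetaFound.inv_hom).symm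
    · exact congrArg (fun k => ψ.blpr.comp k) M.thetaFound.inv_hom
  refine PartialFieldDatum.Hom.ext (MonoidHom.ext fun a => P.toBlpr_injective ?_)
  rw [← φ.blpr_toBlpr, ← ψ.blpr_toBlpr, e]

/-- Because ℙ_M contains -1, the blueprint ℙ_M^blpr evaluates bijectively onto the ambient ring. A
morphism of blueprints thus provides the ring homomorphism that a morphism of partial fields
requires. -/
lemma sqOfHom_surjective : Function.Surjective (M.sqOfHom P) := by
  intro g
  set h := g.comp M.thetaFound.inv with hh
  obtain ⟨γ, hγ⟩ := P.exists_factor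
    (((h.toRingHom : M.universalPartialField.blpr.carrier →* P.blpr.carrier).comp
      M.universalPartialField.blpr.mon.subtype).comp M.universalPartialField.toBlpr)
    fun x => h.map_mon _ (toBlpr_mem _ x)
  have hneg : M.universalPartialField.π (MonoidAlgebra.of ℤ _ (M.universalMk (-1, 1))) = -1 := by
    rw [← map_one M.universalPartialField.π, ← map_neg, universalPartialField_π_eq_iff, map_neg,
      map_one, universalCoe_neg_one, Subgroup.coe_one, map_one]
  let ev := RingEquiv.ofBijective M.universalPartialField.blprEvalHom
    ⟨blprEvalHom_injective _, blprEvalHom_surjective _ hneg⟩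
  have hev : ∀ a, ev.symm (M.universalPartialField.π (MonoidAlgebra.of ℤ _ a)) =
      (M.universalPartialField.toBlpr a : M.universalPartialField.blpr.carrier) := fun a => by
    rw [RingEquiv.symm_apply_eq]
    exact (blprEvalHom_toBlpr _ a).symm
  let φ : PartialFieldDatum.Hom M.universalPartialField P.toPartialFieldDatum :=
    ⟨γ, (P.blprEvalHom.comp h.toRingHom).comp ev.symm.toRingHom, fun a => by
      change P.blprEvalHom (h.toRingHom (ev.symm _)) = _
      rw [hev, ← blprEvalHom_toBlpr]
      exact congrArg P.blprEvalHom (hγ a)⟩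
  refine ⟨φ, ?_⟩
  have e : φ.blpr = h := blpr_hom_ext fun a => (φ.blpr_toBlpr a).trans (hγ a).symm
  rw [sqOfHom, e]
  exact congrArg (fun k => g.comp k) M.thetaFound.hom_inv

variable (M) in
/-- The bijection between morphisms from `k_M^f ⊗ 𝔽₁^{±,sq}` and from `ℙ_M`. -/
def universalEquiv : OrderedBlueprint.Hom M.foundationSq P.blpr ≃
    PartialFieldDatum.Hom M.universalPartialField P.toPartialFieldDatum :=
  (Equiv.ofBijective (M.sqOfHom P) ⟨sqOfHom_injective P, sqOfHom_surjective P⟩).symm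

lemma universalEquiv_blpr (g : OrderedBlueprint.Hom M.foundationSq P.blpr) :
    (M.universalEquiv P g).blpr.comp M.thetaFound.hom = g :=
  (Equiv.ofBijective (M.sqOfHom P) _).apply_symm_apply g

variable {P}

lemma universalEquiv_natural
    (φ : PartialFieldDatum.Hom P.toPartialFieldDatum Q.toPartialFieldDatum)
    (g : OrderedBlueprint.Hom M.foundationSq P.blpr) :
    M.universalEquiv Q (φ.blpr.comp g) = φ.comp (M.universalEquiv P g) := by
  refine sqOfHom_injective Q ((universalEquiv_blpr Q _).trans ?_)
  rw [sqOfHom, Hom.comp_blpr]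
  exact (congrArg (fun k => φ.blpr.comp k) (universalEquiv_blpr P g)).symm

end Bijections

end Matroid
end

noncomputable section

/-! ### Maximal minors -/

namespace Matrix

variable {R : Type v} [CommRing R]

/-- A three term Plücker relation for determinants, with all but two rows fixed. -/
lemma det_three_term {n : ℕ} (a b c d : Fin (n + 2) → R) (w : Fin n → Fin (n + 2) → R) :
    (of (Fin.cons a (Fin.cons b w : Fin (n + 1) → Fin (n + 2) → R))).det *
        (of (Fin.cons c (Fin.cons d w : Fin (n + 1) → Fin (n + 2) → R))).det -
      (of (Fin.cons a (Fin.cons c w : Fin (n + 1) → Fin (n + 2) → R))).det *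
        (of (Fin.cons b (Fin.cons d w : Fin (n + 1) → Fin (n + 2) → R))).det +
      (of (Fin.cons a (Fin.cons d w : Fin (n + 1) → Fin (n + 2) → R))).det *
        (of (Fin.cons b (Fin.cons c w : Fin (n + 1) → Fin (n + 2) → R))).det = 0 := by
  set D : (Fin (n + 2) → R) → (Fin (n + 2) → R) → R := fun x y =>
    (of (Fin.cons x (Fin.cons y w : Fin (n + 1) → Fin (n + 2) → R))).det with hD
  set N : Matrix (Fin (n + 2)) (Fin (n + 2)) R :=
    of (Fin.cons a (Fin.cons b w : Fin (n + 1) → Fin (n + 2) → R)) with hN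
  have hswap : ∀ x y, D x y = -D y x := by
    intro x y
    have h := det_permute (Equiv.swap (0 : Fin (n + 2)) 1)
      (of (Fin.cons y (Fin.cons x w : Fin (n + 1) → Fin (n + 2) → R)))
    rw [Equiv.Perm.sign_swap (by simp)] at h
    have e : (of (Fin.cons y (Fin.cons x w : Fin (n + 1) → Fin (n + 2) → R))).submatrix
        (Equiv.swap (0 : Fin (n + 2)) 1) id =
        of (Fin.cons x (Fin.cons y w : Fin (n + 1) → Fin (n + 2) → R)) := by
      ext i j
      rw [submatrix_apply, of_apply, of_apply]
      refine Fin.cases ?_ (fun i => Fin.cases ?_ (fun i => ?_) i) i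
      · rw [Equiv.swap_apply_left]; rfl
      · rw [show (Fin.succ 0 : Fin (n + 2)) = 1 from rfl, Equiv.swap_apply_right]; rfl
      · rw [Equiv.swap_apply_of_ne_of_ne (by simp [Fin.ext_iff]) (by simp [Fin.ext_iff])]
        rfl
    rw [e] at h
    simpa [hD] using h
  have hupd1 : ∀ x y z, (of (Fin.cons x (Fin.cons z w : Fin (n + 1) → Fin (n + 2) → R))).updateRow
      1 y = of (Fin.cons x (Fin.cons y w : Fin (n + 1) → Fin (n + 2) → R)) := by
    intro x y z
    ext i j
    rw [updateRow_apply]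
    refine Fin.cases ?_ (fun i => Fin.cases ?_ (fun i => ?_) i) i
    · rw [if_neg (by simp)]; rfl
    · exact if_pos rfl
    · rw [if_neg (by simp [Fin.ext_iff])]; rfl
  have hupd0 : ∀ x y z, (of (Fin.cons z (Fin.cons x w : Fin (n + 1) → Fin (n + 2) → R))).updateRow
      0 y = of (Fin.cons y (Fin.cons x w : Fin (n + 1) → Fin (n + 2) → R)) := by
    intro x y z
    ext i j
    rw [updateRow_apply]
    refine Fin.cases ?_ (fun i => ?_) i
    · rw [if_pos rfl]; rfl
    · rw [if_neg (Fin.succ_ne_zero _)]; rfl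
  -- L is the linear form y ↦ D(c, y), which vanishes on the rows w. Cramer's rule writes det(N) d
  -- as the combination of the rows of N whose coefficients are the determinants of N with one row
  -- replaced by d. Applying L leaves only the rows a and b, and antisymmetry turns the result into
  -- the three term relation.
  let L : (Fin (n + 2) → R) →ₗ[R] R := LinearMap.proj 1 ∘ₗ
    cramer (of (Fin.cons c (Fin.cons 0 w : Fin (n + 1) → Fin (n + 2) → R)))ᵀ
  have hLD : ∀ y, L y = D c y := fun y => by
    change cramer _ y 1 = _
    rw [cramer_transpose_apply, hupd1]
  have hLw : ∀ k, L (w k) = 0 := fun k => by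
    rw [hLD]
    exact det_zero_of_row_eq (i := 1) (j := k.succ.succ) (by simp [Fin.ext_iff]) rfl
  have hL := congrArg L (mulVec_cramer Nᵀ d)
  rw [det_transpose, map_smul, mulVec_transpose, vecMul_eq_sum, map_sum, Fin.sum_univ_succ,
    Fin.sum_univ_succ, Finset.sum_eq_zero fun k _ => (by
      rw [map_smul]
      exact (congrArg _ (hLw k)).trans (smul_zero _)), add_zero, map_smul, map_smul,
    cramer_transpose_apply, cramer_transpose_apply, hN, hupd0] at hL
  have e1 : (Fin.succ 0 : Fin (n + 2)) = 1 := rfl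
  rw [e1, hupd1] at hL
  change D d b • L a + D a d • L b = D a b • L d at hL
  rw [hLD, hLD, hLD, smul_eq_mul, smul_eq_mul, smul_eq_mul] at hL
  change D a b * D c d - D a c * D b d + D a d * D b c = 0
  rw [hswap d b, hswap c a, hswap c b] at hL
  linear_combination -hL

end Matrix

namespace Matroid

open Matrix

section Sgn

variable {E : Type u} [LinearOrder E] (ι : E → ℤ)

/-- The sign of a tuple, which is `0` if the tuple is not injective. -/
def tupleSign {r : ℕ} (v : Fin r → E) : ℤ := Int.sign (vandermonde fun k => ι (v k)).det

lemma tupleSign_comp {r : ℕ} (v : Fin r → E) (σ : Equiv.Perm (Fin r)) :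
    tupleSign ι (v ∘ σ) = (Equiv.Perm.sign σ : ℤ) * tupleSign ι v := by
  have h : vandermonde (fun k => ι ((v ∘ σ) k)) =
      (vandermonde fun k => ι (v k)).submatrix σ id := rfl
  rw [tupleSign, h, det_permute, Int.sign_mul, tupleSign]
  congr 1
  rcases Int.units_eq_one_or (Equiv.Perm.sign σ) with h | h <;> rw [h] <;> rfl

variable {ι}

lemma tupleSign_of_strictMono (hι : StrictMono ι) {r : ℕ} {v : Fin r → E} (hv : StrictMono v) : tupleSign ι v = 1 := by
  refine Int.sign_eq_one_of_pos ?_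
  rw [det_vandermonde]
  refine Finset.prod_pos fun i _ => Finset.prod_pos fun j hj => ?_
  exact sub_pos.2 (hι (hv (Finset.mem_Ioi.1 hj)))

lemma tupleSign_of_not_injective (ι : E → ℤ) {r : ℕ} {v : Fin r → E} (hv : ¬ Function.Injective v) :
    tupleSign ι v = 0 := by
  rw [tupleSign, Int.sign_eq_zero_iff_zero, det_vandermonde_eq_zero_iff]
  simp only [Function.Injective, not_forall] at hv
  obtain ⟨i, j, h, hij⟩ := hv
  exact ⟨i, j, congrArg ι h, hij⟩

lemma tupleSign_mul_self (hι : StrictMono ι) {r : ℕ} {v : Fin r → E} (hv : Function.Injective v) :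
    tupleSign ι v * tupleSign ι v = 1 := by
  rw [tupleSign, ← Int.sign_mul]
  refine Int.sign_eq_one_of_pos (mul_self_pos.2 ?_)
  rw [det_vandermonde_ne_zero_iff]
  exact hι.injective.comp hv

/-- The Vandermonde product splits into the pair (x, y), the pairs of x or y with the remaining
entries, and the pairs among these. -/
lemma tupleSign_cons {n : ℕ} (x y : E) (v : Fin n → E) :
    tupleSign ι (Fin.cons x (Fin.cons y v : Fin (n + 1) → E) : Fin (n + 2) → E) =
      Int.sign (ι y - ι x) * (∏ k, Int.sign (ι (v k) - ι x)) * (∏ k, Int.sign (ι (v k) - ι y)) *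
        tupleSign ι v := by
  have e1 : (fun k => ι ((Fin.cons x (Fin.cons y v : Fin (n + 1) → E) : Fin (n + 2) → E) k)) =
      (Fin.cons (ι x) (Fin.cons (ι y) fun k => ι (v k) : Fin (n + 1) → ℤ) : Fin (n + 2) → ℤ) := by
    ext k
    refine Fin.cases rfl (fun k => Fin.cases rfl (fun k => rfl) k) k
  have hs : ∀ f : Fin n → ℤ, Int.sign (∏ k, f k) = ∏ k, Int.sign (f k) := fun f =>
    map_prod (⟨⟨Int.sign, rfl⟩, Int.sign_mul⟩ : ℤ →* ℤ) f Finset.univ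
  rw [tupleSign, tupleSign, e1, det_vandermonde, det_vandermonde, Fin.prod_univ_succ,
    Fin.prod_univ_succ]
  simp only [Fin.prod_Ioi_zero, Fin.prod_Ioi_succ, Fin.cons_zero, Fin.cons_succ,
    Fin.prod_univ_succ, Int.sign_mul, hs]
  ring

/-- A function on finite sets as an alternating function on tuples. -/
def onTuple (ι : E → ℤ) {R : Type v} [CommRing R] (D : Finset E → R) {r : ℕ} (v : Fin r → E) : R :=
  (tupleSign ι v : R) * D (Finset.univ.image v)

/-- The maximal minor in the columns `J`. -/
def minor {R : Type v} [CommRing R] {r : ℕ} (A : Matrix (Fin r) E R) (J : Finset E) : R :=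
  if h : J.card = r then (A.submatrix id (J.orderEmbOfFin h)).det else 0

lemma minor_of_card {R : Type v} [CommRing R] {r : ℕ} (A : Matrix (Fin r) E R) {J : Finset E}
    (h : J.card = r) : minor A J = (A.submatrix id (J.orderEmbOfFin h)).det :=
  dif_pos h

/-- Sorting the columns costs the sign of a permutation, which is the sign of the tuple; for a
repeated column both sides vanish. -/
lemma det_submatrix_eq_onTuple {ι : E → ℤ} (hι : StrictMono ι) {R : Type v} [CommRing R] {r : ℕ}
    (A : Matrix (Fin r) E R) (v : Fin r → E) :
    (A.submatrix id v).det = onTuple ι (minor A) v := by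
  by_cases hv : Function.Injective v
  · have hc : (Finset.univ.image v).card = r := by
      rw [Finset.card_image_of_injective _ hv, Finset.card_univ, Fintype.card_fin]
    set s := (Finset.univ.image v).orderEmbOfFin hc with hs
    let e := (Finset.univ.image v).orderIsoOfFin hc
    let σ' : Fin r → Fin r := fun k => e.symm ⟨v k, Finset.mem_image_of_mem v (Finset.mem_univ k)⟩
    have hσ' : Function.Injective σ' := fun k l h =>
      hv (congrArg Subtype.val (e.symm.injective h))
    let σ := Equiv.ofBijective σ' (Finite.injective_iff_bijective.1 hσ')
    have hvs : v = s ∘ σ := funext fun k => by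
      change v k = (e (e.symm _) : E)
      rw [OrderIso.apply_symm_apply]
    have hsign : tupleSign ι v = Equiv.Perm.sign σ := by
      refine (congrArg (tupleSign ι) hvs).trans ?_
      rw [tupleSign_comp, tupleSign_of_strictMono hι s.strictMono, mul_one]
    have hA : A.submatrix id v = (A.submatrix id s).submatrix id σ :=
      congrArg (A.submatrix id) hvs
    rw [onTuple, minor_of_card A hc, hsign, hA, det_permute']
  · rw [onTuple, tupleSign_of_not_injective ι hv, Int.cast_zero, zero_mul]
    simp only [Function.Injective, not_forall] at hv
    obtain ⟨i, j, h, hij⟩ := hv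
    exact det_zero_of_column_eq hij fun k => by rw [submatrix_apply, submatrix_apply, h]

/-- With w the increasing enumeration of I, the tuple (a, b, w) with a < b has sign g(a) g(b). Every
product therefore has the sign g(x) g(y) g(z) g(t), whose square is 1 as the four elements lie
outside I. -/
lemma three_term_of_onTuple {ι : E → ℤ} (hι : StrictMono ι) {R : Type v} [CommRing R]
    (D : Finset E → R) {n : ℕ} (H : ∀ (x y z t : E) (w : Fin n → E),
      onTuple ι D (Fin.cons x (Fin.cons y w : Fin (n + 1) → E) : Fin (n + 2) → E) *
        onTuple ι D (Fin.cons z (Fin.cons t w : Fin (n + 1) → E) : Fin (n + 2) → E) -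
      onTuple ι D (Fin.cons x (Fin.cons z w : Fin (n + 1) → E) : Fin (n + 2) → E) *
        onTuple ι D (Fin.cons y (Fin.cons t w : Fin (n + 1) → E) : Fin (n + 2) → E) +
      onTuple ι D (Fin.cons x (Fin.cons t w : Fin (n + 1) → E) : Fin (n + 2) → E) *
        onTuple ι D (Fin.cons y (Fin.cons z w : Fin (n + 1) → E) : Fin (n + 2) → E) = 0)
    {I : Finset E} (hI : I.card = n) {x y z t : E} (hx : x ∉ I) (hy : y ∉ I) (hz : z ∉ I)
    (ht : t ∉ I) (hxy : x < y) (hyz : y < z) (hzt : z < t) :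
    D (I ∪ {x, y}) * D (I ∪ {z, t}) - D (I ∪ {x, z}) * D (I ∪ {y, t}) +
      D (I ∪ {x, t}) * D (I ∪ {y, z}) = 0 := by
  set w := I.orderEmbOfFin hI
  have himg : ∀ a b, Finset.univ.image
      (Fin.cons a (Fin.cons b w : Fin (n + 1) → E) : Fin (n + 2) → E) = I ∪ {a, b} := by
    intro a b
    ext e
    have hw : e ∈ I ↔ ∃ k, w k = e := by
      rw [← Set.mem_range, Finset.range_orderEmbOfFin, Finset.mem_coe]
    simp only [Finset.mem_image, Finset.mem_univ, true_and, Fin.exists_fin_succ, Fin.cons_zero,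
      Fin.cons_succ, Finset.mem_union, Finset.mem_insert, Finset.mem_singleton, hw]
    tauto
  set g : E → ℤ := fun a => ∏ k, Int.sign (ι (w k) - ι a) with hg
  have hgu : ∀ a, a ∉ I → g a * g a = 1 := by
    intro a ha
    rw [hg, ← Finset.prod_mul_distrib]
    refine Finset.prod_eq_one fun k _ => ?_
    rw [← Int.sign_mul]
    refine Int.sign_eq_one_of_pos (mul_self_pos.2 (sub_ne_zero.2 fun h => ha ?_))
    rw [← hι.injective h]
    exact Finset.orderEmbOfFin_mem I hI k
  have hT : ∀ a b, a < b → onTuple ι D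
      (Fin.cons a (Fin.cons b w : Fin (n + 1) → E) : Fin (n + 2) → E) =
        ((g a * g b : ℤ) : R) * D (I ∪ {a, b}) := by
    intro a b hab
    rw [onTuple, himg, tupleSign_cons, Int.sign_eq_one_of_pos (sub_pos.2 (hι hab)),
      tupleSign_of_strictMono hι w.strictMono, one_mul, mul_one]
  have h := H x y z t w
  rw [hT _ _ hxy, hT _ _ hzt, hT _ _ (hxy.trans hyz), hT _ _ (hyz.trans hzt),
    hT _ _ (hxy.trans (hyz.trans hzt)), hT _ _ hyz] at h
  have hu : ((g x * g x * (g y * g y) * (g z * g z) * (g t * g t) : ℤ) : R) = 1 := by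
    rw [hgu x hx, hgu y hy, hgu z hz, hgu t ht]
    simp
  push_cast at h hu
  linear_combination ((g x : R) * g y * g z * g t) * h - (D (I ∪ {x, y}) * D (I ∪ {z, t}) -
    D (I ∪ {x, z}) * D (I ∪ {y, t}) + D (I ∪ {x, t}) * D (I ∪ {y, z})) * hu

lemma exists_strictMono_int (E : Type u) [LinearOrder E] [Finite E] : ∃ ι : E → ℤ, StrictMono ι := by
  have := Fintype.ofFinite E
  let e := Fintype.orderIsoFinOfCardEq E rfl
  exact ⟨fun x => ((e.symm x : Fin _) : ℕ), fun x y h => by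
    exact Int.ofNat_lt.2 (e.symm.strictMono h)⟩

/-- Maximal minors satisfy the three term Plücker relations. -/
lemma minor_three_term [Finite E] {R : Type v} [CommRing R] {n : ℕ}
    (A : Matrix (Fin (n + 2)) E R) {I : Finset E} (hI : I.card = n) {x y z t : E} (hx : x ∉ I)
    (hy : y ∉ I) (hz : z ∉ I) (ht : t ∉ I) (hxy : x < y) (hyz : y < z) (hzt : z < t) :
    minor A (I ∪ {x, y}) * minor A (I ∪ {z, t}) - minor A (I ∪ {x, z}) * minor A (I ∪ {y, t}) +
      minor A (I ∪ {x, t}) * minor A (I ∪ {y, z}) = 0 := by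
  obtain ⟨ι, hι⟩ := exists_strictMono_int E
  refine three_term_of_onTuple hι (minor A) (fun x y z t w => ?_) hI hx hy hz ht hxy hyz hzt
  simp only [← det_submatrix_eq_onTuple hι]
  have e : ∀ a b, (A.submatrix id (Fin.cons a (Fin.cons b w : Fin (n + 1) → E) :
      Fin (n + 2) → E)).det = (of (Fin.cons (fun i => A i a) (Fin.cons (fun i => A i b)
        fun k i => A i (w k) : Fin (n + 1) → Fin (n + 2) → R))).det := by
    intro a b
    rw [← det_transpose]
    congr 1
    ext k i
    refine Fin.cases rfl (fun k => Fin.cases rfl (fun k => rfl) k) k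
  simp only [e]
  exact det_three_term _ _ _ _ _

end Sgn

end Matroid
end

noncomputable section

/-! ### Representations from weak Grassmann-Plücker functions -/

namespace Matroid

open Matrix

section Representation

variable {E : Type u} [LinearOrder E] [Finite E] {R : Type v} [CommRing R]

lemma threeTerm_minor {r : ℕ} (A : Matrix (Fin r) E R) {I : Finset E} (hr : r = I.card + 2) :
    ThreeTerm I (-1) {0} fun a b => minor A (I ∪ {a, b}) := by
  subst hr
  refine ⟨fun a b => by simp only [Finset.pair_comm], ?_⟩
  intro x y z t hx hy hz ht hxy hyz hzt
  rw [Set.mem_singleton_iff, ← minor_three_term A rfl hx hy hz ht hxy hyz hzt]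
  ring

lemma eq_of_onTuple_eq {ι : E → ℤ} (hι : StrictMono ι) {F G : Finset E → R} {r : ℕ} {v : Fin r → E}
    (hv : Function.Injective v) (h : onTuple ι F v = onTuple ι G v) :
    F (Finset.univ.image v) = G (Finset.univ.image v) := by
  have h1 : (tupleSign ι v : R) * tupleSign ι v = 1 := by
    rw [← Int.cast_mul, tupleSign_mul_self hι hv, Int.cast_one]
  rw [← one_mul (F _), ← one_mul (G _), ← h1, mul_assoc, mul_assoc]
  exact congrArg _ h

variable (B : Finset E)

lemma image_orderEmb {r : ℕ} (J : Finset E) (h : J.card = r) :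
    Finset.univ.image (J.orderEmbOfFin h) = J := by
  rw [← Finset.coe_inj, Finset.coe_image, Finset.coe_univ, Set.image_univ,
    Finset.range_orderEmbOfFin]

lemma image_update_orderEmb {r : ℕ} (J : Finset E) (h : J.card = r) (k : Fin r) (j : E) :
    Finset.univ.image (Function.update (J.orderEmbOfFin h) k j) =
      insert j (J.erase (J.orderEmbOfFin h k)) := by
  ext e
  have hJ : e ∈ J ↔ ∃ l, J.orderEmbOfFin h l = e := by
    rw [← Set.mem_range, Finset.range_orderEmbOfFin, Finset.mem_coe]
  simp only [Finset.mem_image, Finset.mem_univ, true_and, Finset.mem_insert, Finset.mem_erase, hJ]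
  constructor
  · rintro ⟨l, rfl⟩
    by_cases hl : l = k
    · subst hl
      exact Or.inl (Function.update_self ..)
    · rw [Function.update_of_ne hl]
      exact Or.inr ⟨fun h' => hl ((J.orderEmbOfFin h).injective h'), l, rfl⟩
  · rintro (rfl | ⟨h1, l, rfl⟩)
    · exact ⟨k, Function.update_self ..⟩
    · refine ⟨l, Function.update_of_ne ?_ ..⟩
      rintro rfl
      exact h1 rfl

lemma update_injective {α β : Type*} [DecidableEq α] {v : α → β} (hv : Function.Injective v) {k : α}
    {j : β} (hj : ∀ l, l ≠ k → v l ≠ j) : Function.Injective (Function.update v k j) := by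
  intro l m hlm
  by_cases hl : l = k <;> by_cases hm : m = k
  · exact hl.trans hm.symm
  · subst hl
    rw [Function.update_self, Function.update_of_ne hm] at hlm
    exact (hj m hm hlm.symm).elim
  · subst hm
    rw [Function.update_self, Function.update_of_ne hl] at hlm
    exact (hj l hl hlm).elim
  · rw [Function.update_of_ne hl, Function.update_of_ne hm] at hlm
    exact hv hlm

/-- The matrix whose column `j` consists of the values of `D` at the exchanges of an element of `B`
for `j`. -/
def exchangeMatrix (ι : E → ℤ) (D : Finset E → R) : Matrix (Fin B.card) E R := fun i j =>
  onTuple ι D (Function.update (B.orderEmbOfFin rfl) i j)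

variable {B} {ι : E → ℤ} {D : Finset E → R}

lemma exchangeMatrix_base (hι : StrictMono ι) (hD : D B = 1) :
    (exchangeMatrix B ι D).submatrix id (B.orderEmbOfFin rfl) = 1 := by
  ext i j
  rw [submatrix_apply, exchangeMatrix]
  by_cases h : i = j
  · subst h
    rw [id, Function.update_eq_self, one_apply_eq, onTuple, image_orderEmb, hD,
      tupleSign_of_strictMono hι (B.orderEmbOfFin rfl).strictMono, Int.cast_one, mul_one]
  · rw [id, one_apply_ne h, onTuple, tupleSign_of_not_injective, Int.cast_zero, zero_mul]
    intro hinj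
    refine h (hinj ?_)
    rw [Function.update_self, Function.update_of_ne (Ne.symm h)]

/-- The columns B form the identity matrix, and replacing one of them by column j leaves a single
entry of that column as determinant. -/
lemma det_exchangeMatrix_update (hι : StrictMono ι) (hD : D B = 1) (k : Fin B.card) (j : E) :
    ((exchangeMatrix B ι D).submatrix id (Function.update (B.orderEmbOfFin rfl) k j)).det =
      exchangeMatrix B ι D k j := by
  have h : (exchangeMatrix B ι D).submatrix id (Function.update (B.orderEmbOfFin rfl) k j) =
      (1 : Matrix (Fin B.card) (Fin B.card) R).updateCol k fun i => exchangeMatrix B ι D i j := by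
    ext i l
    rw [← exchangeMatrix_base hι hD, updateCol_apply, submatrix_apply, submatrix_apply]
    split_ifs with hl
    · subst hl
      rw [Function.update_self]; rfl
    · rw [Function.update_of_ne hl]
  rw [h, ← cramer_apply, cramer_one]
  rfl

lemma minor_exchangeMatrix_of_card_le (hι : StrictMono ι) (hD : D B = 1) {J : Finset E}
    (hJ : J.card = B.card) (h : (J \ B).card ≤ 1) : minor (exchangeMatrix B ι D) J = D J := by
  rcases BasisFamily.eq_exchange_of_card hJ h with rfl | ⟨i, hi, j, hj, rfl⟩
  · rw [minor_of_card _ rfl, exchangeMatrix_base hι hD, det_one, hD]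
  · have hi' : ∃ k, B.orderEmbOfFin rfl k = i := by
      rw [← Set.mem_range, Finset.range_orderEmbOfFin]; exact hi
    obtain ⟨k, rfl⟩ := hi'
    rw [← image_update_orderEmb]
    refine eq_of_onTuple_eq hι (update_injective (B.orderEmbOfFin rfl).injective fun l _ hl => ?_) ?_
    · exact hj (hl ▸ Finset.orderEmbOfFin_mem B rfl l)
    · rw [← det_submatrix_eq_onTuple hι, det_exchangeMatrix_update hι hD]
      rfl

/-- The exchange property for nonzero maximal minors. -/
lemma minor_exchange (hι : StrictMono ι) {A : Matrix (Fin B.card) E R}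
    (hA : A.submatrix id (B.orderEmbOfFin rfl) = 1) {J : Finset E} (hJ : J.card = B.card)
    (h : minor A J ≠ 0) {a : E} (ha : a ∈ J \ B) :
    ∃ c ∈ B \ J, minor A (insert c (J.erase a)) ≠ 0 := by
  by_contra! hc
  rw [Finset.mem_sdiff] at ha
  have ha' : ∃ k, J.orderEmbOfFin hJ k = a := by
    rw [← Set.mem_range, Finset.range_orderEmbOfFin]; exact ha.1
  obtain ⟨k, rfl⟩ := ha'
  set N := A.submatrix id (J.orderEmbOfFin hJ) with hN
  have hupd : ∀ e, N.updateCol k (fun i => A i e) =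
      A.submatrix id (Function.update (J.orderEmbOfFin hJ) k e) := by
    intro e
    ext i l
    rw [updateCol_apply, submatrix_apply]
    split_ifs with hl
    · subst hl
      rw [Function.update_self]; rfl
    · rw [Function.update_of_ne hl]; rfl
  -- L sends a vector to the determinant of N with column k replaced by it. If all exchanges towards
  -- B had vanishing minors, L would vanish on the columns B of A, which are the unit vectors. But L
  -- at the original column k is the nonzero minor.
  let L : (Fin B.card → R) →ₗ[R] R := LinearMap.proj k ∘ₗ cramer N
  have hL : ∀ e, L (fun i => A i e) =
      (A.submatrix id (Function.update (J.orderEmbOfFin hJ) k e)).det := by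
    intro e
    rw [← hupd, ← cramer_apply]
    rfl
  have hL0 : L = 0 := by
    refine (Pi.basisFun R (Fin B.card)).ext fun l => ?_
    have hl : (Pi.basisFun R (Fin B.card) l) = fun i => A i (B.orderEmbOfFin rfl l) := by
      ext i
      have := congrFun (congrFun hA i) l
      rw [submatrix_apply, id] at this
      rw [this, Pi.basisFun_apply, one_apply, Pi.single_apply]
    rw [hl, hL, det_submatrix_eq_onTuple hι, LinearMap.zero_apply, onTuple]
    have hlB := Finset.orderEmbOfFin_mem B rfl l
    by_cases hlJ : B.orderEmbOfFin rfl l ∈ J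
    · have hm : ∃ m, J.orderEmbOfFin hJ m = B.orderEmbOfFin rfl l := by
        rw [← Set.mem_range, Finset.range_orderEmbOfFin]; exact hlJ
      obtain ⟨m, hm⟩ := hm
      rw [tupleSign_of_not_injective, Int.cast_zero, zero_mul]
      intro hinj
      have hmk : m ≠ k := by
        rintro rfl
        exact ha.2 (hm ▸ hlB)
      refine hmk (hinj ?_)
      rw [Function.update_self, Function.update_of_ne hmk, hm]
    · rw [image_update_orderEmb, hc _ (Finset.mem_sdiff.2 ⟨hlB, hlJ⟩), mul_zero]
  refine h ?_
  rw [minor_of_card A hJ]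
  have := hL (J.orderEmbOfFin hJ k)
  rw [Function.update_eq_self] at this
  rw [← this, hL0, LinearMap.zero_apply]

variable [IsDomain R] {M : Matroid E}

/-- Induction on |J \ B|, where the cases 0 and 1 hold by construction. Otherwise either both sides
vanish at J or one of them is nonzero there. The nonzero one satisfies an exchange property, so two
exchanges yield I ∪ {z, w} with a nonzero value. Both functions satisfy the same signed three term
relation and agree on its other five sets by induction; cancelling the nonzero coefficient in the
domain R gives equality at J. -/
lemma minor_exchangeMatrix_eq_value (hι : StrictMono ι) {f : M.LaurentMonomial →* R}
    (hf : ∀ p, M.plucker f (-1) p = 0) (hB : M.IsBase (B : Set E)) (hfB : M.value f B = 1)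
    {J : Finset E} (hJ : J.card = B.card) :
    minor (exchangeMatrix B ι (M.value f)) J = M.value f J := by
  set A := exchangeMatrix B ι (M.value f) with hA
  have hne : ∀ {J : Finset E}, M.value f J ≠ 0 → M.IsBase (J : Set E) := fun {J} h => by
    by_contra h'
    exact h (value_of_not_base f h')
  have hne' : ∀ {J : Finset E}, M.IsBase (J : Set E) → M.value f J ≠ 0 := fun {J} h => by
    rw [value_of_base f h]
    exact ((Group.isUnit _).map f).ne_zero
  induction hn : (J \ B).card using Nat.strong_induction_on generalizing J with
  | _ n ih =>
  by_cases h2 : 2 ≤ n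
  · by_cases h0 : minor A J = 0 ∧ M.value f J = 0
    · rw [h0.1, h0.2]
    have hJcard : ∀ (J' : Finset E), J'.card = B.card → minor A J' ≠ 0 → ∀ a ∈ J' \ B,
        ∃ c ∈ B \ J', (insert c (J'.erase a)).card = B.card ∧ minor A (insert c (J'.erase a)) ≠ 0 := by
      intro J' hJ' h a ha
      obtain ⟨c, hc, h'⟩ := minor_exchange hι (exchangeMatrix_base hι hfB) hJ' h ha
      refine ⟨c, hc, ?_, h'⟩
      rw [Finset.mem_sdiff] at ha hc
      rw [Finset.card_insert_of_notMem (by simp [hc.2]), Finset.card_erase_add_one ha.1, hJ']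
    have key : ∃ (I : Finset E) (x y z w : E), J = I ∪ {x, y} ∧ x ∉ I ∧ y ∉ I ∧ z ∉ I ∧ w ∉ I ∧
        x ≠ y ∧ x ≠ z ∧ x ≠ w ∧ y ≠ z ∧ y ≠ w ∧ z ≠ w ∧ x ∉ B ∧ y ∉ B ∧ z ∈ B ∧ w ∈ B ∧
        (minor A (I ∪ {z, w}) ≠ 0 ∨ M.value f (I ∪ {z, w}) ≠ 0) := by
      rcases not_and_or.1 h0 with h | h
      · obtain ⟨I, x, y, z, w, h1, h2, h3, h4, h5, h6, h7, h8, h9, h10, h11, h12, h13, h14, h15,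
          h16⟩ := BasisFamily.exists_two_steps (F := fun J => J.card = B.card ∧ minor A J ≠ 0)
            (fun J' h' a ha => hJcard J' h'.1 h'.2 a ha) ⟨hJ, h⟩ (hn ▸ h2)
        exact ⟨I, x, y, z, w, h1, h2, h3, h4, h5, h6, h7, h8, h9, h10, h11, h12, h13, h14, h15,
          Or.inl h16.2⟩
      · obtain ⟨I, x, y, z, w, h1, h2, h3, h4, h5, h6, h7, h8, h9, h10, h11, h12, h13, h14, h15,
          h16⟩ := BasisFamily.exists_two_steps (F := fun J : Finset E => M.IsBase (J : Set E))
            (fun J' h' a ha => M.exchange J' B h' hB a ha) (hne h) (hn ▸ h2)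
        exact ⟨I, x, y, z, w, h1, h2, h3, h4, h5, h6, h7, h8, h9, h10, h11, h12, h13, h14, h15,
          Or.inr (hne' h16)⟩
    obtain ⟨I, x, y, z, w, rfl, hx, hy, hz, hw, hxy, hxz, hxw, hyz, hyw, hzw, hxB, hyB, hzB, hwB,
      hne2⟩ := key
    have hcard : ∀ {a b : E}, a ∉ I → b ∉ I → a ≠ b → (I ∪ {a, b}).card = I.card + 2 := by
      intro a b ha hb hab
      rw [Finset.card_union_of_disjoint (by simp [ha, hb]), Finset.card_pair hab]
    have hr : B.card = I.card + 2 := hJ.symm.trans (hcard hx hy hxy)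
    have c := @BasisFamily.card_sdiff_aux E _ B I
    have n0 := (c hx hy hxy hxB hyB hzB hwB).1
    have hxz' := ih _ (by have := (c hx hy hxy hxB hyB hzB hwB).2.1; omega)
      ((hcard hx hz hxz).trans hr.symm) rfl
    have hxw' := ih _ (by have := (c hx hy hxy hxB hyB hwB hzB).2.1; omega)
      ((hcard hx hw hxw).trans hr.symm) rfl
    have hyz' := ih _ (by have := (c hy hx hxy.symm hyB hxB hzB hwB).2.1; omega)
      ((hcard hy hz hyz).trans hr.symm) rfl
    have hyw' := ih _ (by have := (c hy hx hxy.symm hyB hxB hwB hzB).2.1; omega)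
      ((hcard hy hw hyw).trans hr.symm) rfl
    have hzw' := ih _ (by have := (c hx hy hxy hxB hyB hzB hwB).2.2; omega)
      ((hcard hz hw hzw).trans hr.symm) rfl
    have hzw0 : M.value f (I ∪ {z, w}) ≠ 0 := hne2.elim (fun h => hzw' ▸ h) fun h => h
    obtain ⟨p, q, s, hpqs⟩ := signedThreeTerm I (-1 : R) {0} hx hy hz hw hxy hxz hxw hyz hyw hzw
    have e1 : _ = (0 : R) := hpqs _ (threeTerm_minor A hr)
    have e2 : _ = (0 : R) := hpqs _ (threeTerm_of_plucker (M := M) (f := f)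
      (by rw [hB.eRank_eq, hr]; rfl) hf)
    simp only [hxz', hxw', hyz', hyw', hzw'] at e1
    have e3 : ((-1 : R) ^ p * M.value f (I ∪ {z, w})) * minor A (I ∪ {x, y}) =
        ((-1 : R) ^ p * M.value f (I ∪ {z, w})) * M.value f (I ∪ {x, y}) := by
      linear_combination e1 - e2
    exact mul_left_cancel₀ (mul_ne_zero (pow_ne_zero _ (neg_ne_zero.2 one_ne_zero)) hzw0) e3
  · exact minor_exchangeMatrix_of_card_le hι hfB hJ (by omega)

end Representation

end Matroid
end

/-! ### Universal partial fields of regular and binary matroids -/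

noncomputable section

namespace PartialFieldDatum

/-- The morphism induced by a ring homomorphism that maps `G` to `H`. -/
def ofUnitsMap {A : Type u} {S : Type v} [CommRing A] [CommRing S] {G : Subgroup Aˣ}
    {H : Subgroup Sˣ} (φ : A →+* S) (h : ∀ a ∈ G, Units.map (φ : A →* S) a ∈ H) :
    Hom (ofUnits A G) (ofUnits S H) where
  toMonoidHom := ((Units.map (φ : A →* S)).comp G.subtype).codRestrict H fun a : G => h a.1 a.2
  exists_ringHom := by
    refine ⟨(φ.comp (unitsLift A G).range.subtype).codRestrict (unitsLift S H).range ?_, ?_⟩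
    · rintro ⟨_, x, rfl⟩
      change φ (unitsLift A G x) ∈ _
      induction x using MonoidAlgebra.induction_on with
      | of a =>
        exact ⟨MonoidAlgebra.of ℤ H ⟨_, h a a.2⟩, by rw [unitsLift_of, unitsLift_of]; rfl⟩
      | add x y hx hy => rw [map_add, map_add]; exact add_mem hx hy
      | smul n x hx => rw [map_zsmul, map_zsmul]; exact zsmul_mem hx n
    · intro (a : G)
      apply Subtype.ext
      exact (congrArg φ (unitsLift_of A G a)).trans
        (unitsLift_of S H ⟨_, h a.1 a.2⟩).symm

/-- The homomorphisms φ and ι induce maps between the unit groups; they are mutually inverse because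
φ ∘ ι is the identity and G lies in the image of ι. -/
lemma isomorphic_of_retract {A : Type u} {S : Type v} [CommRing A] [CommRing S] {G : Subgroup Aˣ}
    (φ : A →+* S) (ι : S →+* A) (hφ : ∀ s, φ (ι s) = s) (hι : ∀ s, Units.map (ι : S →* A) s ∈ G)
    (hG : ∀ a ∈ G, ∃ s : S, (a : A) = ι s) : Isomorphic (ofUnits A G) (ofUnits S ⊤) := by
  refine ⟨ofUnitsMap φ fun _ _ => trivial, ofUnitsMap ι fun s _ => hι s, ?_, ?_⟩
  · refine Hom.ext (MonoidHom.ext fun a : G => Subtype.ext (Units.ext ?_))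
    change ι (φ (a.1 : A)) = (a.1 : A)
    obtain ⟨s, hs⟩ := hG a.1 a.2
    exact (congrArg (fun b => ι (φ b)) hs).trans ((congrArg ι (hφ s)).trans hs.symm)
  · refine Hom.ext (MonoidHom.ext fun a => Subtype.ext (Units.ext ?_))
    exact hφ _

end PartialFieldDatum

namespace Matroid

open Matrix

variable {E : Type u} [LinearOrder E] {M : Matroid E}

/-! ### Solutions with a reduction modulo 2 -/

section Signs

variable {R : Type v} [CommRing R] {f : M.LaurentMonomial →* R}

lemma zmod_two_isUnit {a : ZMod 2} (h : IsUnit a) : a = 1 := by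
  revert a
  decide

lemma isUnit_monomial (f : M.LaurentMonomial →* R) (x : M.LaurentMonomial) : IsUnit (f x) :=
  (Group.isUnit x).map f

/-- Modulo 2 every unit becomes 1 and 1 + 1 + 1 ≠ 0, so the three products of a Plücker relation
cannot all be units. The product of the diagonal pair vanishes, and the remaining two terms say that
the cross ratio is ±1. -/
lemma map_crossMon_eq (φ : R →+* ZMod 2) (hf : ∀ p, M.plucker f (-1) p = 0) (t : M.Omega) :
    f (M.crossMon t) = 1 ∨ f (M.crossMon t) = -1 := by
  by_cases h13 : t.i₁ = t.i₃
  · exact Or.inl (by rw [M.crossMon_eq_one t (Or.inl h13), map_one])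
  by_cases h24 : t.i₂ = t.i₄
  · exact Or.inl (by rw [M.crossMon_eq_one t (Or.inr h24), map_one])
  obtain ⟨⟨n1, n2, n3, n4⟩, h12, h23, h34, h41⟩ := t.notMem
  obtain ⟨a, b, c, h⟩ := signedThreeTerm t.I (-1 : R) {0} n1 n2 n3 n4 h12 h13 (Ne.symm h41) h23 h24 h34
  have h : _ = (0 : R) := h _ (threeTerm_of_plucker t.card_I hf)
  have b41 := t.base₄₁
  have hpair : ∀ a b, M.value f (t.I ∪ {a, b}) = M.value f (t.I ∪ {b, a}) := fun a b => by
    rw [Finset.pair_comm]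
  rw [hpair t.i₁ t.i₄, value_of_base f t.base₁₂, value_of_base f t.base₃₄,
    value_of_base f t.base₂₃, value_of_base f t.base₄₁] at h
  have hc : f (M.crossMon t) * (f (M.xMon ⟨_, t.base₄₁⟩) * f (M.xMon ⟨_, t.base₂₃⟩)) =
      f (M.xMon ⟨_, t.base₁₂⟩) * f (M.xMon ⟨_, t.base₃₄⟩) := by
    rw [← map_mul, ← map_mul, ← map_mul, crossMon, mul_comm (M.xMon ⟨_, t.base₄₁⟩), div_mul_cancel]
  have hu : IsUnit (f (M.xMon ⟨_, t.base₄₁⟩) * f (M.xMon ⟨_, t.base₂₃⟩)) :=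
    (isUnit_monomial f _).mul (isUnit_monomial f _)
  have h0 : M.value f (t.I ∪ {t.i₁, t.i₃}) * M.value f (t.I ∪ {t.i₂, t.i₄}) = 0 := by
    by_cases b13 : M.IsBase ((t.I ∪ {t.i₁, t.i₃} : Finset E) : Set E)
    · by_cases b24 : M.IsBase ((t.I ∪ {t.i₂, t.i₄} : Finset E) : Set E)
      · exfalso
        have h' := congrArg φ h
        rw [value_of_base f b13, value_of_base f b24] at h'
        simp only [map_add, map_mul, map_pow, map_zero, map_neg, map_one,
          zmod_two_isUnit ((isUnit_monomial f _).map φ), CharTwo.neg_eq, one_pow, mul_one] at h'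
        exact absurd h' (by decide)
      · rw [value_of_not_base f b24, mul_zero]
    · rw [value_of_not_base f b13, zero_mul]
  rw [h0, mul_zero, add_zero, ← hc] at h
  rcases neg_one_pow_eq_or R a with ha | ha <;> rcases neg_one_pow_eq_or R c with hc' | hc' <;>
    rw [ha, hc'] at h
  · right
    refine hu.mul_right_cancel ?_
    linear_combination h
  · left
    refine hu.mul_right_cancel ?_
    linear_combination h
  · left
    refine hu.mul_right_cancel ?_
    linear_combination -h
  · right
    refine hu.mul_right_cancel ?_
    linear_combination -h

lemma map_crossGroup_eq (φ : R →+* ZMod 2) (hf : ∀ p, M.plucker f (-1) p = 0)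
    {k : M.LaurentMonomial} (hk : k ∈ M.crossGroup) : f k = 1 ∨ f k = -1 := by
  induction hk using Subgroup.closure_induction with
  | mem x hx =>
    obtain ⟨t, rfl⟩ := hx
    exact map_crossMon_eq φ hf t
  | one => exact Or.inl (map_one f)
  | mul x y _ _ hx hy =>
    rw [map_mul]
    rcases hx with hx | hx <;> rcases hy with hy | hy <;> simp [hx, hy]
  | inv x _ hx =>
    have h : f x * f x⁻¹ = 1 := by rw [← map_mul, mul_inv_cancel, map_one]
    rcases hx with hx | hx <;> rw [hx] at h
    · exact Or.inl (by linear_combination h)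
    · exact Or.inr (by linear_combination -h)

/-- As 2 ≠ 0, the elements 1 and -1 are distinct, so the signs are well defined and multiplicative.
-/
lemma exists_sign {G : Type w} [Group G] (f : G →* R) (hf : ∀ k, f k = 1 ∨ f k = -1)
    (h2 : (2 : R) ≠ 0) : ∃ κ : G →* ℤˣ, ∀ k, ((κ k : ℤ) : R) = f k := by
  have hinj : ∀ s t : ℤˣ, ((s : ℤ) : R) = ((t : ℤ) : R) → s = t := by
    intro s t h
    rcases Int.units_eq_one_or s with rfl | rfl <;> rcases Int.units_eq_one_or t with rfl | rfl
    · rfl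
    · refine (h2 ?_).elim
      push_cast at h
      linear_combination h
    · refine (h2 ?_).elim
      push_cast at h
      linear_combination -h
    · rfl
  have hex : ∀ k, ∃ s : ℤˣ, ((s : ℤ) : R) = f k := fun k => by
    rcases hf k with h | h
    · exact ⟨1, by rw [h]; simp⟩
    · exact ⟨-1, by rw [h]; simp⟩
  choose κ hκ using hex
  refine ⟨MonoidHom.mk' κ fun a b => hinj _ _ ?_, hκ⟩
  rw [hκ, map_mul, Units.val_mul, Int.cast_mul, hκ, hκ]

/-- A solution of the Plücker relations that admits a reduction modulo `2` yields a solution in the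
integers if `2 ≠ 0`. -/
lemma exists_plucker_int [Finite E] (φ : R →+* ZMod 2) (hf : ∀ p, M.plucker f (-1) p = 0)
    (h2 : (2 : R) ≠ 0) : ∃ g : M.LaurentMonomial →* ℤ, ∀ p, M.plucker g (-1) p = 0 := by
  obtain ⟨κ, hκ⟩ := exists_sign (f.comp M.crossGroup.subtype)
    (fun k => map_crossGroup_eq φ hf k.2) h2
  let g : M.LaurentMonomial →* ℤ := (Units.coeHom ℤ).comp
    (κ.comp (M.retraction.codRestrict M.crossGroup M.retraction_mem))
  have hg : ((Int.castRingHom R : ℤ →+* R) : ℤ →* R).comp g = f.comp M.retraction :=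
    MonoidHom.ext fun x => hκ ⟨M.retraction x, M.retraction_mem x⟩
  refine ⟨g, fun p => ?_⟩
  -- The integral relation maps to a relation for f ∘ `retraction`, a multiple of one for f. Its
  -- value vanishes in R and hence is even. Each of its three terms is 0 or ±1, so it is 0 or ±2,
  -- and ±2 is nonzero in R.
  have hR : ((M.plucker g (-1) p : ℤ) : R) = 0 := by
    have h := map_plucker (Int.castRingHom R) g (-1) p
    obtain ⟨v, hv⟩ := M.plucker_comp_retraction f (-1) p
    rw [hg, map_neg, map_one, hv, hf, mul_zero] at h
    exact h
  have hdvd : (2 : ℤ) ∣ M.plucker g (-1) p := by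
    have h := congrArg φ hR
    rw [map_intCast, map_zero] at h
    exact (ZMod.intCast_zmod_eq_zero_iff_dvd _ 2).1 h
  have hv : ∀ J, |M.value g J| ≤ 1 := by
    intro J
    by_cases hJ : M.IsBase (J : Set E)
    · rw [value_of_base g hJ, Int.isUnit_iff_abs_eq.1 (isUnit_monomial g _)]
    · rw [value_of_not_base g hJ, abs_zero]
      exact zero_le_one
  have hm : ∀ J J', |M.value g J * M.value g J'| ≤ 1 := fun J J' => by
    rw [abs_mul]
    exact mul_le_one₀ (hv J) (abs_nonneg _) (hv J')
  have h01 := abs_le.1 (hm (p.sub 0 1) (p.sub 2 3))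
  have h02 := abs_le.1 (hm (p.sub 0 2) (p.sub 1 3))
  have h03 := abs_le.1 (hm (p.sub 0 3) (p.sub 1 2))
  have hN : M.plucker g (-1) p = M.value g (p.sub 0 1) * M.value g (p.sub 2 3) +
      -1 * (M.value g (p.sub 0 2) * M.value g (p.sub 1 3)) +
      M.value g (p.sub 0 3) * M.value g (p.sub 1 2) := rfl
  obtain ⟨m, hm'⟩ := hdvd
  have hm1 : m = 0 ∨ m = 1 ∨ m = -1 := by omega
  rcases hm1 with rfl | rfl | rfl
  · exact hm'
  · rw [hm'] at hR
    exact (h2 (by simpa using hR)).elim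
  · rw [hm'] at hR
    exact (h2 (by simpa using hR)).elim

end Signs

/-! ### Representations and solutions of the Plücker relations -/

section Representation

variable [Finite E] {R : Type v} [CommRing R]

/-- Minors at non-bases of size r vanish, so the values of f extended by 0 agree with the minors on
all r-subsets, and the relations for minors apply. -/
lemma plucker_eq_zero_of_isRepresentedBy {r : ℕ} {A : Matrix (Fin r) E R}
    (h : M.IsRepresentedBy A) {f : M.LaurentMonomial →* R}
    (hf : ∀ J : M.Basis, f (M.xMon J) = minor A J.1) (p : M.PluckerIndex) :
    M.plucker f (-1) p = 0 := by
  have hv : ∀ J : Finset E, J.card = r → M.value f J = minor A J := by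
    intro J hJ
    by_cases hb : M.IsBase (J : Set E)
    · rw [value_of_base f hb, hf]
    · rw [value_of_not_base f hb, minor_of_card A hJ]
      by_contra h0
      exact hb ((h J).2 ⟨hJ, Ne.symm h0⟩)
  obtain ⟨B⟩ : Nonempty M.Basis := inferInstance
  have hr : r = p.I.card + 2 := by
    obtain ⟨hB, -⟩ := (h B.1).1 B.2
    have := (IsBase.eRank_eq B.2).symm.trans p.card_I
    rw [hB] at this
    exact_mod_cast this
  have hs : ∀ k l, k ≠ l → M.value f (p.sub k l) = minor A (p.I ∪ {p.i k, p.i l}) := by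
    intro k l hkl
    refine hv _ ?_
    rw [PluckerIndex.sub, Finset.card_union_of_disjoint (by simp [p.notMem]),
      Finset.card_pair (p.ne hkl), hr]
  have h3 : _ = (0 : R) := (threeTerm_minor A hr).2 (p.i 0) (p.i 1) (p.i 2) (p.i 3) (p.notMem 0)
    (p.notMem 1) (p.notMem 2) (p.notMem 3) (p.strictMono (by decide)) (p.strictMono (by decide))
    (p.strictMono (by decide))
  rw [plucker, hs _ _ (by decide), hs _ _ (by decide), hs _ _ (by decide), hs _ _ (by decide),
    hs _ _ (by decide), hs _ _ (by decide)]
  exact h3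

lemma exists_plucker_of_isRepresentedBy {r : ℕ} {A : Matrix (Fin r) E R}
    (h : M.IsRepresentedBy A) (hu : ∀ J : M.Basis, IsUnit (minor A J.1)) :
    ∃ f : M.LaurentMonomial →* R, ∀ p, M.plucker f (-1) p = 0 := by
  refine ⟨(Units.coeHom R).comp (M.monLift fun J => (hu J).unit),
    plucker_eq_zero_of_isRepresentedBy h fun J => ?_⟩
  rw [MonoidHom.comp_apply, monLift_xMon]
  rfl

lemma minor_ne_zero {r : ℕ} {A : Matrix (Fin r) E R} (h : M.IsRepresentedBy A) (J : M.Basis) :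
    minor A J.1 ≠ 0 := by
  obtain ⟨hJ, h0⟩ := (h J.1).1 J.2
  rwa [minor_of_card A hJ]

lemma shift_base (M : Matroid E) : M.shift (M.xMon (Classical.arbitrary M.Basis)) = 1 := by
  change M.xMon (Classical.arbitrary M.Basis) *
    M.rescaling (M.xMon (Classical.arbitrary M.Basis))⁻¹ (fun _ => 1) (M.xMon _) = 1
  rw [rescaling_xMon, Finset.prod_const_one, mul_one, mul_inv_cancel]

lemma plucker_shift_eq_zero {f : M.LaurentMonomial →* R} (hf : ∀ p, M.plucker f (-1) p = 0)
    (p : M.PluckerIndex) : M.plucker (f.comp M.shift) (-1) p = 0 := by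
  obtain ⟨v, hv⟩ := M.plucker_comp_shift f (-1) p
  rw [hv, hf, mul_zero]

lemma value_shift_base (f : M.LaurentMonomial →* R) :
    M.value (f.comp M.shift) (Classical.arbitrary M.Basis).1 = 1 := by
  rw [value_of_base _ (Classical.arbitrary M.Basis).2]
  exact (congrArg f M.shift_base).trans (map_one f)

/-- A representation of `M` given by a solution of the three term Plücker relations. -/
def repMatrix (ι : E → ℤ) (f : M.LaurentMonomial →* R) :
    Matrix (Fin (Classical.arbitrary M.Basis).1.card) E R :=
  exchangeMatrix (Classical.arbitrary M.Basis).1 ι (M.value (f.comp M.shift))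

variable [IsDomain R] {ι : E → ℤ}

lemma minor_repMatrix (hι : StrictMono ι) {f : M.LaurentMonomial →* R}
    (hf : ∀ p, M.plucker f (-1) p = 0) {J : Finset E}
    (hJ : J.card = (Classical.arbitrary M.Basis).1.card) :
    minor (repMatrix ι f) J = M.value (f.comp M.shift) J :=
  minor_exchangeMatrix_eq_value hι (plucker_shift_eq_zero hf) (Classical.arbitrary M.Basis).2
    (value_shift_base f) hJ

lemma isRepresentedBy_repMatrix (hι : StrictMono ι) {f : M.LaurentMonomial →* R}
    (hf : ∀ p, M.plucker f (-1) p = 0) : M.IsRepresentedBy (repMatrix ι f) := by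
  intro J
  constructor
  · intro h
    have hJ := h.card_eq (Classical.arbitrary M.Basis).2
    refine ⟨hJ, ?_⟩
    rw [← minor_of_card _ hJ, minor_repMatrix hι hf hJ, value_of_base _ h]
    exact (isUnit_monomial _ _).ne_zero
  · rintro ⟨hJ, h⟩
    rw [← minor_of_card _ hJ, minor_repMatrix hι hf hJ] at h
    by_contra h'
    exact h (value_of_not_base _ h')

/-- A square submatrix of a matrix that contains an identity matrix has the same determinant as a
square submatrix of maximal size. -/
lemma det_submatrix_extend {r k : ℕ} {A : Matrix (Fin r) E R} {b : Fin r → E}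
    (hA : A.submatrix id b = 1) {g : Fin k → Fin r} (hg : Function.Injective g) (c : Fin k → E) :
    (A.submatrix id (Function.extend g c b)).det = (A.submatrix g c).det := by
  classical
  have hcol : ∀ i j, (∀ l, g l ≠ j) → A i (Function.extend g c b j) = (1 : Matrix _ _ R) i j := by
    intro i j hj
    rw [Function.extend_apply' _ _ _ (by simpa using hj), ← hA]
    rfl
  -- The columns outside the range of g are columns of the identity matrix, so the matrix is block
  -- triangular with an identity block.
  rw [twoBlockTriangular_det' _ (fun i => i ∈ Set.range g) (fun i hi j hj => ?_)]
  · have h1 : (toSquareBlockProp (A.submatrix id (Function.extend g c b))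
        fun i => ¬ i ∈ Set.range g) = 1 := by
      ext i j
      refine (hcol i j fun l hl => j.2 ⟨l, hl⟩).trans ?_
      rw [one_apply, one_apply]
      exact if_congr Subtype.ext_iff.symm rfl rfl
    let e : Fin k ≃ {i // i ∈ Set.range g} := Equiv.ofInjective g hg
    have h2 : (toSquareBlockProp (A.submatrix id (Function.extend g c b))
        fun i => i ∈ Set.range g).submatrix e e = A.submatrix g c := by
      ext i j
      change A (g i) (Function.extend g c b (g j)) = A (g i) (c j)
      rw [hg.extend_apply]
    rw [h1, det_one, mul_one, ← h2, det_submatrix_equiv_self]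
    congr!
  · refine (hcol i j fun l hl => hj ⟨l, hl⟩).trans (one_apply_ne ?_)
    rintro rfl
    exact hj hi

end Representation

/-! ### Regular and binary matroids by solutions in ℤ and 𝔽₂ -/

section Int

variable [Finite E]

lemma mem_range_signType {x : ℤ} (h : x = 0 ∨ IsUnit x) : x ∈ Set.range (SignType.cast : SignType → ℤ) := by
  rcases h with rfl | h
  · exact ⟨0, rfl⟩
  · rcases Int.isUnit_iff.1 h with rfl | rfl
    · exact ⟨1, rfl⟩
    · exact ⟨-1, rfl⟩

/-- Identity columns complete a square submatrix to one of maximal size without changing its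
determinant. Up to sign, such a determinant is the value of f at a monomial, hence ±1, or it is 0.
-/
lemma isTotallyUnimodular_repMatrix {ι : E → ℤ} (hι : StrictMono ι) {f : M.LaurentMonomial →* ℤ}
    (hf : ∀ p, M.plucker f (-1) p = 0) : (repMatrix ι f).IsTotallyUnimodular := by
  intro k g c hg _
  set b := (Classical.arbitrary M.Basis).1.orderEmbOfFin rfl
  set v := Function.extend g c b
  have h0 : ((repMatrix ι f).submatrix id v).det = ((repMatrix ι f).submatrix g c).det :=
    det_submatrix_extend (exchangeMatrix_base hι (value_shift_base f)) hg c
  rw [← h0]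
  refine mem_range_signType ?_
  have h := det_submatrix_eq_onTuple hι (repMatrix ι f) v
  refine h ▸ ?_
  by_cases hv : Function.Injective v
  · have hc : (Finset.univ.image v).card = (Classical.arbitrary M.Basis).1.card := by
      rw [Finset.card_image_of_injective _ hv, Finset.card_univ, Fintype.card_fin]
    rw [onTuple, minor_repMatrix hι hf hc]
    by_cases hb : M.IsBase ((Finset.univ.image v : Finset E) : Set E)
    · right
      rw [value_of_base _ hb]
      exact (IsUnit.of_mul_eq_one _ (tupleSign_mul_self hι hv)).mul (isUnit_monomial _ _)
    · left
      rw [value_of_not_base _ hb, mul_zero]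
  · left
    rw [onTuple, tupleSign_of_not_injective ι hv, Int.cast_zero, zero_mul]

/-- A homomorphism from the group L to ℤ has values ±1. These are the possible nonzero maximal
minors of a totally unimodular matrix. -/
lemma isRegularMatroid_iff_exists_plucker :
    M.IsRegularMatroid ↔ ∃ f : M.LaurentMonomial →* ℤ, ∀ p, M.plucker f (-1) p = 0 := by
  constructor
  · rintro ⟨r, A, hTU, hA⟩
    refine exists_plucker_of_isRepresentedBy hA fun J => ?_
    obtain ⟨hJ, h0⟩ := (hA J.1).1 J.2
    rw [minor_of_card A hJ]
    obtain ⟨s, hs⟩ := hTU r id (J.1.orderEmbOfFin hJ) Function.injective_id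
      (J.1.orderEmbOfFin hJ).injective
    rw [← hs] at h0 ⊢
    revert h0
    cases s <;> simp
  · rintro ⟨f, hf⟩
    obtain ⟨ι, hι⟩ := exists_strictMono_int E
    exact ⟨_, _, isTotallyUnimodular_repMatrix hι hf, isRepresentedBy_repMatrix hι hf⟩

lemma isBinaryMatroid_iff_exists_plucker :
    M.IsBinaryMatroid ↔ ∃ f : M.LaurentMonomial →* ZMod 2, ∀ p, M.plucker f (-1) p = 0 := by
  constructor
  · rintro ⟨r, A, hA⟩
    exact exists_plucker_of_isRepresentedBy hA fun J => isUnit_iff_ne_zero.2 (minor_ne_zero hA J)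
  · rintro ⟨f, hf⟩
    obtain ⟨ι, hι⟩ := exists_strictMono_int E
    exact ⟨_, _, isRepresentedBy_repMatrix hι hf⟩

end Int

/-! ### Recognizing the universal partial field -/

section Universal

variable [Finite E]

/-- The retraction followed by K → R_P is a solution in the ambient ring: inside B_M it is a
rescaling of the canonical one. Any ring homomorphism transports it to S. -/
lemma exists_plucker_of_universal {S : Type v} [CommRing S]
    (ψ : M.universalPartialField.R →+* S) :
    ∃ f : M.LaurentMonomial →* S, ∀ p, M.plucker f (-1) p = 0 := by
  let f : M.LaurentMonomial →* M.universalPartialField.R :=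
    ((M.universalPartialField.π : _ →* _).comp (MonoidAlgebra.of ℤ _)).comp M.toUniversal
  have hf : ∀ p, M.plucker f (-1) p = 0 := by
    intro p
    obtain ⟨v, hv⟩ := M.plucker_comp_retraction M.bracketMk (-1) p
    rw [plucker_bracketMk, mul_zero] at hv
    refine M.unitsSubtype_injective M.crossRatioUnits ?_
    refine (map_plucker _ _ _ _).trans (Eq.trans ?_ (map_zero _).symm)
    refine Eq.trans ?_ hv
    have h1 : M.unitsSubtype M.crossRatioUnits (-1) = -1 := (map_neg _ _).trans (by rw [map_one])
    have h2 : MonoidHom.comp (M.unitsSubtype M.crossRatioUnits).toMonoidHom f =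
        M.bracketMk.comp M.retraction :=
      MonoidHom.ext fun x => M.universalCoe_one ⟨M.retraction x, M.retraction_mem x⟩
    exact congrArg₂ (fun a b => M.plucker a b p) h2 h1
  refine ⟨(ψ : _ →* S).comp f, fun p => ?_⟩
  have h := map_plucker ψ f (-1) p
  rw [hf, map_zero, map_neg, map_one] at h
  exact h.symm

lemma exists_ringHom_of_isomorphic {S : Type v} [CommRing S] {H : Subgroup Sˣ}
    (h : M.universalPartialField.Isomorphic (PartialFieldDatum.ofUnits S H)) :
    Nonempty (M.universalPartialField.R →+* S) := by
  obtain ⟨f, -⟩ := h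
  obtain ⟨g, -⟩ := f.exists_ringHom
  exact ⟨(PartialFieldDatum.unitsLift S H).range.subtype.comp g⟩

lemma crossRatioUnits_coe_eq (φ : M.BracketRing →+* ZMod 2) {a : M.BracketRingˣ}
    (ha : a ∈ M.crossRatioUnits) : (a : M.BracketRing) = 1 ∨ (a : M.BracketRing) = -1 := by
  obtain ⟨k, hk⟩ := M.exists_of_crossRatioUnits ⟨a, ha⟩
  have hk' : a = M.signedUnit (M.crossZero k) := congrArg Subtype.val hk
  have hc := map_crossGroup_eq φ M.plucker_bracketMk k.2.2
  obtain ⟨s, k⟩ := k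
  rcases Int.units_eq_one_or s with rfl | rfl
  · have e : (a : M.BracketRing) = M.bracketMk k :=
      congrArg Units.val (hk'.trans (M.signedUnit_one k.1))
    exact hc.imp e.trans e.trans
  · have e : (a : M.BracketRing) = -M.bracketMk k :=
      congrArg Units.val (hk'.trans (M.signedUnit_neg_one k.1))
    exact hc.symm.imp (fun h => e.trans ((congrArg Neg.neg h).trans (neg_neg _)))
      fun h => e.trans (congrArg Neg.neg h)

/-- The solution makes ℤ a retract of B_M. Reducing modulo 2 shows that all cross ratios are ±1, so
the unit group of ℙ_M lies in the image of ℤ. -/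
lemma isomorphic_regular_of_plucker {f : M.LaurentMonomial →* ℤ}
    (hf : ∀ p, M.plucker f (-1) p = 0) :
    M.universalPartialField.Isomorphic regularPartialField := by
  refine PartialFieldDatum.isomorphic_of_retract (M.bracketLift f hf)
    (Int.castRingHom M.BracketRing) (fun s => by simp) (fun s => ?_) fun a ha => ?_
  · rcases Int.units_eq_one_or s with rfl | rfl
    · rw [map_one]; exact one_mem _
    · have h : Units.map (Int.castRingHom M.BracketRing : ℤ →* M.BracketRing) (-1) = -1 :=
        Units.ext ((map_neg (Int.castRingHom M.BracketRing) 1).trans (by rw [map_one]; rfl))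
      rw [h]
      exact M.neg_one_mem_crossRatioUnits
  · rcases crossRatioUnits_coe_eq ((Int.castRingHom (ZMod 2)).comp (M.bracketLift f hf)) ha
      with h | h
    · exact ⟨1, h.trans (map_one (Int.castRingHom M.BracketRing)).symm⟩
    · exact ⟨-1, h.trans ((map_neg (Int.castRingHom M.BracketRing) 1).trans
        (by rw [map_one])).symm⟩

lemma isomorphic_F2_of_plucker {f : M.LaurentMonomial →* ZMod 2}
    (hf : ∀ p, M.plucker f (-1) p = 0) (h2 : (2 : M.BracketRing) = 0) :
    M.universalPartialField.Isomorphic partialFieldF2 := by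
  have := (M.bracketLift f hf).domain_nontrivial
  have : CharP M.BracketRing 2 := CharTwo.of_one_ne_zero_of_two_eq_zero one_ne_zero h2
  refine PartialFieldDatum.isomorphic_of_retract (M.bracketLift f hf)
    (ZMod.castHom dvd_rfl M.BracketRing) (fun s => ?_) (fun s => ?_) fun a ha => ?_
  · exact DFunLike.congr_fun (Subsingleton.elim ((M.bracketLift f hf).comp
      (ZMod.castHom dvd_rfl M.BracketRing)) (RingHom.id (ZMod 2))) s
  · have hs : s = 1 := Units.ext (zmod_two_isUnit s.isUnit)
    rw [hs, map_one]
    exact one_mem _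
  · refine ⟨1, Eq.trans ?_ (map_one (ZMod.castHom dvd_rfl M.BracketRing)).symm⟩
    rcases crossRatioUnits_coe_eq (M.bracketLift f hf) ha with h | h
    · exact h
    · exact h.trans (CharTwo.neg_eq 1)

lemma isRegularMatroid_iff :
    M.IsRegularMatroid ↔ M.universalPartialField.Isomorphic regularPartialField := by
  rw [isRegularMatroid_iff_exists_plucker]
  constructor
  · rintro ⟨f, hf⟩
    exact isomorphic_regular_of_plucker hf
  · intro h
    obtain ⟨ψ⟩ := exists_ringHom_of_isomorphic h
    exact exists_plucker_of_universal ψ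

lemma isBinaryMatroid_iff : M.IsBinaryMatroid ↔
    (M.universalPartialField.Isomorphic regularPartialField ∨
      M.universalPartialField.Isomorphic partialFieldF2) := by
  rw [isBinaryMatroid_iff_exists_plucker]
  constructor
  · rintro ⟨f, hf⟩
    -- In characteristic 2 the signs collapse and 𝔽₂ is a retract of B_M. If 2 ≠ 0, the canonical
    -- solution in B_M descends to ℤ by `exists_plucker_int`.
    by_cases h2 : (2 : M.BracketRing) = 0
    · exact Or.inr (isomorphic_F2_of_plucker hf h2)
    · obtain ⟨g, hg⟩ := exists_plucker_int (M.bracketLift f hf) M.plucker_bracketMk h2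
      exact Or.inl (isomorphic_regular_of_plucker hg)
  · rintro (h | h)
    · obtain ⟨ψ⟩ := exists_ringHom_of_isomorphic h
      exact exists_plucker_of_universal ((Int.castRingHom (ZMod 2)).comp ψ)
    · obtain ⟨ψ⟩ := exists_ringHom_of_isomorphic h
      exact exists_plucker_of_universal ψ

end Universal

end Matroid
end

theorem mainTheorem12 {E : Type u} [Finite E] [LinearOrder E] (M : Matroid E)
    (hM : M.E = Set.univ) :
    ∃ (θ : OrderedBlueprint.Iso M.weakUniversalPastureSq M.partialBracketField.blpr)
      (θf : OrderedBlueprint.Iso M.foundationSq M.universalPartialField.blpr),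
      -- `θ` is the canonical isomorphism, which maps `(x_I / x_J) ⊗ 1` to `x_I / x_J`
      (∀ I J : M.Basis,
        θ.hom.toRingHom (M.toWeakUniversalPastureSq.toRingHom (M.xRatio I J)) =
          (M.partialBracketField.toBlpr (M.bracketRatio I J) :
            M.partialBracketField.blpr.carrier)) ∧
      -- `θf` is the restriction of `θ`
      (∀ a : M.foundation.carrier,
        M.universalPartialFieldIncl.blpr.toRingHom
            (θf.hom.toRingHom (M.toFoundationSq.toRingHom a)) =
          θ.hom.toRingHom
            (M.toWeakUniversalPastureSq.toRingHom (M.foundationIncl.toRingHom a))) ∧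
      -- the universal partial field is a partial field whenever the bracket ring is not trivial
      (Nontrivial M.BracketRing → M.universalPartialField.IsPartialField) ∧
      -- the natural bijections
      (∃ (e₁ : ∀ P : PartialField.{v},
            M.RescalingClass P.oblpr ≃ OrderedBlueprint.Hom M.foundation P.oblpr)
          (e₂ : ∀ P : PartialField.{v},
            OrderedBlueprint.Hom M.foundation P.oblpr ≃
              OrderedBlueprint.Hom M.foundationSq P.blpr)
          (e₃ : ∀ P : PartialField.{v},
            OrderedBlueprint.Hom M.foundationSq P.blpr ≃
              PartialFieldDatum.Hom M.universalPartialField P.toPartialFieldDatum),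
          (∀ (P : PartialField.{v}) (D : M.WeakGPFunction P.oblpr),
            ∃ χ : OrderedBlueprint.Hom M.weakUniversalPasture P.oblpr,
              (∀ I J : M.Basis,
                χ.toRingHom (M.xRatio I J) * (D.Δ J.1 : P.oblpr.carrier) = D.Δ I.1) ∧
              e₁ P (Matroid.RescalingClass.mk D) = χ.comp M.foundationIncl) ∧
          (∀ (P : PartialField.{v}) (f : OrderedBlueprint.Hom M.foundation P.oblpr),
            (e₂ P f).comp M.toFoundationSq = P.oblprToBlpr.comp f) ∧
          (∀ (P : PartialField.{v}) (g : OrderedBlueprint.Hom M.foundationSq P.blpr),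
            (e₃ P g).blpr.comp θf.hom = g) ∧
          (∀ (P Q : PartialField.{v})
            (φ : PartialFieldDatum.Hom P.toPartialFieldDatum Q.toPartialFieldDatum),
            (∀ c : M.RescalingClass P.oblpr,
              e₁ Q (Matroid.RescalingClass.map φ.oblpr c) = φ.oblpr.comp (e₁ P c)) ∧
            (∀ f : OrderedBlueprint.Hom M.foundation P.oblpr,
              e₂ Q (φ.oblpr.comp f) = φ.blpr.comp (e₂ P f)) ∧
            (∀ g : OrderedBlueprint.Hom M.foundationSq P.blpr,
              e₃ Q (φ.blpr.comp g) = φ.comp (e₃ P g)))) ∧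
      -- regular and binary matroids
      (M.IsRegularMatroid ↔ M.universalPartialField.Isomorphic regularPartialField) ∧
      (M.IsBinaryMatroid ↔
        (M.universalPartialField.Isomorphic regularPartialField ∨
          M.universalPartialField.Isomorphic partialFieldF2)) := by
  exact ⟨M.theta, M.thetaFound, M.theta_xRatio, M.thetaFound_compat,
    fun _ => M.universalPartialField_isPartialField,
    ⟨fun P => M.classEquiv P, fun P => M.sqEquiv P, fun P => M.universalEquiv P,
      fun P D => ⟨D.hom, D.hom_xRatio, rfl⟩, fun P f => M.homToSq_comp P f,
      fun P g => M.universalEquiv_blpr P g,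
      fun P Q φ => ⟨M.classEquiv_natural φ, M.sqEquiv_natural φ, M.universalEquiv_natural φ⟩⟩,
    Matroid.isRegularMatroid_iff, Matroid.isBinaryMatroid_iff⟩
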